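/- Theorem 6.1 (density of the limiting spectral distribution for identity covariance). Let $c\in(0,\infty)$. For each $n\ge 1$ let $p=p(n)$ with $p/n\to c$, and let $Z_1=Z_1^{(n)},Z_2=Z_2^{(n)}$ be random $p\times n$ complex matrices whose entries $z_{ij}^{(k)}$ ($k=1,2$) are, for each $n$, all independent with $\mathbb{E}z_{ij}^{(k)}=0$ and $\mathbb{E}|z_{ij}^{(k)}|^2=1$, and such that $\sup_{n,k,i,j}\mathbb{E}|z_{ij}^{(k)}|^{2+\eta_0}<\infty$ for some $\eta_0>0$. Put $S_n=\frac1n(Z_1Z_2^*-Z_2Z_1^*)$, a skew-Hermitian matrix with eigenvalues $\mathrm{i}\lambda_1,\dots,\mathrm{i}\lambda_p$, and identify distributions on $\mathrm{i}\mathbb{R}$ with distributions on $\mathbb{R}$ via $\mathrm{i}t\leftrightarrow t$, so that the empirical spectral distribution of $S_n$ is $\frac1p\sum_{j}\delta_{\lambda_j}$. Then there is a probability distribution on $\mathbb{R}$, depending only on $c$, to which the empirical spectral distribution of $S_n$ converges weakly almost surely, for every such choice of $p(n),Z_1,Z_2$. Its distribution function $F_c$ has the following properties. Define $$r_1=-\frac{c+1}{3c^3},\quad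 r_3=-\frac{(c-2)^3}{27c^3},\quad d_0=\frac1{27c^6},\quad d_2=\frac{2c^2+10c-1}{27c^6},\quad d_4=\frac{(c-2)^3}{27c^5},$$ $$R(z)=\frac{r_1}{z}+\frac{r_3}{z^3}\ (z\in\mathbb{C}\setminus\{0\}),\qquad R_\pm=\frac{d_2\pm\sqrt{d_2^2-4d_0d_4}}{2d_0},$$ $$L_c=\sqrt{R_-\mathbf{1}_{\{R_->0\}}},\qquad U_c=\sqrt{R_+},\qquad S_c=(-U_c,-L_c)\cup(L_c,U_c),$$ and for real $x\ne0$ $$r(x)=\lim_{\epsilon\downarrow0}R(-\epsilon+\mathrm{i}x),\qquad d(x)=d_0-\frac{d_2}{x^2}+\frac{d_4}{x^4},\qquad V_\pm(x)=|r(x)|\pm\sqrt{-d(x)}\ \text{ (for } x\in S_c).$$ (a) $F_c$ is differentiable at every $x\neq0$, with derivative $$f_c(x)=\frac{\sqrt3}{2\pi}\Big(V_+(x)^{1/3}-V_-(x)^{1/3}\Big)\mathbf{1}_{\{x\in S_c\}}.$$ (b) $F_c$ is differentiable at $x=0$ if and only if $0<c<2$, and in that case $f_c(0)=F_c'(0)=\dfrac{1}{\pi\sqrt{2c-c^2}}$.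 (c) The density $f_c=F_c'$ is continuous at every point where it exists. -/

import Mathlib

open MeasureTheory ProbabilityTheory Filter Topology
open scoped NNReal ENNReal BoundedContinuousFunction

noncomputable section

namespace CommutatorLSD

/-! ### The random matrix model -/

/-- The sample commutator matrix `n⁻¹ (X₁ X₂ᴴ - X₂ X₁ᴴ)` of two `p × n` data matrices. -/
def sampleCommutator {p n : ℕ} (X₁ X₂ : Matrix (Fin p) (Fin n) ℂ) : Matrix (Fin p) (Fin p) ℂ :=
  (n : ℂ)⁻¹ • (X₁ * X₂.conjTranspose - X₂ * X₁.conjTranspose)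

theorem sampleCommutator_conjTranspose {p n : ℕ} (X₁ X₂ : Matrix (Fin p) (Fin n) ℂ) :
    (sampleCommutator X₁ X₂).conjTranspose = -sampleCommutator X₁ X₂ := by
  simp [sampleCommutator, Matrix.conjTranspose_smul, Matrix.conjTranspose_sub,
    Matrix.conjTranspose_mul, ← smul_neg]

theorem isHermitian_neg_I_smul {p : ℕ} {S : Matrix (Fin p) (Fin p) ℂ}
    (hS : S.conjTranspose = -S) : ((-Complex.I) • S).IsHermitian := by
  simp [Matrix.IsHermitian, Matrix.conjTranspose_smul, hS]

/-- The empirical spectral distribution of a skew-Hermitian matrix `S` whose eigenvalues are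
`i λ₁, …, i λ_p`. Distributions on the imaginary axis are identified with distributions on `ℝ`
through `i t ↔ t`, so this is `p⁻¹ ∑ⱼ δ_{λⱼ}`, where the `λⱼ` are the eigenvalues (with
multiplicity) of the Hermitian matrix `-i S`. -/
def skewESD {p : ℕ} (S : Matrix (Fin p) (Fin p) ℂ) (hS : S.conjTranspose = -S) : Measure ℝ :=
  (p : ℝ≥0∞)⁻¹ • ∑ j : Fin p, Measure.dirac ((isHermitian_neg_I_smul hS).eigenvalues j)

/-- Weak convergence (convergence in distribution) of a sequence of measures on `ℝ`. -/
def WeaklyTendsto (μ : ℕ → Measure ℝ) (ν : Measure ℝ) : Prop :=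
  ∀ f : ℝ →ᵇ ℝ, Tendsto (fun n => ∫ x, f x ∂(μ n)) atTop (𝓝 (∫ x, f x ∂ν))

/-- The assumptions on the innovations: for every `n` there are two random `p n × n` complex
matrices `Z n 0`, `Z n 1`, all of whose entries together are independent, with zero mean, unit
variance, and absolute moments of some order `2 + η > 2` that are bounded uniformly in all
indices. Nothing is assumed about the joint law for different values of `n`. -/
structure IsInnovationArray {Ω : Type*} [MeasurableSpace Ω] (P : Measure Ω) (p : ℕ → ℕ)
    (Z : (n : ℕ) → Fin 2 → Ω → Matrix (Fin (p n)) (Fin n) ℂ) : Prop where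
  measurable_entry : ∀ n k i j, Measurable fun ω => Z n k ω i j
  indep : ∀ n, iIndepFun
    (fun (e : Fin 2 × Fin (p n) × Fin n) (ω : Ω) => Z n e.1 ω e.2.1 e.2.2) P
  mean_zero : ∀ n k i j, ∫ ω, Z n k ω i j ∂P = 0
  variance_one : ∀ n k i j, ∫ ω, ‖Z n k ω i j‖ ^ 2 ∂P = 1
  moment_bound : ∃ η : ℝ, 0 < η ∧ ∃ M : ℝ≥0, ∀ n k i j,
    ∫⁻ ω, ‖Z n k ω i j‖ₑ ^ (2 + η) ∂P ≤ M

/-- `F` is the limiting spectral distribution of the commutator matrices with identity covariance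
for the array `Z`: almost surely the empirical spectral distributions of
`n⁻¹ (Z₁ Z₂ᴴ - Z₂ Z₁ᴴ)` converge weakly to `F`. -/
def IsLSD {Ω : Type*} [MeasurableSpace Ω] (P : Measure Ω) (p : ℕ → ℕ)
    (Z : (n : ℕ) → Fin 2 → Ω → Matrix (Fin (p n)) (Fin n) ℂ) (F : Measure ℝ) : Prop :=
  ∀ᵐ ω ∂P, WeaklyTendsto
    (fun n => skewESD (sampleCommutator (Z n 0 ω) (Z n 1 ω))
      (sampleCommutator_conjTranspose (Z n 0 ω) (Z n 1 ω))) F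

/-! ### The explicit parameters of the density -/

def r₁ (c : ℝ) : ℝ := -(c + 1) / (3 * c ^ 3)
def r₃ (c : ℝ) : ℝ := -(c - 2) ^ 3 / (27 * c ^ 3)
def d₀ (c : ℝ) : ℝ := 1 / (27 * c ^ 6)
def d₂ (c : ℝ) : ℝ := (2 * c ^ 2 + 10 * c - 1) / (27 * c ^ 6)
def d₄ (c : ℝ) : ℝ := (c - 2) ^ 3 / (27 * c ^ 5)

/-- `R(z) = r₁ / z + r₃ / z³` for complex `z ≠ 0`. -/
def R (c : ℝ) (z : ℂ) : ℂ := (r₁ c : ℂ) / z + (r₃ c : ℂ) / z ^ 3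

/-- `r(x)` for real `x ≠ 0`: the limit of `R(-ε + i x)` as `ε ↓ 0`, which is `R(i x)`
(see `tendsto_R`). -/
def r (c x : ℝ) : ℂ := R c (Complex.I * x)

theorem tendsto_R (c : ℝ) {x : ℝ} (hx : x ≠ 0) :
    Tendsto (fun ε : ℝ => R c (-(ε : ℂ) + Complex.I * x)) (𝓝[>] 0) (𝓝 (r c x)) := by
  have hne : (-((0 : ℝ) : ℂ) + Complex.I * x) ≠ 0 := by simp [hx]
  have hcont : ContinuousAt (fun ε : ℝ => R c (-(ε : ℂ) + Complex.I * x)) 0 := by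
    unfold R
    refine ContinuousAt.add (ContinuousAt.div (by fun_prop) (by fun_prop) hne)
      (ContinuousAt.div (by fun_prop) (by fun_prop) (pow_ne_zero 3 hne))
  have h := hcont.tendsto.mono_left (nhdsWithin_le_nhds (s := Set.Ioi (0 : ℝ)))
  simpa [r] using h

/-- `d(x) = d₀ - d₂ / x² + d₄ / x⁴` for real `x ≠ 0`. -/
def d (c x : ℝ) : ℝ := d₀ c - d₂ c / x ^ 2 + d₄ c / x ^ 4

def Rplus (c : ℝ) : ℝ := (d₂ c + √(d₂ c ^ 2 - 4 * d₀ c * d₄ c)) / (2 * d₀ c)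
def Rminus (c : ℝ) : ℝ := (d₂ c - √(d₂ c ^ 2 - 4 * d₀ c * d₄ c)) / (2 * d₀ c)

/-- `L_c`: the square root of `R₋` if `R₋ > 0`, and `0` otherwise. -/
def L (c : ℝ) : ℝ := √(if 0 < Rminus c then Rminus c else 0)

def U (c : ℝ) : ℝ := √(Rplus c)

/-- `S_c = (-U_c, -L_c) ∪ (L_c, U_c)`. -/
def S (c : ℝ) : Set ℝ := Set.Ioo (-U c) (-L c) ∪ Set.Ioo (L c) (U c)

def Vplus (c x : ℝ) : ℝ := ‖r c x‖ + √(-d c x)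
def Vminus (c x : ℝ) : ℝ := ‖r c x‖ - √(-d c x)

/-- The density `f_c(x) = (√3 / (2π)) (V₊(x)^{1/3} - V₋(x)^{1/3}) 1_{x ∈ S_c}` off the origin. -/
def density (c : ℝ) : ℝ → ℝ :=
  (S c).indicator fun x =>
    √3 / (2 * Real.pi) * (Vplus c x ^ (1 / 3 : ℝ) - Vminus c x ^ (1 / 3 : ℝ))

end CommutatorLSD

end

/-!
Let `m` be the Stieltjes transform of the empirical spectral distribution of `-i S_n`. Removing
one pair of columns changes the matrix by rank two; since quadratic forms in an independent pair of
columns concentrate around traces (two plus `η` moments suffice, after truncation), `m` solves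
`1 + z m + 2 κ m² / (1 - (κ m)²) = 0` with `κ = p / n` up to an error of vanishing expectation. The
bounded differences inequality and the Borel–Cantelli lemma make the error vanish almost surely.
Along a subsequence the spectral distributions converge by tightness, and the Stieltjes transform
of any limit is a root of the cubic `(1 + z m) (1 - c² m²) + 2 c m² = 0`.

Such a limit `F` is unique: on the real axis off the origin, Cardano's formula identifies the
imaginary part of the boundary values of `m`, so Stieltjes inversion determines the density there,
and the mass at the origin is what is left over. Applied to matrices of random signs the argument
also produces `F`. At the origin the density formula has the limit `1 / (π √(2c - c²))` if `c < 2`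
and is unbounded if `c = 2`, while for `c > 2` the distribution `F` has an atom.
-/

noncomputable section

namespace CommutatorLSD

open Complex (I)
open scoped Real ComplexConjugate

/-! ### Stieltjes transforms -/

section StieltjesTransform

/-- The Stieltjes transform `z ↦ ∫ (x - z)⁻¹ dμ(x)`: the complex resolvent transform of a measure on
the real line. -/
abbrev stieltjes (μ : Measure ℝ) (z : ℂ) : ℂ := resolventTransform μ z

variable {z : ℂ}

lemma stieltjes_apply (μ : Measure ℝ) (z : ℂ) : stieltjes μ z = ∫ x : ℝ, ((x : ℂ) - z)⁻¹ ∂μ := by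
  simp [resolventTransform_apply, resolvent, Ring.inverse_eq_inv']

lemma ofReal_sub_ne_zero (hz : 0 < z.im) (x : ℝ) : (x : ℂ) - z ≠ 0 := by
  intro h
  rw [← sub_eq_zero.1 h, Complex.ofReal_im] at hz
  exact hz.false

lemma norm_inv_ofReal_sub_le (hz : 0 < z.im) (x : ℝ) : ‖((x : ℂ) - z)⁻¹‖ ≤ z.im⁻¹ := by
  rw [norm_inv]
  refine inv_anti₀ hz ?_
  simpa [abs_of_pos hz] using Complex.abs_im_le_norm ((x : ℂ) - z)

lemma im_inv_ofReal_sub (x : ℝ) (z : ℂ) :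
    (((x : ℂ) - z)⁻¹).im = z.im / ((x - z.re) ^ 2 + z.im ^ 2) := by
  simp [Complex.inv_im, Complex.normSq_apply, ← sq]

lemma continuous_inv_ofReal_sub (hz : 0 < z.im) : Continuous fun x : ℝ => ((x : ℂ) - z)⁻¹ :=
  Continuous.inv₀ (by fun_prop) (ofReal_sub_ne_zero hz)

lemma integrable_inv_ofReal_sub (μ : Measure ℝ) [IsFiniteMeasure μ] (hz : 0 < z.im) :
    Integrable (fun x : ℝ => ((x : ℂ) - z)⁻¹) μ :=
  Integrable.of_bound (continuous_inv_ofReal_sub hz).aestronglyMeasurable z.im⁻¹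
    (ae_of_all _ (norm_inv_ofReal_sub_le hz))

lemma norm_stieltjes_le (μ : Measure ℝ) [IsProbabilityMeasure μ] (hz : 0 < z.im) :
    ‖stieltjes μ z‖ ≤ z.im⁻¹ := by
  simpa [stieltjes_apply] using norm_integral_le_of_norm_le_const (μ := μ)
    (ae_of_all _ (norm_inv_ofReal_sub_le hz))

lemma tendsto_stieltjes {ι : Type*} {l : Filter ι} {μ : ι → ProbabilityMeasure ℝ}
    {ν : ProbabilityMeasure ℝ} (h : Tendsto μ l (𝓝 ν)) (hz : 0 < z.im) :
    Tendsto (fun n => stieltjes (μ n) z) l (𝓝 (stieltjes ν z)) := by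
  simp only [stieltjes_apply]
  rw [ProbabilityMeasure.tendsto_iff_forall_integral_rclike_tendsto ℂ] at h
  exact h (BoundedContinuousFunction.ofNormedAddCommGroup _ (continuous_inv_ofReal_sub hz) z.im⁻¹
    (norm_inv_ofReal_sub_le hz))

lemma im_stieltjes (μ : Measure ℝ) [IsFiniteMeasure μ] (hz : 0 < z.im) :
    (stieltjes μ z).im = ∫ x : ℝ, (((x : ℂ) - z)⁻¹).im ∂μ := by
  rw [stieltjes_apply]
  exact (integral_im (𝕜 := ℂ) (integrable_inv_ofReal_sub μ hz)).symm

lemma im_stieltjes_pos (μ : Measure ℝ) [IsFiniteMeasure μ] [NeZero μ] (hz : 0 < z.im) :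
    0 < (stieltjes μ z).im := by
  have hpos (x : ℝ) : 0 < (((x : ℂ) - z)⁻¹).im := by
    rw [im_inv_ofReal_sub]
    positivity
  rw [im_stieltjes μ hz, integral_pos_iff_support_of_nonneg (fun x => (hpos x).le)
    (integrable_inv_ofReal_sub μ hz).im, Function.support_eq_univ fun x => (hpos x).ne']
  exact Measure.measure_univ_pos.2 (NeZero.ne μ)

lemma differentiableAt_stieltjes (μ : Measure ℝ) [IsFiniteMeasure μ] (hz : 0 < z.im) :
    DifferentiableAt ℂ (stieltjes μ) z := by
  refine (hasDerivAt_resolventTransform z ?_).differentiableAt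
  rintro ⟨x, -, rfl⟩
  simp at hz

lemma continuous_stieltjes_line (μ : Measure ℝ) [IsFiniteMeasure μ] {ε : ℝ} (hε : 0 < ε) :
    Continuous fun t : ℝ => stieltjes μ (t + ε * I) := by
  refine continuous_iff_continuousAt.2 fun t => ?_
  exact ContinuousAt.comp (f := fun t : ℝ => (t + ε * I : ℂ))
    (differentiableAt_stieltjes μ (by simpa using hε)).continuousAt (by fun_prop)

/-- The points `t i` with `t ≥ a` rational accumulate in the upper half-plane. -/
lemma eq_zero_of_eq_zero_on_rat {f : ℂ → ℂ} (hf : DifferentiableOn ℂ f {z | 0 < z.im}) (a : ℝ)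
    (h : ∀ t : ℚ, a ≤ t → f (t * I) = 0) (hz : 0 < z.im) : f z = 0 := by
  obtain ⟨N, hN⟩ := exists_nat_gt (max a 0)
  obtain ⟨hNa, hN0⟩ := max_lt_iff.1 hN
  have hmem : (N * I : ℂ) ∈ {z : ℂ | 0 < z.im} := by simpa using hN0
  have hinv : Tendsto (fun n : ℕ => 1 / ((n : ℂ) + 1)) atTop (𝓝 0) :=
    tendsto_one_div_add_atTop_nhds_zero_nat
  have hlim : Tendsto (fun n : ℕ => (((N + 1 / (n + 1) : ℚ) : ℂ) * I)) atTop (𝓝[≠] (N * I)) := by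
    refine tendsto_nhdsWithin_iff.2 ⟨?_, Eventually.of_forall fun n => ?_⟩
    · simpa using (hinv.const_add (N : ℂ)).mul_const I
    · simpa using Nat.cast_add_one_ne_zero n
  refine (hf.analyticOnNhd (isOpen_lt continuous_const Complex.continuous_im)
    ).eqOn_zero_of_preconnected_of_frequently_eq_zero (convex_halfSpace_im_gt 0).isPreconnected
    hmem (hlim.frequently (Eventually.of_forall fun n => h _ ?_).frequently) hz
  push_cast
  have : (0 : ℝ) < 1 / (n + 1) := by positivity
  linarith

lemma tendsto_neg_mul_inv_ofReal_sub (a x : ℝ) :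
    Tendsto (fun ε : ℝ => -(ε * I) * ((x : ℂ) - (a + ε * I))⁻¹) (𝓝[>] 0)
      (𝓝 (({a} : Set ℝ).indicator 1 x)) := by
  by_cases hx : x = a
  · subst hx
    rw [Set.indicator_of_mem (Set.mem_singleton x)]
    refine tendsto_const_nhds.congr' ?_
    filter_upwards [self_mem_nhdsWithin] with ε (hε : 0 < ε)
    have : (ε : ℂ) * I ≠ 0 := by simp [hε.ne']
    rw [sub_add_cancel_left, mul_inv_cancel₀ (neg_ne_zero.2 this), Pi.one_apply]
  · rw [Set.indicator_of_notMem (by simpa using hx)]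
    have hne : (x : ℂ) - (a + (0 : ℝ) * I) ≠ 0 := by
      simpa [sub_eq_zero] using hx
    have hcont : ContinuousAt (fun ε : ℝ => -(ε * I) * ((x : ℂ) - (a + ε * I))⁻¹) 0 :=
      ContinuousAt.mul (by fun_prop) (ContinuousAt.inv₀ (by fun_prop) hne)
    simpa using hcont.tendsto.mono_left nhdsWithin_le_nhds

lemma tendsto_neg_mul_stieltjes (μ : Measure ℝ) [IsFiniteMeasure μ] (a : ℝ) :
    Tendsto (fun ε : ℝ => -(ε * I) * stieltjes μ (a + ε * I)) (𝓝[>] 0) (𝓝 (μ.real {a} : ℂ)) := by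
  have hlim : (μ.real {a} : ℂ) = ∫ x : ℝ, ({a} : Set ℝ).indicator 1 x ∂μ := by
    rw [integral_indicator (measurableSet_singleton a)]
    simp [Measure.real]
  simp_rw [stieltjes_apply, ← integral_const_mul]
  rw [hlim]
  refine tendsto_integral_filter_of_dominated_convergence (fun _ => 1) ?_ ?_
    (integrable_const _) (ae_of_all _ (tendsto_neg_mul_inv_ofReal_sub a))
  · filter_upwards [self_mem_nhdsWithin] with ε hε
    exact (continuous_const.mul
      (continuous_inv_ofReal_sub (by simpa using hε))).aestronglyMeasurable
  · filter_upwards [self_mem_nhdsWithin] with ε (hε : 0 < ε)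
    refine ae_of_all _ fun x => ?_
    have hle := norm_inv_ofReal_sub_le (z := a + ε * I) (by simpa using hε) x
    calc ‖-(ε * I) * ((x : ℂ) - (a + ε * I))⁻¹‖ ≤ ε * ε⁻¹ := by
          rw [norm_mul]
          gcongr
          · simp [abs_of_pos hε]
          · simpa using hle
      _ = 1 := mul_inv_cancel₀ hε.ne'

lemma integral_im_inv_ofReal_sub {ε : ℝ} (hε : 0 < ε) (x a b : ℝ) :
    ∫ t in a..b, (((x : ℂ) - (t + ε * I))⁻¹).im
      = Real.arctan ((b - x) / ε) - Real.arctan ((a - x) / ε) := by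
  have him (t : ℝ) : 0 < (t + ε * I).im := by simpa using hε
  refine intervalIntegral.integral_eq_sub_of_hasDerivAt
    (f := fun t => Real.arctan ((t - x) / ε)) (fun t _ => ?_) ?_
  · have hdiv : HasDerivAt (fun t => (t - x) / ε) (1 / ε) t :=
      ((hasDerivAt_id t).sub_const x).div_const ε
    refine hdiv.arctan.congr_deriv ?_
    simp only [im_inv_ofReal_sub, Complex.add_re, Complex.add_im, Complex.re_ofReal_mul,
      Complex.im_ofReal_mul, Complex.ofReal_re, Complex.ofReal_im, Complex.I_re, Complex.I_im,
      mul_zero, mul_one, add_zero, zero_add]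
    rw [show (x - t) ^ 2 + ε ^ 2 = ε ^ 2 * (1 + ((t - x) / ε) ^ 2) by field_simp; ring]
    field_simp
  · exact (Complex.continuous_im.comp (Continuous.inv₀ (by fun_prop)
      fun t => ofReal_sub_ne_zero (him t) x)).intervalIntegrable _ _

lemma integral_im_stieltjes (μ : Measure ℝ) [IsFiniteMeasure μ] {ε : ℝ} (hε : 0 < ε) (a b : ℝ) :
    ∫ t in a..b, (stieltjes μ (t + ε * I)).im
      = ∫ x, (Real.arctan ((b - x) / ε) - Real.arctan ((a - x) / ε)) ∂μ := by
  have him (t : ℝ) : 0 < (t + ε * I).im := by simpa using hε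
  simp_rw [im_stieltjes μ (him _), ← integral_im_inv_ofReal_sub hε]
  refine intervalIntegral_integral_swap ?_
  have : IsFiniteMeasure (volume.restrict (Set.uIoc a b)) := ⟨by simp [Set.uIoc]⟩
  have hcont : Continuous fun p : ℝ × ℝ => ((p.2 : ℂ) - (p.1 + ε * I))⁻¹ :=
    Continuous.inv₀ (by fun_prop) fun p => ofReal_sub_ne_zero (him p.1) p.2
  refine (Integrable.of_bound hcont.aestronglyMeasurable ε⁻¹ (ae_of_all _ fun p => ?_)).im
  simpa using norm_inv_ofReal_sub_le (him p.1) p.2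

lemma tendsto_arctan_div_nhdsGT_zero (y : ℝ) :
    Tendsto (fun ε : ℝ => Real.arctan (y / ε)) (𝓝[>] 0) (𝓝 (π / 2 * SignType.sign y)) := by
  simp_rw [div_eq_mul_inv y]
  rcases lt_trichotomy y 0 with hy | rfl | hy
  · simpa [sign_neg hy, neg_div, Function.comp_def] using
      (Real.tendsto_arctan_atBot.mono_right nhdsWithin_le_nhds).comp
        (tendsto_inv_nhdsGT_zero.const_mul_atTop_of_neg hy)
  · simp
  · simpa [sign_pos hy, Function.comp_def] using
      (Real.tendsto_arctan_atTop.mono_right nhdsWithin_le_nhds).comp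
        (tendsto_inv_nhdsGT_zero.const_mul_atTop hy)

lemma sign_sub_sub_sign_sub {a b : ℝ} (hab : a < b) (x : ℝ) :
    (SignType.sign (b - x) : ℝ) - SignType.sign (a - x)
      = (Set.Ioo a b).indicator 1 x + (Set.Icc a b).indicator 1 x := by
  simp only [Set.indicator_apply, Set.mem_Ioo, Set.mem_Icc, Pi.one_apply, sign_apply]
  grind [SignType.coe_one, SignType.coe_zero, SignType.coe_neg_one]

/-- Stieltjes inversion: each endpoint counts with half of its mass. -/
theorem tendsto_integral_im_stieltjes (μ : Measure ℝ) [IsFiniteMeasure μ] {a b : ℝ} (hab : a < b) :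
    Tendsto (fun ε : ℝ => ∫ t in a..b, (stieltjes μ (t + ε * I)).im) (𝓝[>] 0)
      (𝓝 (π / 2 * (μ.real (Set.Ioo a b) + μ.real (Set.Icc a b)))) := by
  have hlim : π / 2 * (μ.real (Set.Ioo a b) + μ.real (Set.Icc a b))
      = ∫ x : ℝ, π / 2 * ((Set.Ioo a b).indicator 1 x + (Set.Icc a b).indicator 1 x) ∂μ := by
    rw [integral_const_mul, integral_add
      ((integrable_indicator_iff measurableSet_Ioo).2 (integrable_const 1).integrableOn)
      ((integrable_indicator_iff measurableSet_Icc).2 (integrable_const 1).integrableOn),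
      integral_indicator_one measurableSet_Ioo, integral_indicator_one measurableSet_Icc]
  rw [hlim]
  refine Tendsto.congr' (f₁ := fun ε : ℝ =>
    ∫ x, (Real.arctan ((b - x) / ε) - Real.arctan ((a - x) / ε)) ∂μ) ?_ ?_
  · filter_upwards [self_mem_nhdsWithin] with ε hε
    rw [integral_im_stieltjes μ hε]
  refine tendsto_integral_filter_of_dominated_convergence (fun _ => π) ?_ ?_
    (integrable_const _) (ae_of_all _ fun x => ?_)
  · refine Eventually.of_forall fun ε => Continuous.aestronglyMeasurable ?_
    exact (Real.continuous_arctan.comp (by fun_prop)).sub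
      (Real.continuous_arctan.comp (by fun_prop))
  · refine Eventually.of_forall fun ε => ae_of_all _ fun x => ?_
    rw [Real.norm_eq_abs, abs_le]
    have hb := Real.arctan_mem_Ioo ((b - x) / ε)
    have ha := Real.arctan_mem_Ioo ((a - x) / ε)
    constructor <;> linarith [ha.1, ha.2, hb.1, hb.2]
  · rw [← sign_sub_sub_sign_sub hab, mul_sub]
    exact (tendsto_arctan_div_nhdsGT_zero (b - x)).sub (tendsto_arctan_div_nhdsGT_zero (a - x))

lemma ofReal_mul_inv_ofReal_sub (hz : 0 < z.im) (x : ℝ) :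
    (x : ℂ) * ((x : ℂ) - z)⁻¹ = 1 + z * ((x : ℂ) - z)⁻¹ := by
  have := ofReal_sub_ne_zero hz x
  field_simp
  ring

lemma integrable_ofReal_mul_inv_ofReal_sub (μ : Measure ℝ) [IsFiniteMeasure μ] (hz : 0 < z.im) :
    Integrable (fun x : ℝ => (x : ℂ) * ((x : ℂ) - z)⁻¹) μ := by
  simp_rw [ofReal_mul_inv_ofReal_sub hz]
  exact (integrable_const 1).add ((integrable_inv_ofReal_sub μ hz).const_mul z)

lemma one_add_mul_stieltjes (μ : Measure ℝ) [IsProbabilityMeasure μ] (hz : 0 < z.im) :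
    1 + z * stieltjes μ z = ∫ x : ℝ, x * ((x : ℂ) - z)⁻¹ ∂μ := by
  simp_rw [ofReal_mul_inv_ofReal_sub hz]
  rw [integral_add (integrable_const 1) ((integrable_inv_ofReal_sub μ hz).const_mul z),
    integral_const_mul, stieltjes_apply]
  simp

lemma indicator_norm_gt_le {v : ℝ} (hv : 0 < v) (x : ℝ) :
    {x : ℝ | v < ‖x‖}.indicator 1 x ≤ 2 * ((x : ℂ) * ((x : ℂ) - v * I)⁻¹).re := by
  have hre : ((x : ℂ) * ((x : ℂ) - v * I)⁻¹).re = x ^ 2 / (x ^ 2 + v ^ 2) := by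
    simp [Complex.inv_re, Complex.normSq_apply, ← sq]
    ring
  rw [hre]
  by_cases hx : v < ‖x‖
  · have : v ^ 2 < x ^ 2 := ((sq_lt_sq₀ hv.le (norm_nonneg x)).2 hx).trans_eq (sq_abs x)
    rw [Set.indicator_of_mem (by exact hx), Pi.one_apply, mul_div_assoc',
      le_div_iff₀ (by positivity)]
    linarith
  · rw [Set.indicator_of_notMem (by exact hx)]
    positivity

lemma measureReal_norm_gt_le (μ : Measure ℝ) [IsProbabilityMeasure μ] {v : ℝ} (hv : 0 < v) :
    μ.real {x | v < ‖x‖} ≤ 2 * ‖1 + v * I * stieltjes μ (v * I)‖ := by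
  have hz : 0 < (v * I : ℂ).im := by simpa using hv
  have hm : MeasurableSet {x : ℝ | v < ‖x‖} := measurableSet_lt measurable_const measurable_norm
  have hint := integrable_ofReal_mul_inv_ofReal_sub μ hz
  calc μ.real {x | v < ‖x‖} = ∫ x, {x : ℝ | v < ‖x‖}.indicator 1 x ∂μ :=
        (integral_indicator_one hm).symm
    _ ≤ ∫ x : ℝ, 2 * ((x : ℂ) * ((x : ℂ) - v * I)⁻¹).re ∂μ :=
        integral_mono ((integrable_const 1).indicator hm) (hint.re.const_mul 2)
          (indicator_norm_gt_le hv)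
    _ = 2 * (1 + v * I * stieltjes μ (v * I)).re := by
        rw [integral_const_mul, one_add_mul_stieltjes μ hz]
        exact congrArg (2 * ·) (integral_re (𝕜 := ℂ) hint)
    _ ≤ 2 * ‖1 + v * I * stieltjes μ (v * I)‖ := by
        gcongr
        exact Complex.re_le_norm _

end StieltjesTransform

/-! ### The limiting cubic equation -/

section DepressedCubic

variable {q s : ℝ}

lemma rpow_one_third_pow_three {b : ℝ} (hb : 0 ≤ b) : (b ^ 3) ^ (1 / 3 : ℝ) = b := by
  rw [← Real.rpow_natCast, ← Real.rpow_mul hb]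
  norm_num

lemma depressed_coeffs_of_root {u t : ℝ} (ht : t ≠ 0)
    (h : (⟨u, √3 * t⟩ : ℂ) ^ 3 - 3 * q * ⟨u, √3 * t⟩ + 2 * s = 0) :
    q = u ^ 2 - t ^ 2 ∧ s = u * (u ^ 2 + 3 * t ^ 2) := by
  have h3 : √3 ^ 2 = 3 := Real.sq_sqrt (by norm_num)
  have him := congrArg Complex.im h
  have hre := congrArg Complex.re h
  simp only [pow_succ, pow_zero, one_mul, Complex.add_im, Complex.sub_im, Complex.mul_im,
    Complex.mul_re, Complex.add_re, Complex.sub_re, Complex.ofReal_re, Complex.ofReal_im,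
    Complex.re_ofNat, Complex.im_ofNat, Complex.zero_re, Complex.zero_im] at him hre
  have hq : q = u ^ 2 - t ^ 2 := by
    have hmul : 3 * √3 * t * (u ^ 2 - t ^ 2 - q) = 0 := by
      linear_combination him + √3 * t ^ 3 * h3
    have hne : 3 * √3 * t ≠ 0 := by positivity
    linarith [(mul_eq_zero.1 hmul).resolve_left hne]
  refine ⟨hq, ?_⟩
  rw [hq] at hre
  linear_combination hre / 2 + 3 / 2 * u * t ^ 2 * h3

/-- Cardano's formula for the imaginary part: if the root is `u + i √3 t`, then
`|s| ± √(s² - q³) = (|u| ± t)³`. -/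
lemma im_root_depressed_cubic (hq : 0 ≤ q) {y : ℂ} (hy : 0 < y.im)
    (h : y ^ 3 - 3 * q * y + 2 * s = 0) :
    0 < s ^ 2 - q ^ 3 ∧ y.im = √3 / 2 * ((|s| + √(s ^ 2 - q ^ 3)) ^ (1 / 3 : ℝ)
      - (|s| - √(s ^ 2 - q ^ 3)) ^ (1 / 3 : ℝ)) := by
  obtain ⟨u, v⟩ := y
  obtain ⟨t, rfl⟩ : ∃ t, v = √3 * t := ⟨v / √3, by field_simp⟩
  have ht : 0 < t := pos_of_mul_pos_right hy (Real.sqrt_nonneg 3)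
  obtain ⟨rfl, rfl⟩ := depressed_coeffs_of_root ht.ne' h
  have hdisc : (u * (u ^ 2 + 3 * t ^ 2)) ^ 2 - (u ^ 2 - t ^ 2) ^ 3
      = (t * (3 * u ^ 2 + t ^ 2)) ^ 2 := by ring
  have hut : t ≤ |u| := abs_of_pos ht ▸ sq_le_sq.1 (sub_nonneg.1 hq)
  have habs : |u * (u ^ 2 + 3 * t ^ 2)| = |u| * (|u| ^ 2 + 3 * t ^ 2) := by
    rw [abs_mul, sq_abs, abs_of_nonneg (by positivity : 0 ≤ u ^ 2 + 3 * t ^ 2)]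
  rw [hdisc, Real.sqrt_sq (by positivity), habs, ← sq_abs u,
    show |u| * (|u| ^ 2 + 3 * t ^ 2) + t * (3 * |u| ^ 2 + t ^ 2) = (|u| + t) ^ 3 by ring,
    show |u| * (|u| ^ 2 + 3 * t ^ 2) - t * (3 * |u| ^ 2 + t ^ 2) = (|u| - t) ^ 3 by ring,
    rpow_one_third_pow_three (by positivity), rpow_one_third_pow_three (sub_nonneg.2 hut)]
  exact ⟨by positivity, by ring⟩

lemma four_mul_lt_sq_of_depressed_root {y : ℝ} (hsq : 0 < s ^ 2 - q ^ 3)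
    (h : y ^ 3 - 3 * q * y + 2 * s = 0) : 4 * q < y ^ 2 := by
  have hprod : (y ^ 2 - 4 * q) * (y ^ 2 - q) ^ 2 = 4 * (s ^ 2 - q ^ 3) := by
    rw [show s = -(y ^ 3 - 3 * q * y) / 2 by linarith]
    ring
  have := pos_of_mul_pos_left (hprod ▸ mul_pos four_pos hsq) (sq_nonneg (y ^ 2 - q))
  linarith

end DepressedCubic

section Cubic

/-- The left hand side of the cubic equation `(1 + z m) (1 - c² m²) + 2 c m² = 0` satisfied by the
Stieltjes transform `m` of the limiting spectral distribution. -/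
def lsdCubic (c : ℝ) (z m : ℂ) : ℂ := (1 + z * m) * (1 - (c : ℂ) ^ 2 * m ^ 2) + 2 * c * m ^ 2

/-- The coefficient `q` of the depressed form `y³ - 3 q y + 2 s` of the cubic above the point `x` of
the real line. -/
def depressedQ (c x : ℝ) : ℝ := 1 / (3 * c ^ 2) + (c - 2) ^ 2 / (9 * c ^ 2 * x ^ 2)

/-- The coefficient `s` of the depressed form `y³ - 3 q y + 2 s` of the cubic above the point `x` of
the real line. -/
def depressedS (c x : ℝ) : ℝ := r₁ c / x - r₃ c / x ^ 3

/-- The shift `m = y + cubicShift c x` that removes the quadratic term of the cubic. -/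
def cubicShift (c x : ℝ) : ℝ := (2 - c) / (3 * c * x)

variable {c x : ℝ}

lemma depressedQ_pos (hc : 0 < c) (x : ℝ) : 0 < depressedQ c x := by
  unfold depressedQ
  positivity

lemma depressedS_sq_sub_depressedQ_pow (hc : 0 < c) (hx : x ≠ 0) :
    depressedS c x ^ 2 - depressedQ c x ^ 3 = -d c x := by
  unfold depressedS depressedQ d r₁ r₃ d₀ d₂ d₄
  field_simp
  ring

lemma norm_r (c x : ℝ) : ‖r c x‖ = |depressedS c x| := by
  have hr : r c x = -I * (depressedS c x : ℂ) := by
    by_cases hx : x = 0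
    · simp [r, R, depressedS, hx]
    · unfold r R depressedS
      push_cast
      field_simp
      simp only [Complex.I_sq, Complex.I_pow_four]
      ring
  simp [hr]

lemma lsdCubic_add_cubicShift (hc : 0 < c) (hx : x ≠ 0) (y : ℂ) :
    lsdCubic c x (y + cubicShift c x)
      = -(c ^ 2 * x : ℂ) * (y ^ 3 - 3 * depressedQ c x * y + 2 * depressedS c x) := by
  have hc' : (c : ℂ) ≠ 0 := by exact_mod_cast hc.ne'
  have hx' : (x : ℂ) ≠ 0 := by exact_mod_cast hx
  unfold lsdCubic depressedS depressedQ cubicShift r₁ r₃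
  push_cast
  field_simp
  ring

lemma lsdCubic_add_cubicShift_eq_zero_iff (hc : 0 < c) (hx : x ≠ 0) {y : ℂ} :
    lsdCubic c x (y + cubicShift c x) = 0 ↔
      y ^ 3 - 3 * depressedQ c x * y + 2 * depressedS c x = 0 := by
  rw [lsdCubic_add_cubicShift hc hx, mul_eq_zero, or_iff_right]
  simp [hc.ne', hx]

end Cubic

section Support

variable {c x : ℝ}

lemma d₀_pos (hc : 0 < c) : 0 < d₀ c := by
  unfold d₀
  positivity

lemma discrim_eq (hc : 0 < c) :
    d₂ c ^ 2 - 4 * d₀ c * d₄ c = (4 * c + 1) ^ 3 / (27 * c ^ 6) ^ 2 := by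
  unfold d₀ d₂ d₄
  field_simp
  ring

lemma d_eq_mul (hc : 0 < c) (hx : x ≠ 0) :
    d c x = d₀ c / x ^ 4 * ((x ^ 2 - Rplus c) * (x ^ 2 - Rminus c)) := by
  have h0 := (d₀_pos hc).ne'
  have hsqrt : √(d₂ c ^ 2 - 4 * d₀ c * d₄ c) ^ 2 = d₂ c ^ 2 - 4 * d₀ c * d₄ c :=
    Real.sq_sqrt (by rw [discrim_eq hc]; positivity)
  unfold d Rplus Rminus
  set D := √(d₂ c ^ 2 - 4 * d₀ c * d₄ c)
  field_simp
  linear_combination hsqrt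

lemma Rminus_lt_Rplus (hc : 0 < c) : Rminus c < Rplus c := by
  have := d₀_pos hc
  have hsqrt : 0 < √(d₂ c ^ 2 - 4 * d₀ c * d₄ c) :=
    Real.sqrt_pos.2 (by rw [discrim_eq hc]; positivity)
  unfold Rplus Rminus
  gcongr
  linarith

lemma d_neg_iff (hc : 0 < c) (hx : x ≠ 0) : d c x < 0 ↔ Rminus c < x ^ 2 ∧ x ^ 2 < Rplus c := by
  have hpos : 0 < d₀ c / x ^ 4 := div_pos (d₀_pos hc) (by positivity)
  have hR := Rminus_lt_Rplus hc
  rw [d_eq_mul hc hx, ← smul_eq_mul, smul_neg_iff_of_pos_left hpos, mul_neg_iff]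
  grind

lemma mem_S_iff_abs : x ∈ S c ↔ L c < |x| ∧ |x| < U c := by
  have hL : 0 ≤ L c := Real.sqrt_nonneg _
  simp only [S, Set.mem_union, Set.mem_Ioo, lt_abs, abs_lt]
  grind

lemma L_eq_sqrt (c : ℝ) : L c = √(Rminus c) := by
  unfold L
  split_ifs with h
  · rfl
  · rw [Real.sqrt_zero, Real.sqrt_eq_zero_of_nonpos (not_lt.1 h)]

lemma mem_S_iff (hc : 0 < c) : x ∈ S c ↔ x ≠ 0 ∧ d c x < 0 := by
  rcases eq_or_ne x 0 with rfl | hx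
  · simp [mem_S_iff_abs, L_eq_sqrt]
  · rw [mem_S_iff_abs, L_eq_sqrt, U, Real.sqrt_lt' (abs_pos.2 hx),
      Real.lt_sqrt (abs_nonneg x), sq_abs, d_neg_iff hc hx]
    simp [hx]

end Support

section DensityFormula

variable {c x : ℝ}

/-- The density off the origin as a single formula, without the indicator of the support. -/
def densityFormula (c x : ℝ) : ℝ :=
  √3 / (2 * π) * (Vplus c x ^ (1 / 3 : ℝ) - Vminus c x ^ (1 / 3 : ℝ))

lemma densityFormula_of_nonneg (hd : 0 ≤ d c x) : densityFormula c x = 0 := by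
  simp [densityFormula, Vplus, Vminus, Real.sqrt_eq_zero_of_nonpos (neg_nonpos.2 hd)]

lemma density_eq_densityFormula (hc : 0 < c) (hx : x ≠ 0) :
    density c x = densityFormula c x := by
  by_cases h : x ∈ S c
  · exact Set.indicator_of_mem h _
  · have hd : 0 ≤ d c x := not_lt.1 fun hd => h ((mem_S_iff hc).2 ⟨hx, hd⟩)
    rw [densityFormula_of_nonneg hd]
    exact Set.indicator_of_notMem h _

lemma continuousAt_densityFormula (hx : x ≠ 0) : ContinuousAt (densityFormula c) x := by
  have hr : ContinuousAt (fun x => ‖r c x‖) x := by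
    simp_rw [norm_r, depressedS]
    fun_prop (disch := positivity)
  have hd : ContinuousAt (fun x => √(-d c x)) x := by
    unfold d
    fun_prop (disch := positivity)
  exact continuousAt_const.mul (((hr.add hd).rpow_const (Or.inr (by norm_num))).sub
    ((hr.sub hd).rpow_const (Or.inr (by norm_num))))

lemma pi_mul_densityFormula (hc : 0 < c) (hx : x ≠ 0) :
    π * densityFormula c x = √3 / 2 * (
      (|depressedS c x| + √(depressedS c x ^ 2 - depressedQ c x ^ 3)) ^ (1 / 3 : ℝ)
      - (|depressedS c x| - √(depressedS c x ^ 2 - depressedQ c x ^ 3)) ^ (1 / 3 : ℝ)) := by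
  rw [depressedS_sq_sub_depressedQ_pow hc hx, densityFormula, Vplus, Vminus, norm_r]
  field_simp

lemma im_root_eq (hc : 0 < c) (hx : x ≠ 0) {w : ℂ} (hw : 0 < w.im) (h : lsdCubic c x w = 0) :
    w.im = π * densityFormula c x := by
  obtain ⟨y, rfl⟩ : ∃ y : ℂ, w = y + cubicShift c x := ⟨w - cubicShift c x, by ring⟩
  rw [Complex.add_im, Complex.ofReal_im, add_zero] at hw ⊢
  rw [pi_mul_densityFormula hc hx]
  exact (im_root_depressed_cubic (depressedQ_pos hc x).le hw
    ((lsdCubic_add_cubicShift_eq_zero_iff hc hx).1 h)).2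

end DensityFormula

section RealRoots

variable {c x ρ : ℝ}

/-- The quotient of the cubic above `x` by the factor `c² x (ρ - w)` of its real root `ρ`. -/
def cubicQuotient (c x ρ w : ℝ) : ℝ :=
  (w - cubicShift c x) ^ 2 + (w - cubicShift c x) * (ρ - cubicShift c x)
    + (ρ - cubicShift c x) ^ 2 - 3 * depressedQ c x

lemma depressed_root_of_real_root (hc : 0 < c) (hx : x ≠ 0) (h : lsdCubic c x ρ = 0) :
    (ρ - cubicShift c x) ^ 3 - 3 * depressedQ c x * (ρ - cubicShift c x) + 2 * depressedS c x
      = 0 := by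
  have := (lsdCubic_add_cubicShift_eq_zero_iff hc hx (y := (ρ : ℂ) - cubicShift c x)).1
    (by rwa [sub_add_cancel])
  exact_mod_cast this

lemma lsdCubic_eq_mul_cubicQuotient (hc : 0 < c) (hx : x ≠ 0) (h : lsdCubic c x ρ = 0) (w : ℝ) :
    (1 + x * w) * (1 - c ^ 2 * w ^ 2) + 2 * c * w ^ 2
      = c ^ 2 * x * (ρ - w) * cubicQuotient c x ρ w := by
  have hw := lsdCubic_add_cubicShift hc hx ((w : ℂ) - cubicShift c x)
  rw [sub_add_cancel, lsdCubic] at hw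
  norm_cast at hw
  rw [hw, cubicQuotient]
  linear_combination -(c ^ 2 * x) * depressed_root_of_real_root hc hx h

lemma mul_cubicQuotient_self (hc : 0 < c) (hx : x ≠ 0) :
    c ^ 2 * x * cubicQuotient c x ρ ρ
      = 3 * c ^ 2 * x * ρ ^ 2 - 2 * (2 * c - c ^ 2) * ρ - x := by
  unfold cubicQuotient cubicShift depressedQ
  field_simp
  ring

lemma cubicQuotient_pos (hc : 0 < c) (hx : x ≠ 0) (hd : d c x < 0) (h : lsdCubic c x ρ = 0)
    (w : ℝ) : 0 < cubicQuotient c x ρ w := by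
  have hlt := four_mul_lt_sq_of_depressed_root
    (by rw [depressedS_sq_sub_depressedQ_pow hc hx]; linarith)
    (depressed_root_of_real_root hc hx h)
  unfold cubicQuotient
  nlinarith [sq_nonneg (2 * (w - cubicShift c x) + (ρ - cubicShift c x))]

lemma mul_real_root_pos (hc : 0 < c) (hx : x ≠ 0) (hd : d c x < 0) (h : lsdCubic c x ρ = 0) :
    0 < x * ρ := by
  have h0 := lsdCubic_eq_mul_cubicQuotient hc hx h 0
  have hone : x * ρ * (c ^ 2 * cubicQuotient c x ρ 0) = 1 := by linear_combination -h0
  exact pos_of_mul_pos_left (hone ▸ one_pos)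
    (mul_pos (pow_pos hc 2) (cubicQuotient_pos hc hx hd h 0)).le

/-- A real root `ρ` over the support violates the inequality `norm_sq_root_le` satisfied by the
roots in the upper half-plane: the latter would force the inverse function `x(ρ)` of the Stieltjes
transform to be increasing at `ρ`, while the sign of the quotient shows that it is decreasing. -/
lemma real_root_lt (hc : 0 < c) (hx : x ≠ 0) (hd : d c x < 0) (h : lsdCubic c x ρ = 0) :
    (1 - c ^ 2 * ρ ^ 2) ^ 2 < 2 * c * ρ ^ 2 * (1 + c ^ 2 * ρ ^ 2) := by
  have hroot : (1 + x * ρ) * (1 - c ^ 2 * ρ ^ 2) + 2 * c * ρ ^ 2 = 0 := by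
    rw [lsdCubic_eq_mul_cubicQuotient hc hx h]
    ring
  have hxρ := mul_real_root_pos hc hx hd h
  have hneg : 1 - c ^ 2 * ρ ^ 2 < 0 := by
    have hρ : ρ ≠ 0 := right_ne_zero_of_mul hxρ.ne'
    have hsq : 0 < 2 * c * ρ ^ 2 := by positivity
    exact neg_of_mul_neg_right (by linarith) (by linarith : 0 ≤ 1 + x * ρ)
  have hderiv : 0 < ρ * (3 * c ^ 2 * x * ρ ^ 2 - 2 * (2 * c - c ^ 2) * ρ - x) := by
    have := cubicQuotient_pos hc hx hd h ρ
    calc 0 < c ^ 2 * (x * ρ) * cubicQuotient c x ρ ρ := by positivity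
      _ = _ := by rw [← mul_cubicQuotient_self hc hx]; ring
  have hprod : ρ * (3 * c ^ 2 * x * ρ ^ 2 - 2 * (2 * c - c ^ 2) * ρ - x) * (1 - c ^ 2 * ρ ^ 2)
      = (1 - c ^ 2 * ρ ^ 2) ^ 2 - 2 * c * ρ ^ 2 * (1 + c ^ 2 * ρ ^ 2) := by
    linear_combination (3 * c ^ 2 * ρ ^ 2 - 1) * hroot
  linarith [mul_neg_of_pos_of_neg hderiv hneg]

/-- Take imaginary parts in `z = -m⁻¹ - 2 c m / (1 - c² m²)`. -/
lemma norm_sq_root_le {z m : ℂ} (hz : 0 ≤ z.im) (hm : 0 < m.im) (h : lsdCubic c z m = 0) :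
    2 * c * ‖m‖ ^ 2 * (1 + c ^ 2 * ‖m‖ ^ 2) ≤ ‖1 - (c : ℂ) ^ 2 * m ^ 2‖ ^ 2 := by
  unfold lsdCubic at h
  set W := 1 - (c : ℂ) ^ 2 * m ^ 2 with hW
  have hconj : conj W = 1 - (c : ℂ) ^ 2 * (conj m) ^ 2 := by simp [hW]
  have hcleared : z * (m * conj m) * (W * conj W)
      = -(conj m) * (W * conj W) - 2 * c * (m * conj m)
          * (m - (c : ℂ) ^ 2 * (m * conj m) * conj m) := by
    linear_combination (conj m) * (conj W) * h
      - 2 * c * m ^ 2 * conj m * hconj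
  have hc2 : (c : ℂ) ^ 2 = ((c ^ 2 : ℝ) : ℂ) := by push_cast; rfl
  have him := congrArg Complex.im hcleared
  simp only [hc2, Complex.mul_conj, Complex.sub_im, Complex.neg_im, Complex.neg_re, Complex.mul_im,
    Complex.mul_re, Complex.sub_re, Complex.conj_im, Complex.conj_re, Complex.ofReal_im,
    Complex.ofReal_re, Complex.re_ofNat, Complex.im_ofNat, Complex.normSq_eq_norm_sq] at him
  have hprod : z.im * (‖m‖ ^ 2 * ‖W‖ ^ 2)
      = m.im * (‖W‖ ^ 2 - 2 * c * ‖m‖ ^ 2 * (1 + c ^ 2 * ‖m‖ ^ 2)) := by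
    linear_combination him
  have := nonneg_of_mul_nonneg_right (hprod ▸ mul_nonneg hz (by positivity)) hm
  linarith

end RealRoots

section Origin

variable {c x : ℝ}

lemma Vminus_nonneg (hc : 0 < c) (hx : x ≠ 0) : 0 ≤ Vminus c x := by
  have hle : -d c x ≤ depressedS c x ^ 2 := by
    rw [← depressedS_sq_sub_depressedQ_pow hc hx]
    exact sub_le_self _ (pow_pos (depressedQ_pos hc x) 3).le
  rw [Vminus, norm_r, sub_nonneg, ← Real.sqrt_sq_eq_abs]
  exact Real.sqrt_le_sqrt hle

lemma Vplus_nonneg (c x : ℝ) : 0 ≤ Vplus c x :=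
  add_nonneg (norm_nonneg _) (Real.sqrt_nonneg _)

lemma mul_densityFormula (hc : 0 < c) (hx : x ≠ 0) {t : ℝ} (ht : 0 ≤ t) :
    t * densityFormula c x = √3 / (2 * π) *
      ((t ^ 3 * Vplus c x) ^ (1 / 3 : ℝ) - (t ^ 3 * Vminus c x) ^ (1 / 3 : ℝ)) := by
  rw [Real.mul_rpow (by positivity) (Vplus_nonneg c x),
    Real.mul_rpow (by positivity) (Vminus_nonneg hc hx), rpow_one_third_pow_three ht,
    densityFormula]
  ring

lemma abs_mul_depressedS (hx : x ≠ 0) :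
    |x| ^ 3 * |depressedS c x| = |r₁ c * x ^ 2 - r₃ c| := by
  rw [← abs_pow, ← abs_mul, depressedS]
  congr 1
  field_simp

lemma abs_mul_sqrt_neg_d (hx : x ≠ 0) :
    |x| ^ 3 * √(-d c x) = |x| * √(d₂ c * x ^ 2 - d₀ c * x ^ 4 - d₄ c) := by
  have h : d₂ c * x ^ 2 - d₀ c * x ^ 4 - d₄ c = (x ^ 2) ^ 2 * -d c x := by
    unfold d
    field_simp
    ring
  rw [h, Real.sqrt_mul (by positivity), Real.sqrt_sq (by positivity), ← sq_abs]
  ring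

lemma rpow_one_third_sub_mul {a b : ℝ} (ha : 0 ≤ a) (hb : 0 ≤ b) :
    (a ^ (1 / 3 : ℝ) - b ^ (1 / 3 : ℝ)) * ((a ^ (1 / 3 : ℝ)) ^ 2
      + a ^ (1 / 3 : ℝ) * b ^ (1 / 3 : ℝ) + (b ^ (1 / 3 : ℝ)) ^ 2) = a - b := by
  have h (y : ℝ) (hy : 0 ≤ y) : (y ^ (1 / 3 : ℝ)) ^ 3 = y := by
    rw [← Real.rpow_natCast, ← Real.rpow_mul hy]
    norm_num
  linear_combination h a ha - h b hb

/-- The denominator arises from `a - b = (a³ - b³) / (a² + a b + b²)`, applied to the two cube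
roots in the density, and everything in sight has been scaled so as to be continuous at `0`. -/
lemma densityFormula_eq_div (hc : 0 < c) (hx : x ≠ 0) {N A B : ℝ}
    (hN : N = √(d₂ c * x ^ 2 - d₀ c * x ^ 4 - d₄ c))
    (hA : A = (|r₁ c * x ^ 2 - r₃ c| + |x| * N) ^ (1 / 3 : ℝ))
    (hB : B = (|r₁ c * x ^ 2 - r₃ c| - |x| * N) ^ (1 / 3 : ℝ)) (hpos : 0 < A) :
    densityFormula c x = √3 / (2 * π) * (2 * N / (A ^ 2 + A * B + B ^ 2)) := by
  have habs : 0 < |x| := abs_pos.2 hx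
  have hplus : |x| ^ 3 * Vplus c x = |r₁ c * x ^ 2 - r₃ c| + |x| * N := by
    rw [Vplus, mul_add, norm_r, abs_mul_depressedS hx, abs_mul_sqrt_neg_d hx, hN]
  have hminus : |x| ^ 3 * Vminus c x = |r₁ c * x ^ 2 - r₃ c| - |x| * N := by
    rw [Vminus, mul_sub, norm_r, abs_mul_depressedS hx, abs_mul_sqrt_neg_d hx, hN]
  have hV := rpow_one_third_sub_mul (mul_nonneg (pow_nonneg habs.le 3) (Vplus_nonneg c x))
    (mul_nonneg (pow_nonneg habs.le 3) (Vminus_nonneg hc hx))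
  have hmul := mul_densityFormula hc hx habs.le
  rw [hplus, hminus, ← hA, ← hB] at hV hmul
  have hden : 0 < A ^ 2 + A * B + B ^ 2 := by nlinarith [sq_nonneg (A + 2 * B)]
  have hdiff : A - B = |x| * (2 * N / (A ^ 2 + A * B + B ^ 2)) := by
    rw [mul_div_assoc', eq_div_iff hden.ne']
    linear_combination hV
  rw [hdiff] at hmul
  exact mul_left_cancel₀ habs.ne' (hmul.trans (by ring))

lemma abs_r₃ (hc : 0 < c) (hc2 : c ≤ 2) : |r₃ c| = ((2 - c) / (3 * c)) ^ 3 := by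
  have h : r₃ c = ((2 - c) / (3 * c)) ^ 3 := by
    unfold r₃
    field_simp
    ring
  have : 0 ≤ 2 - c := by linarith
  rw [h, abs_of_nonneg (by positivity)]

lemma sqrt_neg_d₄ (hc : 0 < c) (hc2 : c < 2) :
    √(-d₄ c) = (2 - c) ^ 2 / (3 * c ^ 2) / (√3 * √(2 * c - c ^ 2)) := by
  have : 0 < 2 - c := by linarith
  have h : -d₄ c = ((2 - c) ^ 2 / (3 * c ^ 2)) ^ 2 / (3 * (2 * c - c ^ 2)) := by
    rw [show 2 * c - c ^ 2 = c * (2 - c) by ring]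
    unfold d₄
    field_simp
    ring
  rw [h, Real.sqrt_div (by positivity), Real.sqrt_sq (by positivity), Real.sqrt_mul (by norm_num)]

lemma tendsto_densityFormula_zero (hc : 0 < c) (hc2 : c < 2) :
    Tendsto (densityFormula c) (𝓝[≠] 0) (𝓝 (1 / (π * √(2 * c - c ^ 2)))) := by
  have h2 : 0 < 2 - c := by linarith
  set N : ℝ → ℝ := fun x => √(d₂ c * x ^ 2 - d₀ c * x ^ 4 - d₄ c) with hN
  set A : ℝ → ℝ := fun x => (|r₁ c * x ^ 2 - r₃ c| + |x| * N x) ^ (1 / 3 : ℝ) with hA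
  set B : ℝ → ℝ := fun x => (|r₁ c * x ^ 2 - r₃ c| - |x| * N x) ^ (1 / 3 : ℝ) with hB
  have hNc : Continuous N := by fun_prop
  have hAc : Continuous A := Continuous.rpow_const (by fun_prop) fun _ => Or.inr (by norm_num)
  have hBc : Continuous B := Continuous.rpow_const (by fun_prop) fun _ => Or.inr (by norm_num)
  have hroot : |r₃ c| ^ (1 / 3 : ℝ) = (2 - c) / (3 * c) := by
    rw [abs_r₃ hc hc2.le, rpow_one_third_pow_three (by positivity)]
  have hA0 : A 0 = (2 - c) / (3 * c) := by simp [hA, ← hroot]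
  have hB0 : B 0 = (2 - c) / (3 * c) := by simp [hB, ← hroot]
  have hN0 : N 0 = (2 - c) ^ 2 / (3 * c ^ 2) / (√3 * √(2 * c - c ^ 2)) := by
    simp [hN, ← sqrt_neg_d₄ hc hc2]
  have hcont : ContinuousAt
      (fun x => √3 / (2 * π) * (2 * N x / (A x ^ 2 + A x * B x + B x ^ 2))) 0 := by
    refine continuousAt_const.mul (ContinuousAt.div (by fun_prop) (by fun_prop) ?_)
    rw [hA0, hB0]
    positivity
  have hlim : √3 / (2 * π) * (2 * N 0 / (A 0 ^ 2 + A 0 * B 0 + B 0 ^ 2))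
      = 1 / (π * √(2 * c - c ^ 2)) := by
    rw [hA0, hB0, hN0]
    field_simp
    ring
  have hpos : ∀ᶠ x in 𝓝[≠] (0 : ℝ), 0 < A x :=
    (hAc.tendsto 0).mono_left nhdsWithin_le_nhds |>.eventually_const_lt (by rw [hA0]; positivity)
  rw [← hlim]
  refine (hcont.tendsto.mono_left nhdsWithin_le_nhds).congr' ?_
  filter_upwards [hpos, self_mem_nhdsWithin] with x hAx hx
  exact (densityFormula_eq_div hc hx rfl rfl rfl hAx).symm

lemma mul_densityFormula_two (hx : x ≠ 0) :
    |x| ^ (1 / 3 : ℝ) * densityFormula 2 x = √3 / (2 * π) *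
      ((1 / 8 + √((27 - x ^ 2) / 1728)) ^ (1 / 3 : ℝ)
        - (1 / 8 - √((27 - x ^ 2) / 1728)) ^ (1 / 3 : ℝ)) := by
  have hcube : (|x| ^ (1 / 3 : ℝ)) ^ 3 = |x| := by
    rw [← Real.rpow_natCast, ← Real.rpow_mul (abs_nonneg x)]
    norm_num
  have hs : |x| * |depressedS 2 x| = 1 / 8 := by
    rw [← abs_mul, show x * depressedS 2 x = -(1 / 8) by
      unfold depressedS r₁ r₃
      field_simp
      ring, abs_neg, abs_of_pos (by norm_num)]
  have hd : |x| * √(-d 2 x) = √((27 - x ^ 2) / 1728) := by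
    rw [← Real.sqrt_sq_eq_abs, ← Real.sqrt_mul (sq_nonneg x)]
    congr 1
    unfold d d₀ d₂ d₄
    field_simp
    ring
  rw [mul_densityFormula two_pos hx (by positivity), hcube, Vplus, Vminus, norm_r, mul_add |x|,
    mul_sub |x|, hs, hd]

lemma tendsto_densityFormula_two : Tendsto (densityFormula 2) (𝓝[≠] 0) atTop := by
  set g : ℝ → ℝ := fun x => √3 / (2 * π) * ((1 / 8 + √((27 - x ^ 2) / 1728)) ^ (1 / 3 : ℝ)
    - (1 / 8 - √((27 - x ^ 2) / 1728)) ^ (1 / 3 : ℝ)) with hg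
  have hgc : Continuous g :=
    continuous_const.mul ((Continuous.rpow_const (by fun_prop) fun _ => Or.inr (by norm_num)).sub
      (Continuous.rpow_const (by fun_prop) fun _ => Or.inr (by norm_num)))
  have hg0 : 0 < g 0 := by
    have hsqrt : √((27 - 0 ^ 2) / 1728) = 1 / 8 := by
      rw [show (27 - 0 ^ 2) / 1728 = (1 / 8 : ℝ) ^ 2 by norm_num, Real.sqrt_sq (by norm_num)]
    simp only [hg, hsqrt]
    rw [sub_self, Real.zero_rpow (by norm_num), sub_zero]
    positivity
  have hinv : Tendsto (fun x : ℝ => (|x| ^ (1 / 3 : ℝ))⁻¹) (𝓝[≠] 0) atTop := by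
    refine tendsto_inv_nhdsGT_zero.comp (tendsto_nhdsWithin_iff.2 ⟨?_, ?_⟩)
    · have : Continuous fun x : ℝ => |x| ^ (1 / 3 : ℝ) :=
        continuous_abs.rpow_const fun _ => Or.inr (by norm_num)
      simpa using (this.tendsto 0).mono_left (nhdsWithin_le_nhds (s := {0}ᶜ))
    · filter_upwards [self_mem_nhdsWithin] with x hx
      exact Real.rpow_pos_of_pos (abs_pos.2 hx) _
  refine (hinv.atTop_mul_pos hg0 ((hgc.tendsto 0).mono_left nhdsWithin_le_nhds)).congr' ?_
  filter_upwards [self_mem_nhdsWithin] with x hx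
  have := Real.rpow_pos_of_pos (abs_pos.2 hx) (1 / 3)
  simp only [hg, ← mul_densityFormula_two hx]
  field_simp

end Origin

/-! ### Solutions of the cubic equation -/

section CubicSolutions

variable {c x : ℝ} {F G : Measure ℝ}

/-- The Stieltjes transform of `F` solves the limiting cubic equation on the upper half-plane. -/
def SolvesCubic (c : ℝ) (F : Measure ℝ) : Prop :=
  ∀ ⦃z : ℂ⦄, 0 < z.im → lsdCubic c z (stieltjes F z) = 0

lemma SolvesCubic.neZero (hF : SolvesCubic c F) : NeZero F := by
  refine ⟨?_⟩
  rintro rfl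
  simpa [lsdCubic, stieltjes_apply] using hF (z := I) (by simp)

lemma exists_norm_root_le (hc : 0 < c) {a : ℝ} (ha : 0 < a) :
    ∃ K, ∀ z m : ℂ, a ≤ ‖z‖ → lsdCubic c z m = 0 → ‖m‖ ≤ K := by
  set A := |2 * c - c ^ 2| with hA
  refine ⟨max 1 ((A / a + 1 + 1 / a) / c ^ 2), fun z m hz h => ?_⟩
  rcases le_or_gt ‖m‖ 1 with hm | hm
  · exact hm.trans (le_max_left _ _)
  have hz0 : 0 < ‖z‖ := ha.trans_le hz
  have hcubic : (c : ℂ) ^ 2 * z * m ^ 3 = ((2 * c - c ^ 2 : ℝ) : ℂ) * m ^ 2 + z * m + 1 := by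
    unfold lsdCubic at h
    push_cast
    linear_combination -h
  have hnorm : c ^ 2 * ‖z‖ * ‖m‖ ^ 3 ≤ A * ‖m‖ ^ 2 + ‖z‖ * ‖m‖ + 1 := by
    calc c ^ 2 * ‖z‖ * ‖m‖ ^ 3 = ‖(c : ℂ) ^ 2 * z * m ^ 3‖ := by simp
      _ ≤ A * ‖m‖ ^ 2 + ‖z‖ * ‖m‖ + 1 := by
        rw [hcubic]
        exact norm_add₃_le.trans_eq (by simp only [norm_mul, norm_pow, Complex.norm_real,
          Real.norm_eq_abs, norm_one, hA])
  have hlinear : c ^ 2 * ‖z‖ * ‖m‖ ≤ A + ‖z‖ + 1 := by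
    have hle : ‖m‖ ≤ ‖m‖ ^ 2 := le_self_pow₀ hm.le two_ne_zero
    have hone : 1 ≤ ‖m‖ ^ 2 := hm.le.trans hle
    refine le_of_mul_le_mul_right ?_ (one_pos.trans_le hone)
    nlinarith
  refine le_max_of_le_right ((le_div_iff₀ (by positivity)).2 ?_)
  calc ‖m‖ * c ^ 2 ≤ (A + ‖z‖ + 1) / ‖z‖ := (le_div_iff₀ hz0).2 (by linarith)
    _ = A / ‖z‖ + 1 + 1 / ‖z‖ := by field_simp
    _ ≤ A / a + 1 + 1 / a := by gcongr

lemma SolvesCubic.exists_norm_stieltjes_le (hF : SolvesCubic c F) (hc : 0 < c) {a : ℝ}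
    (ha : 0 < a) : ∃ K, ∀ t ε : ℝ, a ≤ |t| → 0 < ε → ‖stieltjes F (t + ε * I)‖ ≤ K := by
  obtain ⟨K, hK⟩ := exists_norm_root_le hc ha
  refine ⟨K, fun t ε ht hε => hK _ _ (ht.trans ?_) (hF (by simpa using hε))⟩
  simpa using Complex.abs_re_le_norm (t + ε * I)

lemma tendsto_ofReal_add_mul_I (x : ℝ) :
    Tendsto (fun ε : ℝ => (x + ε * I : ℂ)) (𝓝[>] 0) (𝓝 x) := by
  have : Continuous fun ε : ℝ => (x + ε * I : ℂ) := by fun_prop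
  simpa using (this.tendsto 0).mono_left (nhdsWithin_le_nhds (s := Set.Ioi 0))

lemma im_boundary_root_eq (hc : 0 < c) (hx : x ≠ 0) {w : ℂ} (hw : 0 ≤ w.im)
    (h : lsdCubic c x w = 0)
    (hle : 2 * c * ‖w‖ ^ 2 * (1 + c ^ 2 * ‖w‖ ^ 2) ≤ ‖1 - (c : ℂ) ^ 2 * w ^ 2‖ ^ 2) :
    w.im = π * densityFormula c x := by
  rcases hw.lt_or_eq with hpos | hzero
  · exact im_root_eq hc hx hpos h
  obtain ⟨ρ, rfl⟩ : ∃ ρ : ℝ, w = ρ := ⟨w.re, Complex.ext rfl hzero.symm⟩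
  have hnorm : ‖1 - (c : ℂ) ^ 2 * (ρ : ℂ) ^ 2‖ ^ 2 = (1 - c ^ 2 * ρ ^ 2) ^ 2 := by
    rw [← Complex.ofReal_pow, ← Complex.ofReal_pow, ← Complex.ofReal_mul, ← Complex.ofReal_one,
      ← Complex.ofReal_sub, Complex.norm_real, Real.norm_eq_abs, sq_abs]
  rw [hnorm, Complex.norm_real, Real.norm_eq_abs, sq_abs] at hle
  have hd : 0 ≤ d c x := not_lt.1 fun hd => hle.not_gt (real_root_lt hc hx hd h)
  rw [← hzero, densityFormula_of_nonneg hd, mul_zero]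

theorem SolvesCubic.tendsto_im_stieltjes [IsFiniteMeasure F] (hF : SolvesCubic c F) (hc : 0 < c)
    (hx : x ≠ 0) : Tendsto (fun ε : ℝ => (stieltjes F (x + ε * I)).im) (𝓝[>] 0)
      (𝓝 (π * densityFormula c x)) := by
  have := hF.neZero
  have hclosed : IsClosed {p : ℂ × ℂ | 0 ≤ p.2.im ∧ lsdCubic c p.1 p.2 = 0 ∧
      2 * c * ‖p.2‖ ^ 2 * (1 + c ^ 2 * ‖p.2‖ ^ 2) ≤ ‖1 - (c : ℂ) ^ 2 * p.2 ^ 2‖ ^ 2} := by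
    have hcubic : Continuous fun p : ℂ × ℂ => lsdCubic c p.1 p.2 := by
      unfold lsdCubic
      fun_prop
    have hnonneg : IsClosed {p : ℂ × ℂ | 0 ≤ p.2.im} :=
      isClosed_le (by fun_prop) (by fun_prop)
    have hnorm : IsClosed {p : ℂ × ℂ | 2 * c * ‖p.2‖ ^ 2 * (1 + c ^ 2 * ‖p.2‖ ^ 2) ≤
        ‖1 - (c : ℂ) ^ 2 * p.2 ^ 2‖ ^ 2} := isClosed_le (by fun_prop) (by fun_prop)
    exact hnonneg.inter ((isClosed_eq hcubic continuous_const).inter hnorm)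
  obtain ⟨K, hK⟩ := hF.exists_norm_stieltjes_le hc (abs_pos.2 hx)
  rw [tendsto_iff_ultrafilter]
  intro g hg
  have hpos : ∀ᶠ ε in (g : Filter ℝ), 0 < ε := hg self_mem_nhdsWithin
  obtain ⟨w, -, hw⟩ := (isCompact_closedBall (0 : ℂ) K).ultrafilter_le_nhds
    (g.map fun ε : ℝ => stieltjes F (x + ε * I))
    (le_principal_iff.2 (hpos.mono fun ε hε => mem_closedBall_zero_iff.2 (hK x ε le_rfl hε)))
  have hlim : Tendsto (fun ε : ℝ => stieltjes F (x + ε * I)) g (𝓝 w) := hw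
  obtain ⟨hwim, hroot, hle⟩ := hclosed.mem_of_tendsto
    (((tendsto_ofReal_add_mul_I x).mono_left hg).prodMk_nhds hlim) <| by
      filter_upwards [hpos] with ε hε
      have hz : 0 < (x + ε * I : ℂ).im := by simpa using hε
      exact ⟨(im_stieltjes_pos F hz).le, hF hz,
        norm_sq_root_le hz.le (im_stieltjes_pos F hz) (hF hz)⟩
  rw [← im_boundary_root_eq hc hx hwim hroot hle]
  exact (Complex.continuous_im.tendsto w).comp hlim

lemma SolvesCubic.measureReal_singleton [IsFiniteMeasure F] (hF : SolvesCubic c F) (hc : 0 < c)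
    (hx : x ≠ 0) : F.real {x} = 0 := by
  obtain ⟨K, hK⟩ := hF.exists_norm_stieltjes_le hc (abs_pos.2 hx)
  have hzero : Tendsto (fun ε : ℝ => -(ε * I) * stieltjes F (x + ε * I)) (𝓝[>] 0) (𝓝 0) := by
    refine squeeze_zero_norm' (a := fun ε : ℝ => |ε| * K) ?_ ?_
    · filter_upwards [self_mem_nhdsWithin] with ε hε
      calc ‖-(ε * I) * stieltjes F (x + ε * I)‖ = |ε| * ‖stieltjes F (x + ε * I)‖ := by simp
        _ ≤ |ε| * K := by
          gcongr
          exact hK x ε le_rfl hε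
    · have : Continuous fun ε : ℝ => |ε| * K := by fun_prop
      simpa using (this.tendsto 0).mono_left (nhdsWithin_le_nhds (s := Set.Ioi 0))
  exact_mod_cast tendsto_nhds_unique (tendsto_neg_mul_stieltjes F x) hzero

lemma SolvesCubic.measureReal_Ioo [IsFiniteMeasure F] (hF : SolvesCubic c F) (hc : 0 < c)
    {a b : ℝ} (hab : a < b) (h0 : (0 : ℝ) ∉ Set.Icc a b) :
    F.real (Set.Ioo a b) = ∫ t in a..b, densityFormula c t := by
  have hne : ∀ t ∈ Set.Icc a b, t ≠ 0 := fun t ht h => h0 (h ▸ ht)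
  have hIcc : F.real (Set.Icc a b) = F.real (Set.Ioo a b) := by
    have hnull : ∀ t ∈ Set.Icc a b, F {t} = 0 := fun t ht =>
      (measureReal_eq_zero_iff).1 (hF.measureReal_singleton hc (hne t ht))
    exact (measureReal_congr (Ioo_ae_eq_Icc' (hnull a (Set.left_mem_Icc.2 hab.le))
      (hnull b (Set.right_mem_Icc.2 hab.le)))).symm
  have hinv := tendsto_integral_im_stieltjes F hab
  obtain ⟨K, hK⟩ := hF.exists_norm_stieltjes_le hc
    (lt_min (abs_pos.2 (hne a (Set.left_mem_Icc.2 hab.le)))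
      (abs_pos.2 (hne b (Set.right_mem_Icc.2 hab.le))))
  have hmin : ∀ t ∈ Set.uIoc a b, min |a| |b| ≤ |t| ∧ t ≠ 0 := by
    intro t ht
    rw [Set.uIoc_of_le hab.le] at ht
    refine ⟨?_, hne t ⟨ht.1.le, ht.2⟩⟩
    grind
  have hdom : Tendsto (fun ε : ℝ => ∫ t in a..b, (stieltjes F (t + ε * I)).im) (𝓝[>] 0)
      (𝓝 (∫ t in a..b, π * densityFormula c t)) := by
    refine intervalIntegral.tendsto_integral_filter_of_dominated_convergence (fun _ => K) ?_ ?_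
      intervalIntegrable_const (ae_of_all _ fun t ht => hF.tendsto_im_stieltjes hc (hmin t ht).2)
    · filter_upwards [self_mem_nhdsWithin] with ε hε
      exact (Complex.continuous_im.comp (continuous_stieltjes_line F hε)).aestronglyMeasurable
    · filter_upwards [self_mem_nhdsWithin] with ε hε
      exact ae_of_all _ fun t ht => (Complex.abs_im_le_norm _).trans (hK t ε (hmin t ht).1 hε)
  have h := tendsto_nhds_unique hinv hdom
  rw [intervalIntegral.integral_const_mul, hIcc] at h
  exact mul_left_cancel₀ Real.pi_ne_zero (by linarith)

end CubicSolutions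

section DistributionFunction

variable {c x : ℝ} {F G : Measure ℝ} [IsProbabilityMeasure F] [IsProbabilityMeasure G]

lemma SolvesCubic.cdf_eq_add_integral (hF : SolvesCubic c F) (hc : 0 < c) {a b : ℝ} (hab : a < b)
    (h0 : (0 : ℝ) ∉ Set.Icc a b) : cdf F b = cdf F a + ∫ t in a..b, densityFormula c t := by
  have hb : b ≠ 0 := fun h => h0 ⟨h ▸ hab.le, h.ge⟩
  have hIoc : F.real (Set.Ioc a b) = F.real (Set.Ioo a b) :=
    (measureReal_congr (Ioo_ae_eq_Ioc'
      ((measureReal_eq_zero_iff).1 (hF.measureReal_singleton hc hb)))).symm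
  rw [← hF.measureReal_Ioo hc hab h0, ← hIoc, cdf_eq_real, cdf_eq_real,
    ← measureReal_union (Set.Iic_disjoint_Ioc le_rfl) measurableSet_Ioc,
    Set.Iic_union_Ioc_eq_Iic hab.le]

theorem SolvesCubic.hasDerivAt_cdf (hF : SolvesCubic c F) (hc : 0 < c) (hx : x ≠ 0) :
    HasDerivAt (fun t : ℝ => cdf F t) (densityFormula c x) x := by
  obtain ⟨a, hax, b, hxb, h0⟩ : ∃ a < x, ∃ b > x, (0 : ℝ) ∉ Set.Icc a b := by
    rcases hx.lt_or_gt with h | h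
    · exact ⟨2 * x, by linarith, x / 2, by linarith, fun h' => by linarith [h'.2]⟩
    · exact ⟨x / 2, by linarith, 2 * x, by linarith, fun h' => by linarith [h'.1]⟩
  have hcont : ContinuousOn (densityFormula c) (Set.Icc a b) := fun t ht =>
    (continuousAt_densityFormula fun h => h0 (h ▸ ht)).continuousWithinAt
  have hint : HasDerivAt (fun u => cdf F a + ∫ t in a..u, densityFormula c t)
      (densityFormula c x) x := by
    refine (intervalIntegral.integral_hasDerivAt_right ?_ ?_
      (continuousAt_densityFormula hx)).const_add _
    · exact (hcont.mono (Set.Icc_subset_Icc_right hxb.le)).intervalIntegrable_of_Icc hax.le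
    · exact (hcont.mono Set.Ioo_subset_Icc_self).stronglyMeasurableAtFilter isOpen_Ioo x ⟨hax, hxb⟩
  refine hint.congr_of_eventuallyEq ?_
  filter_upwards [Ioo_mem_nhds hax hxb] with t ht
  exact hF.cdf_eq_add_integral hc ht.1 fun h => h0 ⟨h.1, h.2.trans ht.2.le⟩

/-- Off the origin the density is prescribed by `densityFormula`, so the distribution functions of
two solutions differ by a constant on either side of it; the limits at `±∞` force both constants
to vanish. -/
theorem SolvesCubic.measure_eq (hF : SolvesCubic c F) (hG : SolvesCubic c G) (hc : 0 < c) :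
    F = G := by
  set D : ℝ → ℝ := fun t => cdf F t - cdf G t
  have hderiv : ∀ t ≠ 0, HasDerivAt D 0 t := fun t ht =>
    ((hF.hasDerivAt_cdf hc ht).sub (hG.hasDerivAt_cdf hc ht)).congr_deriv (sub_self _)
  have hconst : ∀ {s : Set ℝ}, IsOpen s → IsPreconnected s → (∀ t ∈ s, t ≠ 0) →
      ∀ {u v}, u ∈ s → v ∈ s → D u = D v := fun hs hs' hne _ _ hu hv =>
    hs.is_const_of_deriv_eq_zero hs' (fun t ht => (hderiv t (hne t ht)).differentiableAt
      |>.differentiableWithinAt) (fun t ht => (hderiv t (hne t ht)).deriv) hu hv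
  have hneg : ∀ u < 0, D u = 0 := fun u hu => by
    have hbot : Tendsto D atBot (𝓝 0) := by
      simpa using (tendsto_cdf_atBot F).sub (tendsto_cdf_atBot G)
    refine tendsto_nhds_unique (tendsto_const_nhds.congr' ?_) hbot
    filter_upwards [eventually_lt_atBot 0] with v hv
    exact hconst isOpen_Iio isPreconnected_Iio (fun t ht => ht.ne) hu hv
  have hpos : ∀ u > 0, D u = 0 := fun u hu => by
    have htop : Tendsto D atTop (𝓝 0) := by
      simpa using (tendsto_cdf_atTop F).sub (tendsto_cdf_atTop G)
    refine tendsto_nhds_unique (tendsto_const_nhds.congr' ?_) htop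
    filter_upwards [eventually_gt_atTop 0] with v hv
    exact hconst isOpen_Ioi isPreconnected_Ioi (fun t ht => ht.ne') hu hv
  have hzero : D 0 = 0 := by
    have hright : Tendsto D (𝓝[>] 0) (𝓝 (D 0)) :=
      (((cdf F).right_continuous 0).sub ((cdf G).right_continuous 0)).tendsto.mono_left
        (nhdsWithin_mono 0 Set.Ioi_subset_Ici_self)
    refine tendsto_nhds_unique hright (tendsto_const_nhds.congr' ?_)
    filter_upwards [self_mem_nhdsWithin] with u hu
    exact (hpos u hu).symm
  refine Measure.eq_of_cdf F G (StieltjesFunction.ext fun t => sub_eq_zero.1 ?_)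
  rcases lt_trichotomy t 0 with ht | rfl | ht
  exacts [hneg t ht, hzero, hpos t ht]

lemma continuousAt_cdf_iff (a : ℝ) :
    ContinuousAt (fun t : ℝ => cdf F t) a ↔ F.real {a} = 0 := by
  have hmass : F {a} = ENNReal.ofReal (cdf F a - Function.leftLim (cdf F) a) := by
    conv_lhs => rw [← measure_cdf F]
    exact StieltjesFunction.measure_singleton _ _
  rw [(cdf F).mono.continuousAt_iff_leftLim_eq_rightLim, StieltjesFunction.rightLim_eq,
    measureReal_eq_zero_iff, hmass, ENNReal.ofReal_eq_zero, sub_nonpos,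
    ((cdf F).mono.leftLim_le le_rfl).ge_iff_eq]

lemma tendsto_neg_mul_stieltjes_zero (μ : Measure ℝ) [IsFiniteMeasure μ] :
    Tendsto (fun ε : ℝ => -(ε * I) * stieltjes μ (ε * I)) (𝓝[>] 0) (𝓝 (μ.real {0} : ℂ)) := by
  simpa using tendsto_neg_mul_stieltjes μ 0

lemma SolvesCubic.atom_equation (hF : SolvesCubic c F) :
    c ^ 2 * F.real {0} ^ 3 + (2 * c - c ^ 2) * F.real {0} ^ 2 = 0 := by
  have hclosed : IsClosed {p : ℂ × ℂ | (c : ℂ) ^ 2 * p.2 ^ 3 + (2 * c - c ^ 2) * p.2 ^ 2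
      - p.1 ^ 2 * p.2 + p.1 ^ 2 = 0} := isClosed_eq (by fun_prop) continuous_const
  have hlim := hclosed.mem_of_tendsto
    ((tendsto_ofReal_add_mul_I 0).prodMk_nhds (tendsto_neg_mul_stieltjes_zero F)) <| by
      filter_upwards [self_mem_nhdsWithin] with ε hε
      have h := hF (z := ε * I) (by simpa using hε)
      simp only [lsdCubic] at h
      simp only [Complex.ofReal_zero, zero_add]
      linear_combination (ε * I) ^ 2 * h
  have hzero : (c : ℂ) ^ 2 * (F.real {0} : ℂ) ^ 3 + (2 * c - c ^ 2) * (F.real {0} : ℂ) ^ 2 = 0 := by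
    simpa using hlim
  exact_mod_cast hzero

lemma SolvesCubic.measureReal_zero_eq_zero (hF : SolvesCubic c F) (hc : 0 < c) (hc2 : c < 2) :
    F.real {0} = 0 := by
  have hfactor : F.real {0} ^ 2 * (c ^ 2 * F.real {0} + c * (2 - c)) = 0 := by
    linear_combination hF.atom_equation
  have : 0 < 2 - c := sub_pos.2 hc2
  have hpos : 0 < c ^ 2 * F.real {0} + c * (2 - c) := by positivity
  exact pow_eq_zero_iff two_ne_zero |>.1 ((mul_eq_zero.1 hfactor).resolve_right hpos.ne')

lemma SolvesCubic.tendsto_sq_stieltjes (hF : SolvesCubic c F) (hκ : c * (c - 2) ≠ 0)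
    (h0 : F.real {0} = 0) :
    Tendsto (fun ε : ℝ => stieltjes F (ε * I) ^ 2) (𝓝[>] 0) (𝓝 (((c * (c - 2))⁻¹ : ℝ) : ℂ)) := by
  have hmass := tendsto_neg_mul_stieltjes_zero F
  rw [h0, Complex.ofReal_zero] at hmass
  have hκ' : (c * (c - 2) : ℂ) ≠ 0 := by exact_mod_cast hκ
  have hden : Tendsto (fun ε : ℝ => (c * (c - 2) : ℂ) - c ^ 2 * (-(ε * I) * stieltjes F (ε * I)))
      (𝓝[>] 0) (𝓝 (c * (c - 2))) := by
    simpa using (hmass.const_mul ((c : ℂ) ^ 2)).const_sub (c * (c - 2) : ℂ)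
  have hquot := (hmass.const_sub 1).div hden hκ'
  rw [sub_zero, one_div] at hquot
  push_cast
  refine hquot.congr' ?_
  filter_upwards [self_mem_nhdsWithin, hden.eventually_ne hκ'] with ε hε hne
  have h := hF (z := ε * I) (by simpa using hε)
  simp only [lsdCubic] at h
  rw [Pi.div_apply, div_eq_iff hne]
  linear_combination h

/-- Without an atom at `0` the squares of `stieltjes F (ε * I)` would have the limit
`(c * (c - 2))⁻¹`, which violates the inequality satisfied by every root with `0 < im m`. -/
lemma SolvesCubic.measureReal_zero_ne_zero (hF : SolvesCubic c F) (hc2 : 2 < c) :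
    F.real {0} ≠ 0 := by
  intro h0
  have := hF.neZero
  have hκ : 0 < c * (c - 2) := mul_pos (by linarith) (by linarith)
  have hclosed : IsClosed {w : ℂ | 2 * c * ‖w‖ * (1 + c ^ 2 * ‖w‖) ≤ ‖1 - (c : ℂ) ^ 2 * w‖ ^ 2} :=
    isClosed_le (by fun_prop) (by fun_prop)
  have hle := hclosed.mem_of_tendsto (hF.tendsto_sq_stieltjes hκ.ne' h0) <| by
    filter_upwards [self_mem_nhdsWithin] with ε hε
    have hz : 0 < (ε * I : ℂ).im := by simpa using hε
    simpa only [Set.mem_ofPred, norm_pow] using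
      norm_sq_root_le hz.le (im_stieltjes_pos F hz) (hF hz)
  have hnorm : ‖1 - (c : ℂ) ^ 2 * ((c * (c - 2))⁻¹ : ℝ)‖ ^ 2 =
      (1 - c ^ 2 * (c * (c - 2))⁻¹) ^ 2 := by
    rw [← Complex.ofReal_pow, ← Complex.ofReal_mul, ← Complex.ofReal_one,
      ← Complex.ofReal_sub, Complex.norm_real, Real.norm_eq_abs, sq_abs]
  rw [Set.mem_ofPred, hnorm, Complex.norm_real, Real.norm_of_nonneg (inv_pos.2 hκ).le] at hle
  have hc0 : c ≠ 0 := by linarith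
  have hc2' : 0 < c - 2 := by linarith
  have hleft : 2 * c * (c * (c - 2))⁻¹ * (1 + c ^ 2 * (c * (c - 2))⁻¹)
      = 4 * (c - 1) / (c - 2) ^ 2 := by
    field_simp
    ring
  have hright : (1 - c ^ 2 * (c * (c - 2))⁻¹) ^ 2 = 4 / (c - 2) ^ 2 := by
    field_simp
    ring
  rw [hleft, hright, div_le_div_iff_of_pos_right (by positivity)] at hle
  linarith

theorem SolvesCubic.hasDerivAt_cdf_zero (hF : SolvesCubic c F) (hc : 0 < c) (hc2 : c < 2) :
    HasDerivAt (fun t : ℝ => cdf F t) (1 / (π * √(2 * c - c ^ 2))) 0 := by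
  classical
  set f := Function.update (densityFormula c) 0 (1 / (π * √(2 * c - c ^ 2))) with hf
  have hcont : ContinuousAt f 0 :=
    continuousAt_update_same.2 (tendsto_densityFormula_zero hc hc2)
  have h := hasDerivAt_of_hasDerivAt_of_ne (f := fun t : ℝ => cdf F t) (g := f)
    (fun y hy => (hF.hasDerivAt_cdf hc hy).congr_deriv (Function.update_of_ne hy _ _).symm)
    ((continuousAt_cdf_iff 0).2 (hF.measureReal_zero_eq_zero hc hc2)) hcont
  rwa [hf, Function.update_self] at h

lemma SolvesCubic.not_differentiableAt_cdf_two (hF : SolvesCubic 2 F) :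
    ¬ DifferentiableAt ℝ (fun t : ℝ => cdf F t) 0 := by
  intro hdiff
  set D := deriv (fun t : ℝ => cdf F t) 0
  have hright : 𝓝[>] (0 : ℝ) ≤ 𝓝[≠] 0 := nhdsWithin_mono 0 fun x hx => ne_of_gt hx
  have hslope : ∀ᶠ x : ℝ in 𝓝[>] 0, slope (fun t : ℝ => cdf F t) 0 x < D + 1 :=
    ((hasDerivAt_iff_tendsto_slope.1 hdiff.hasDerivAt).mono_left hright).eventually_lt_const
      (lt_add_one D)
  have hdensity : ∀ᶠ x : ℝ in 𝓝[>] 0, D + 1 < densityFormula 2 x :=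
    (tendsto_densityFormula_two.mono_left hright).eventually_gt_atTop _
  obtain ⟨δ, hδ, hsub⟩ := mem_nhdsGT_iff_exists_Ioo_subset.1 (hslope.and hdensity)
  have hδ : 0 < δ := hδ
  obtain ⟨ξ, hξ, hξe⟩ := exists_hasDerivAt_eq_slope (fun t : ℝ => cdf F t) (densityFormula 2)
    (a := 0) (b := δ / 2) (by linarith) (fun t ht => by
      rcases ht.1.eq_or_lt with h | h
      · exact h ▸ hdiff.continuousAt.continuousWithinAt
      · exact (hF.hasDerivAt_cdf two_pos h.ne').continuousAt.continuousWithinAt)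
    (fun t ht => hF.hasDerivAt_cdf two_pos ht.1.ne')
  have hslopeδ := (hsub ⟨by linarith, by linarith⟩ : δ / 2 ∈ _).1
  have hdensityξ := (hsub ⟨hξ.1, by linarith [hξ.2]⟩ : ξ ∈ _).2
  rw [slope_def_field] at hslopeδ
  linarith

theorem SolvesCubic.differentiableAt_cdf_zero_iff (hF : SolvesCubic c F) (hc : 0 < c) :
    DifferentiableAt ℝ (fun t : ℝ => cdf F t) 0 ↔ c < 2 := by
  refine ⟨fun h => ?_, fun h => (hF.hasDerivAt_cdf_zero hc h).differentiableAt⟩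
  by_contra! hc2
  rcases hc2.eq_or_lt with rfl | hc2
  · exact hF.not_differentiableAt_cdf_two h
  · exact hF.measureReal_zero_ne_zero hc2 ((continuousAt_cdf_iff 0).1 h.continuousAt)

theorem SolvesCubic.continuousAt_deriv_cdf (hF : SolvesCubic c F) (hc : 0 < c)
    (hx : DifferentiableAt ℝ (fun t : ℝ => cdf F t) x) :
    ContinuousAt (deriv fun t : ℝ => cdf F t) x := by
  have hderiv : ∀ y ≠ 0, densityFormula c y = deriv (fun t : ℝ => cdf F t) y := fun y hy =>
    (hF.hasDerivAt_cdf hc hy).deriv.symm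
  rcases eq_or_ne x 0 with rfl | h0
  · have hc2 := (hF.differentiableAt_cdf_zero_iff hc).1 hx
    rw [← continuousWithinAt_compl_self, ContinuousWithinAt, (hF.hasDerivAt_cdf_zero hc hc2).deriv]
    exact (tendsto_densityFormula_zero hc hc2).congr'
      (eventually_nhdsWithin_of_forall fun y hy => hderiv y hy)
  · exact (continuousAt_densityFormula h0).congr
      (mem_of_superset (isOpen_ne.mem_nhds h0) hderiv)

end DistributionFunction

/-! ### Resolvents of Hermitian matrices -/

section Resolvent

open Matrix

variable {ι : Type*}

lemma isHermitian_add_smul_vecMulVec {H : Matrix ι ι ℂ} (hH : H.IsHermitian) (t : ℝ) (u : ι → ℂ) :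
    (H + (t : ℂ) • vecMulVec u (star u)).IsHermitian := by
  have hrank : (vecMulVec u (star u)).IsHermitian := by
    rw [IsHermitian, conjTranspose_vecMulVec, star_star]
  exact hH.add (hrank.smul (Complex.conj_ofReal t))

variable [Fintype ι]

/-- The squared Euclidean norm of a complex vector, kept as a finite sum because the moment
computations below expand it. -/
def sqNorm (u : ι → ℂ) : ℝ := ∑ i, ‖u i‖ ^ 2

lemma sqNorm_nonneg (u : ι → ℂ) : 0 ≤ sqNorm u := Finset.sum_nonneg fun _ _ => sq_nonneg _

lemma star_dotProduct_self (u : ι → ℂ) : star u ⬝ᵥ u = (sqNorm u : ℂ) := by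
  simp [dotProduct, sqNorm, ← Complex.conj_mul']

lemma norm_star_dotProduct_sq_le (u w : ι → ℂ) :
    ‖star u ⬝ᵥ w‖ ^ 2 ≤ sqNorm u * sqNorm w := by
  have hsum : ‖star u ⬝ᵥ w‖ ≤ ∑ i, ‖u i‖ * ‖w i‖ :=
    (norm_sum_le _ _).trans_eq (Finset.sum_congr rfl fun i _ => by simp)
  calc ‖star u ⬝ᵥ w‖ ^ 2 ≤ (∑ i, ‖u i‖ * ‖w i‖) ^ 2 := by gcongr
    _ ≤ sqNorm u * sqNorm w := Finset.sum_mul_sq_le_sq_mul_sq _ _ _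

lemma sqNorm_eq_zero {u : ι → ℂ} : sqNorm u = 0 ↔ u = 0 := by
  simp [sqNorm, Finset.sum_eq_zero_iff_of_nonneg, funext_iff]

lemma trace_mul_vecMulVec_star_mul (A B : Matrix ι ι ℂ) (u w : ι → ℂ) :
    (A * vecMulVec u (star w) * B).trace = star w ⬝ᵥ (B *ᵥ (A *ᵥ u)) := by
  rw [trace_mul_comm, ← Matrix.mul_assoc, mul_vecMulVec, trace_vecMulVec, dotProduct_comm,
    mulVec_mulVec]

variable [DecidableEq ι]

lemma sqNorm_single_one (i : ι) : sqNorm (Pi.single i (1 : ℂ)) = 1 := by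
  rw [sqNorm, Finset.sum_eq_single i] <;> simp +contextual

/-- The resolvent `(H - z)⁻¹` of a matrix. It has the junk value `0` at the eigenvalues of `H`; for
Hermitian `H` it is only used on the upper half-plane. -/
def resolv (H : Matrix ι ι ℂ) (z : ℂ) : Matrix ι ι ℂ := (H - z • 1)⁻¹

variable {H H' : Matrix ι ι ℂ} {z : ℂ}

lemma isUnit_sub_smul (hH : H.IsHermitian) (hz : 0 < z.im) : IsUnit (H - z • 1) := by
  rw [← mulVec_injective_iff_isUnit]
  refine (injective_iff_map_eq_zero (H - z • 1).mulVecLin).2 fun w hw => ?_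
  have heigen : H *ᵥ w = z • w := by
    simpa [sub_mulVec, smul_mulVec, sub_eq_zero] using hw
  have hreal : (star w ⬝ᵥ (H *ᵥ w)).im = 0 := hH.im_star_dotProduct_mulVec_self w
  rw [heigen, dotProduct_smul, star_dotProduct_self, smul_eq_mul, Complex.im_mul_ofReal] at hreal
  exact sqNorm_eq_zero.1 ((mul_eq_zero.1 hreal).resolve_left hz.ne')

lemma sub_mul_resolv (hH : H.IsHermitian) (hz : 0 < z.im) : (H - z • 1) * resolv H z = 1 :=
  mul_nonsing_inv _ ((isUnit_iff_isUnit_det _).1 (isUnit_sub_smul hH hz))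

lemma resolv_mul_sub (hH : H.IsHermitian) (hz : 0 < z.im) : resolv H z * (H - z • 1) = 1 :=
  nonsing_inv_mul _ ((isUnit_iff_isUnit_det _).1 (isUnit_sub_smul hH hz))

lemma resolv_sub_resolv (hH : H.IsHermitian) (hH' : H'.IsHermitian) (hz : 0 < z.im) :
    resolv H z - resolv H' z = resolv H z * (H' - H) * resolv H' z := by
  rw [← sub_sub_sub_cancel_right H' H (z • 1), Matrix.mul_sub, Matrix.sub_mul,
    resolv_mul_sub hH hz, Matrix.mul_assoc, sub_mul_resolv hH' hz, Matrix.mul_one, Matrix.one_mul]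

lemma conjTranspose_resolv (hH : H.IsHermitian) (z : ℂ) : (resolv H z)ᴴ = resolv H (star z) := by
  rw [resolv, conjTranspose_nonsing_inv, conjTranspose_sub, hH.eq, conjTranspose_smul,
    conjTranspose_one, resolv]

lemma resolv_mul_comm (H : Matrix ι ι ℂ) (z w : ℂ) :
    resolv H z * resolv H w = resolv H w * resolv H z := by
  have hcomm : Commute (H - w • 1) (H - z • 1) :=
    ((Commute.refl H).sub_left ((Commute.one_left H).smul_left w)).sub_right
      ((Commute.one_right _).smul_right z)
  rw [resolv, resolv, ← Matrix.mul_inv_rev, ← Matrix.mul_inv_rev, hcomm.eq]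

lemma sqNorm_conjTranspose_resolv_mulVec (hH : H.IsHermitian) (z : ℂ) (u : ι → ℂ) :
    sqNorm ((resolv H z)ᴴ *ᵥ u) = sqNorm (resolv H z *ᵥ u) := by
  refine Complex.ofReal_injective ?_
  rw [← star_dotProduct_self, ← star_dotProduct_self, star_mulVec, star_mulVec, ← dotProduct_mulVec,
    ← dotProduct_mulVec, mulVec_mulVec, mulVec_mulVec, conjTranspose_conjTranspose,
    conjTranspose_resolv hH, resolv_mul_comm]

theorem im_star_dotProduct_resolv (hH : H.IsHermitian) (hz : 0 < z.im) (u : ι → ℂ) :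
    (star u ⬝ᵥ (resolv H z *ᵥ u)).im = z.im * sqNorm (resolv H z *ᵥ u) := by
  set w := resolv H z *ᵥ u with hw
  have hu : u = H *ᵥ w - z • w := by
    rw [← one_mulVec u, ← sub_mul_resolv hH hz, ← mulVec_mulVec, ← hw, sub_mulVec, smul_mulVec,
      one_mulVec]
  have hsymm : star (H *ᵥ w) ⬝ᵥ w = star w ⬝ᵥ (H *ᵥ w) := by
    rw [star_mulVec, hH.eq, ← dotProduct_mulVec]
  have hreal : (star w ⬝ᵥ (H *ᵥ w)).im = 0 := hH.im_star_dotProduct_mulVec_self w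
  rw [hu, star_sub, sub_dotProduct, hsymm, star_smul, smul_dotProduct, star_dotProduct_self,
    Complex.sub_im, hreal, smul_eq_mul, Complex.im_mul_ofReal]
  simp

lemma sqNorm_resolv_mulVec_le (hH : H.IsHermitian) (hz : 0 < z.im) (u : ι → ℂ) :
    sqNorm (resolv H z *ᵥ u) ≤ sqNorm u / z.im ^ 2 := by
  set N := sqNorm (resolv H z *ᵥ u)
  have hN : 0 ≤ N := sqNorm_nonneg _
  have him : z.im * N ≤ ‖star u ⬝ᵥ (resolv H z *ᵥ u)‖ := by
    rw [← im_star_dotProduct_resolv hH hz u]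
    exact (le_abs_self _).trans (Complex.abs_im_le_norm _)
  have hsq : (z.im * N) ^ 2 ≤ sqNorm u * N :=
    (pow_le_pow_left₀ (by positivity) him 2).trans (norm_star_dotProduct_sq_le _ _)
  rw [le_div_iff₀ (by positivity)]
  rcases hN.eq_or_lt with h0 | h0
  · rw [← h0, zero_mul]
    exact sqNorm_nonneg u
  · exact le_of_mul_le_mul_right (by linarith) h0

lemma norm_resolv_form_le (hH : H.IsHermitian) (hz : 0 < z.im) (u w : ι → ℂ) :
    ‖star u ⬝ᵥ (resolv H z *ᵥ w)‖ ≤ (sqNorm u + sqNorm w) / (2 * z.im) := by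
  have hu := sqNorm_nonneg u
  have hw := sqNorm_nonneg w
  rw [← pow_le_pow_iff_left₀ (norm_nonneg _) (by positivity) two_ne_zero]
  calc ‖star u ⬝ᵥ (resolv H z *ᵥ w)‖ ^ 2 ≤ sqNorm u * sqNorm (resolv H z *ᵥ w) :=
        norm_star_dotProduct_sq_le _ _
    _ ≤ sqNorm u * (sqNorm w / z.im ^ 2) := by
        gcongr
        exact sqNorm_resolv_mulVec_le hH hz w
    _ = 4 * sqNorm u * sqNorm w / (2 * z.im) ^ 2 := by
        field_simp
        ring
    _ ≤ ((sqNorm u + sqNorm w) / (2 * z.im)) ^ 2 := by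
        rw [div_pow]
        gcongr
        exact four_mul_le_sq_add _ _

lemma norm_resolv_apply_le (hH : H.IsHermitian) (hz : 0 < z.im) (i j : ι) :
    ‖resolv H z i j‖ ≤ 1 / z.im := by
  have h := norm_resolv_form_le hH hz (Pi.single i 1) (Pi.single j 1)
  rw [sqNorm_single_one, sqNorm_single_one, ← Pi.single_star, star_one, mulVec_single_one,
    single_one_dotProduct] at h
  exact h.trans_eq (by field_simp; norm_num)

lemma sum_norm_resolv_sq_le (hH : H.IsHermitian) (hz : 0 < z.im) :
    ∑ i, ∑ j, ‖resolv H z i j‖ ^ 2 ≤ Fintype.card ι / z.im ^ 2 := by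
  have hcol : ∀ j, ∑ i, ‖resolv H z i j‖ ^ 2 ≤ 1 / z.im ^ 2 := fun j => by
    have h := sqNorm_resolv_mulVec_le hH hz (Pi.single j 1)
    rwa [sqNorm_single_one, mulVec_single_one] at h
  rw [Finset.sum_comm]
  exact (Finset.sum_le_sum fun j _ => hcol j).trans_eq (by simp [div_eq_mul_inv])

/-- The Sherman–Morrison formula, with the denominator cleared. -/
lemma smul_resolv_add_vecMulVec_mulVec (hH : H.IsHermitian) (hz : 0 < z.im) (t : ℝ) (u : ι → ℂ) :
    (1 + t * (star u ⬝ᵥ (resolv H z *ᵥ u))) •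
      (resolv (H + (t : ℂ) • vecMulVec u (star u)) z *ᵥ u) = resolv H z *ᵥ u := by
  set G' := resolv (H + (t : ℂ) • vecMulVec u (star u)) z
  have hid : G' *ᵥ u - resolv H z *ᵥ u =
      -((t * (star u ⬝ᵥ (resolv H z *ᵥ u))) • (G' *ᵥ u)) := by
    rw [← sub_mulVec, resolv_sub_resolv (isHermitian_add_smul_vecMulVec hH t u) hH hz,
      sub_add_cancel_left, ← mulVec_mulVec, ← mulVec_mulVec, neg_mulVec, smul_mulVec,
      vecMulVec_mulVec, op_smul_eq_smul, smul_smul, mulVec_neg, mulVec_smul]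
  linear_combination (norm := module) hid

lemma trace_resolv_add_vecMulVec_sub (hH : H.IsHermitian) (hz : 0 < z.im) (t : ℝ) (u : ι → ℂ) :
    (resolv (H + (t : ℂ) • vecMulVec u (star u)) z).trace - (resolv H z).trace =
      -t * (star u ⬝ᵥ
        (resolv H z *ᵥ (resolv (H + (t : ℂ) • vecMulVec u (star u)) z *ᵥ u))) := by
  rw [← trace_sub, resolv_sub_resolv
    (isHermitian_add_smul_vecMulVec hH t u) hH hz,
    sub_add_cancel_left, Matrix.mul_neg, Matrix.neg_mul, Matrix.mul_smul, Matrix.smul_mul,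
    trace_neg, trace_smul, trace_mul_vecMulVec_star_mul, smul_eq_mul, neg_mul]

/-- With `q = uᴴ G u`, both `(1 + t q)` times the change of the trace and `im (1 + t q)` are
controlled by `t ‖G u‖²`, so the ratio does not depend on `t` and `u`. -/
theorem norm_trace_resolv_rank_one_le (hH : H.IsHermitian) (hz : 0 < z.im) (t : ℝ) (u : ι → ℂ) :
    ‖(resolv (H + (t : ℂ) • vecMulVec u (star u)) z).trace - (resolv H z).trace‖ ≤ 1 / z.im := by
  have hsm := smul_resolv_add_vecMulVec_mulVec hH hz t u
  rw [trace_resolv_add_vecMulVec_sub hH hz]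
  set G := resolv H z
  set G' := resolv (H + (t : ℂ) • vecMulVec u (star u)) z
  set q := star u ⬝ᵥ (G *ᵥ u) with hq
  set N := sqNorm (G *ᵥ u)
  have hN : 0 ≤ N := sqNorm_nonneg _
  have hform : ‖1 + t * q‖ * ‖star u ⬝ᵥ (G *ᵥ (G' *ᵥ u))‖ ≤ N := by
    have hmul : (1 + t * q) * (star u ⬝ᵥ (G *ᵥ (G' *ᵥ u))) = star (Gᴴ *ᵥ u) ⬝ᵥ (G *ᵥ u) := by
      rw [← smul_eq_mul, ← dotProduct_smul, ← mulVec_smul, hsm, star_mulVec,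
        conjTranspose_conjTranspose, dotProduct_mulVec]
    have hCS := norm_star_dotProduct_sq_le (Gᴴ *ᵥ u) (G *ᵥ u)
    rw [sqNorm_conjTranspose_resolv_mulVec hH, ← hmul, ← sq, norm_mul] at hCS
    exact (pow_le_pow_iff_left₀ (by positivity) hN two_ne_zero).1 hCS
  have him : |t| * (z.im * N) ≤ ‖1 + t * q‖ := by
    calc |t| * (z.im * N) = |(1 + t * q).im| := by
          rw [Complex.add_im, Complex.one_im, zero_add, Complex.im_ofReal_mul,
            im_star_dotProduct_resolv hH hz, abs_mul, abs_of_nonneg (mul_nonneg hz.le hN)]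
      _ ≤ ‖1 + t * q‖ := Complex.abs_im_le_norm _
  have hpos : 0 < ‖1 + t * q‖ := by
    refine norm_pos_iff.2 fun h0 => ?_
    have hq0 : q = 0 := by rw [hq, ← hsm, h0, zero_smul, dotProduct_zero]
    simp [hq0] at h0
  rw [norm_mul, norm_neg, Complex.norm_real, Real.norm_eq_abs, le_div_iff₀ hz]
  refine le_of_mul_le_mul_right ?_ hpos
  calc |t| * ‖star u ⬝ᵥ (G *ᵥ (G' *ᵥ u))‖ * z.im * ‖1 + t * q‖
      = |t| * z.im * (‖1 + t * q‖ * ‖star u ⬝ᵥ (G *ᵥ (G' *ᵥ u))‖) := by ring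
    _ ≤ |t| * z.im * N := by gcongr
    _ ≤ 1 * ‖1 + t * q‖ := by linarith

theorem trace_resolv (hH : H.IsHermitian) (hz : 0 < z.im) :
    (resolv H z).trace = ∑ i, ((hH.eigenvalues i : ℂ) - z)⁻¹ := by
  set φ := Unitary.conjStarAlgAut ℂ (Matrix ι ι ℂ) hH.eigenvectorUnitary
  have htrace : ∀ A : Matrix ι ι ℂ, (φ A).trace = A.trace := fun A => by
    rw [Unitary.conjStarAlgAut_apply, trace_mul_cycle, Unitary.coe_star_mul_self, Matrix.one_mul]
  have hsub : H - z • 1 = φ (diagonal fun i => (hH.eigenvalues i : ℂ) - z) := by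
    conv_lhs => rw [hH.spectral_theorem, ← map_one φ, ← map_smul, ← map_sub,
      smul_one_eq_diagonal, diagonal_sub]
    rfl
  have hinv : resolv H z = φ (diagonal fun i => ((hH.eigenvalues i : ℂ) - z)⁻¹) := by
    refine inv_eq_right_inv ?_
    rw [hsub, ← map_mul, diagonal_mul_diagonal]
    simp [mul_inv_cancel₀ (ofReal_sub_ne_zero hz _)]
  rw [hinv, htrace, trace_diagonal]

lemma norm_trace_resolv_le (hH : H.IsHermitian) (hz : 0 < z.im) :
    ‖(resolv H z).trace‖ ≤ Fintype.card ι / z.im := by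
  rw [trace_resolv hH hz]
  exact (norm_sum_le_of_le _ fun i _ => norm_inv_ofReal_sub_le hz _).trans_eq
    (by simp [div_eq_mul_inv])

end Resolvent

/-! ### Removing one pair of columns -/

section Columns

open Matrix

variable {p n : ℕ}

/-- The `k`-th of the two vectors `x₀, x₁ ∈ ℂᵖ` encoded by `ξ`. -/
def column (k : Fin 2) (ξ : Fin 2 × Fin p → ℂ) : Fin p → ℂ := fun i => ξ (k, i)

/-- The Hermitian matrix `-i (x₀ x₁ᴴ - x₁ x₀ᴴ)` contributed by one pair of columns. -/
def pairMatrix (ξ : Fin 2 × Fin p → ℂ) : Matrix (Fin p) (Fin p) ℂ :=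
  (-I) • (vecMulVec (column 0 ξ) (star (column 1 ξ)) - vecMulVec (column 1 ξ) (star (column 0 ξ)))

/-- The Hermitian matrix `-i n⁻¹ (X₁ X₂ᴴ - X₂ X₁ᴴ)` as a function of its `n` pairs of columns. -/
def columnMatrix (x : Fin n → Fin 2 × Fin p → ℂ) : Matrix (Fin p) (Fin p) ℂ :=
  (n : ℂ)⁻¹ • ∑ j, pairMatrix (x j)

lemma isHermitian_pairMatrix (ξ : Fin 2 × Fin p → ℂ) : (pairMatrix ξ).IsHermitian := by
  simp [pairMatrix, IsHermitian, conjTranspose_smul, conjTranspose_sub, conjTranspose_vecMulVec,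
    ← smul_neg]

lemma pairMatrix_zero : pairMatrix (0 : Fin 2 × Fin p → ℂ) = 0 := by
  ext i j
  simp [pairMatrix, column, vecMulVec_apply]

lemma isHermitian_inv_natCast_smul {A : Matrix (Fin p) (Fin p) ℂ} (hA : A.IsHermitian) (n : ℕ) :
    ((n : ℂ)⁻¹ • A).IsHermitian := by
  simp [IsHermitian, conjTranspose_smul, hA.eq]

lemma isHermitian_columnMatrix (x : Fin n → Fin 2 × Fin p → ℂ) : (columnMatrix x).IsHermitian := by
  refine isHermitian_inv_natCast_smul ?_ n
  simp [IsHermitian, conjTranspose_sum, (isHermitian_pairMatrix _).eq]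

lemma columnMatrix_update (x : Fin n → Fin 2 × Fin p → ℂ) (j : Fin n) (ξ : Fin 2 × Fin p → ℂ) :
    columnMatrix (Function.update x j ξ)
      = columnMatrix (Function.update x j 0) + (n : ℂ)⁻¹ • pairMatrix ξ := by
  have sum_update (e : Fin 2 × Fin p → ℂ) : ∑ i, pairMatrix (Function.update x j e i)
      = pairMatrix e + ∑ i ∈ Finset.univ.erase j, pairMatrix (x i) := by
    rw [← Finset.add_sum_erase _ _ (Finset.mem_univ j), Function.update_self]
    congr 1
    exact Finset.sum_congr rfl fun i hi => by rw [Function.update_of_ne (Finset.ne_of_mem_erase hi)]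
  rw [columnMatrix, columnMatrix, sum_update, sum_update, pairMatrix_zero, zero_add, add_comm,
    smul_add]

lemma columnMatrix_eq_add (x : Fin n → Fin 2 × Fin p → ℂ) (j : Fin n) :
    columnMatrix x = columnMatrix (Function.update x j 0) + (n : ℂ)⁻¹ • pairMatrix (x j) := by
  rw [← columnMatrix_update, Function.update_eq_self]

lemma pairMatrix_eq_rank_one_add (ξ : Fin 2 × Fin p → ℂ) :
    pairMatrix ξ
      = ((1 / 2 : ℝ) : ℂ) • vecMulVec (column 0 ξ + I • column 1 ξ)
          (star (column 0 ξ + I • column 1 ξ))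
        + ((-(1 / 2) : ℝ) : ℂ) • vecMulVec (column 0 ξ - I • column 1 ξ)
          (star (column 0 ξ - I • column 1 ξ)) := by
  ext i j
  simp only [pairMatrix, Matrix.smul_apply, Matrix.sub_apply, Matrix.add_apply, vecMulVec_apply,
    Pi.star_apply, Pi.add_apply, Pi.sub_apply, Pi.smul_apply, smul_eq_mul, star_add, star_sub,
    star_mul', RCLike.star_def, Complex.conj_I]
  push_cast
  ring

lemma norm_trace_resolv_add_pairMatrix_sub_le {H : Matrix (Fin p) (Fin p) ℂ} {z : ℂ}
    (hH : H.IsHermitian) (hz : 0 < z.im) (n : ℕ) (ξ : Fin 2 × Fin p → ℂ) :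
    ‖(resolv (H + (n : ℂ)⁻¹ • pairMatrix ξ) z).trace - (resolv H z).trace‖ ≤ 2 / z.im := by
  have hcoe (t : ℝ) : (n : ℂ)⁻¹ * t = (((n : ℝ)⁻¹ * t : ℝ) : ℂ) := by push_cast; rfl
  rw [pairMatrix_eq_rank_one_add, smul_add, smul_smul, smul_smul, ← add_assoc, hcoe, hcoe]
  set u := column 0 ξ + I • column 1 ξ
  set t := (n : ℝ)⁻¹ * (1 / 2)
  calc _ ≤ 1 / z.im + 1 / z.im :=
        (norm_sub_le_norm_sub_add_norm_sub _ (resolv (H + (t : ℂ) • vecMulVec u (star u)) z).trace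
          _).trans (add_le_add
            (norm_trace_resolv_rank_one_le (isHermitian_add_smul_vecMulVec hH _ _) hz _ _)
            (norm_trace_resolv_rank_one_le hH hz _ _))
    _ = 2 / z.im := by ring

/-- The normalized sesquilinear form `n⁻¹ x_kᴴ G x_l` of a pair of columns. -/
def form (n : ℕ) (G : Matrix (Fin p) (Fin p) ℂ) (ξ : Fin 2 × Fin p → ℂ) (k l : Fin 2) : ℂ :=
  (n : ℂ)⁻¹ * (star (column k ξ) ⬝ᵥ (G *ᵥ column l ξ))

/-- The deviation of `form n G ξ k l` from its mean when `ξ` has independent standardized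
entries. -/
def formDeviation (n : ℕ) (G : Matrix (Fin p) (Fin p) ℂ) (ξ : Fin 2 × Fin p → ℂ) (k l : Fin 2) :
    ℂ :=
  form n G ξ k l - (n : ℂ)⁻¹ * if k = l then G.trace else 0

/-- The total error made by replacing the forms in `G` and the squared lengths of the columns by
their means. -/
def formError (n : ℕ) (G : Matrix (Fin p) (Fin p) ℂ) (ξ : Fin 2 × Fin p → ℂ) : ℝ :=
  ∑ k, ∑ l, ‖formDeviation n G ξ k l‖ + ∑ k, ‖formDeviation n 1 ξ k k‖

lemma form_one (n : ℕ) (ξ : Fin 2 × Fin p → ℂ) (k : Fin 2) :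
    form n 1 ξ k k = (((n : ℝ)⁻¹ * sqNorm (column k ξ) : ℝ) : ℂ) := by
  rw [form, one_mulVec, star_dotProduct_self]
  push_cast
  rfl

lemma sum_norm_form_sub_le_formError (G : Matrix (Fin p) (Fin p) ℂ) (ξ : Fin 2 × Fin p → ℂ)
    {s : ℂ} {ε : ℝ} (hs : ‖(n : ℂ)⁻¹ * G.trace - s‖ ≤ ε / n) :
    ‖form n G ξ 0 0 - s‖ + ‖form n G ξ 0 1‖ + ‖form n G ξ 1 0‖ + ‖form n G ξ 1 1 - s‖
        + (|(n : ℝ)⁻¹ * sqNorm (column 0 ξ) - p / n| + |(n : ℝ)⁻¹ * sqNorm (column 1 ξ) - p / n|)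
      ≤ formError n G ξ + 2 * ε / n := by
  have hdiag (k : Fin 2) : ‖form n G ξ k k - s‖ ≤ ‖formDeviation n G ξ k k‖ + ε / n := by
    rw [formDeviation, if_pos rfl]
    exact (norm_sub_le_norm_sub_add_norm_sub _ _ _).trans (by gcongr)
  have hoff {k l : Fin 2} (hkl : k ≠ l) : form n G ξ k l = formDeviation n G ξ k l := by
    rw [formDeviation, if_neg hkl, mul_zero, sub_zero]
  have hlength (k : Fin 2) :
      |(n : ℝ)⁻¹ * sqNorm (column k ξ) - p / n| = ‖formDeviation n 1 ξ k k‖ := by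
    rw [formDeviation, if_pos rfl, form_one, trace_one, Fintype.card_fin, ← Real.norm_eq_abs,
      ← Complex.norm_real]
    congr 1
    push_cast
    ring
  rw [hlength, hlength, hoff zero_ne_one, hoff one_ne_zero, formError, mul_div_assoc]
  simp only [Fin.sum_univ_two]
  linarith [hdiag 0, hdiag 1]

lemma form_resolv_add_pairMatrix {H : Matrix (Fin p) (Fin p) ℂ} {z : ℂ} (hH : H.IsHermitian)
    (hz : 0 < z.im) (n : ℕ) (ξ : Fin 2 × Fin p → ℂ) (k l : Fin 2) :
    form n (resolv (H + (n : ℂ)⁻¹ • pairMatrix ξ) z) ξ k l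
      = form n (resolv H z) ξ k l
        + I * (form n (resolv H z) ξ k 0
            * form n (resolv (H + (n : ℂ)⁻¹ • pairMatrix ξ) z) ξ 1 l
          - form n (resolv H z) ξ k 1
            * form n (resolv (H + (n : ℂ)⁻¹ • pairMatrix ξ) z) ξ 0 l) := by
  have hH' := hH.add (isHermitian_inv_natCast_smul (isHermitian_pairMatrix ξ) n)
  set H' := H + (n : ℂ)⁻¹ • pairMatrix ξ
  have resolvent_identity : resolv H' z
      = resolv H z - (n : ℂ)⁻¹ • (resolv H z * (pairMatrix ξ * resolv H' z)) := by
    have h := resolv_sub_resolv hH hH' hz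
    rw [add_sub_cancel_left, Matrix.mul_smul, Matrix.smul_mul, Matrix.mul_assoc] at h
    rw [← h, sub_sub_cancel]
  have pairMatrix_mulVec (v : Fin p → ℂ) : pairMatrix ξ *ᵥ v
      = (-I) • ((star (column 1 ξ) ⬝ᵥ v) • column 0 ξ - (star (column 0 ξ) ⬝ᵥ v) • column 1 ξ) := by
    simp only [pairMatrix, smul_mulVec, sub_mulVec, vecMulVec_mulVec, op_smul_eq_smul]
  simp only [form]
  nth_rewrite 1 [resolvent_identity]
  rw [sub_mulVec, smul_mulVec, ← mulVec_mulVec, ← mulVec_mulVec, pairMatrix_mulVec, mulVec_smul,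
    mulVec_sub, mulVec_smul, mulVec_smul, dotProduct_sub, dotProduct_smul, dotProduct_smul,
    dotProduct_sub, dotProduct_smul, dotProduct_smul]
  simp only [smul_eq_mul]
  ring

lemma trace_pairMatrix_mul (ξ : Fin 2 × Fin p → ℂ) (G : Matrix (Fin p) (Fin p) ℂ) (n : ℕ) :
    (n : ℂ)⁻¹ * (pairMatrix ξ * G).trace = -I * (form n G ξ 1 0 - form n G ξ 0 1) := by
  have trace_vecMulVec_mul (u w : Fin p → ℂ) :
      (vecMulVec u (star w) * G).trace = star w ⬝ᵥ (G *ᵥ u) := by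
    rw [trace_mul_comm, mul_vecMulVec, trace_vecMulVec, dotProduct_comm]
  rw [pairMatrix, Matrix.smul_mul, Matrix.sub_mul, trace_smul, trace_sub, trace_vecMulVec_mul,
    trace_vecMulVec_mul, form, form, smul_eq_mul]
  ring

lemma norm_form_resolv_le {H : Matrix (Fin p) (Fin p) ℂ} {z : ℂ} (hH : H.IsHermitian)
    (hz : 1 ≤ z.im) (n : ℕ) (ξ : Fin 2 × Fin p → ℂ) (k l : Fin 2) :
    ‖form n (resolv H z) ξ k l‖
      ≤ (n : ℝ)⁻¹ * sqNorm (column 0 ξ) + (n : ℝ)⁻¹ * sqNorm (column 1 ξ) := by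
  have hcol (k : Fin 2) : sqNorm (column k ξ) ≤ sqNorm (column 0 ξ) + sqNorm (column 1 ξ) := by
    fin_cases k
    · exact le_add_of_nonneg_right (sqNorm_nonneg _)
    · exact le_add_of_nonneg_left (sqNorm_nonneg _)
  have hkl : 0 ≤ sqNorm (column k ξ) + sqNorm (column l ξ) :=
    add_nonneg (sqNorm_nonneg _) (sqNorm_nonneg _)
  rw [form, norm_mul, norm_inv, Complex.norm_natCast, ← mul_add]
  gcongr
  calc _ ≤ (sqNorm (column k ξ) + sqNorm (column l ξ)) / (2 * z.im) :=
        norm_resolv_form_le hH (by linarith) _ _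
    _ ≤ (sqNorm (column k ξ) + sqNorm (column l ξ)) / 2 := by gcongr; linarith
    _ ≤ _ := by linarith [hcol k, hcol l]

lemma three_quarters_le_norm_one_sub_sq {s : ℂ} (hs : ‖s‖ ≤ 1 / 2) : 3 / 4 ≤ ‖1 - s ^ 2‖ := by
  have hs2 : ‖s ^ 2‖ ≤ 1 / 4 := by
    rw [norm_pow]
    nlinarith [norm_nonneg s]
  linarith [norm_sub_norm_le (1 : ℂ) (s ^ 2), norm_one (α := ℂ)]

lemma one_sub_sq_ne_zero {s : ℂ} (hs : ‖s‖ ≤ 1 / 2) : 1 - s ^ 2 ≠ 0 :=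
  norm_pos_iff.1 (by linarith [three_quarters_le_norm_one_sub_sq hs])

lemma norm_eq_one_of_sq_eq_neg_one {σ : ℂ} (hσ : σ ^ 2 = -1) : ‖σ‖ = 1 :=
  Complex.norm_eq_one_of_pow_eq_one (n := 4) (by linear_combination (σ ^ 2 - 1) * hσ) (by norm_num)

lemma norm_add_mul_sub_le {σ e b γ α : ℂ} {B : ℝ} (hσ : ‖σ‖ = 1) (hγ : ‖γ‖ ≤ B) (hα : ‖α‖ ≤ B) :
    ‖e + σ * (e * γ - b * α)‖ ≤ (1 + B) * (‖e‖ + ‖b‖) := by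
  calc ‖e + σ * (e * γ - b * α)‖ ≤ ‖e‖ + ‖σ * (e * γ - b * α)‖ := norm_add_le _ _
    _ = ‖e‖ + ‖e * γ - b * α‖ := by rw [norm_mul, hσ, one_mul]
    _ ≤ ‖e‖ + (‖e‖ * ‖γ‖ + ‖b‖ * ‖α‖) := by
        rw [← norm_mul, ← norm_mul]
        gcongr
        exact norm_sub_le _ _
    _ ≤ ‖e‖ + (‖e‖ * B + ‖b‖ * B) := by gcongr
    _ ≤ (1 + B) * (‖e‖ + ‖b‖) := by linarith [norm_nonneg b]

/-- For `a = d = s` and `b = g = 0` the system is solved by `γ = -σ s² / (1 - s²)`. -/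
lemma norm_sub_le_of_system {σ s a b g d α γ : ℂ} {B : ℝ} (hσ : σ ^ 2 = -1) (hs : ‖s‖ ≤ 1 / 2)
    (hα : α = a + σ * (a * γ - b * α)) (hγ : γ = g + σ * (g * γ - d * α)) (hαB : ‖α‖ ≤ B)
    (hγB : ‖γ‖ ≤ B) :
    ‖γ - -σ * s ^ 2 / (1 - s ^ 2)‖
      ≤ 4 / 3 * ((1 + B) * (‖a - s‖ + ‖b‖ + ‖g‖ + ‖d - s‖)) := by
  have hσ1 := norm_eq_one_of_sq_eq_neg_one hσ
  have hne := one_sub_sq_ne_zero hs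
  set e₁ := (a - s) + σ * ((a - s) * γ - b * α)
  set e₂ := g + σ * (g * γ - (d - s) * α)
  have he₁ : ‖e₁‖ ≤ (1 + B) * (‖a - s‖ + ‖b‖) := norm_add_mul_sub_le hσ1 hγB hαB
  have he₂ : ‖e₂‖ ≤ (1 + B) * (‖g‖ + ‖d - s‖) := norm_add_mul_sub_le hσ1 hγB hαB
  have elimination : (γ - -σ * s ^ 2 / (1 - s ^ 2)) * (1 - s ^ 2) = e₂ - σ * s * e₁ := by
    rw [sub_mul, div_mul_cancel₀ _ hne]
    linear_combination hγ - σ * s * hα - s ^ 2 * γ * hσ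
  have hprod : ‖γ - -σ * s ^ 2 / (1 - s ^ 2)‖ * ‖1 - s ^ 2‖
      ≤ (1 + B) * (‖a - s‖ + ‖b‖ + ‖g‖ + ‖d - s‖) := by
    rw [← norm_mul, elimination]
    calc ‖e₂ - σ * s * e₁‖ ≤ ‖e₂‖ + ‖σ * s * e₁‖ := norm_sub_le _ _
      _ = ‖e₂‖ + ‖s‖ * ‖e₁‖ := by rw [norm_mul, norm_mul, hσ1, one_mul]
      _ ≤ ‖e₂‖ + 1 * ‖e₁‖ := by gcongr; linarith
      _ ≤ _ := by linarith
  nlinarith [norm_nonneg (γ - -σ * s ^ 2 / (1 - s ^ 2)), three_quarters_le_norm_one_sub_sq hs]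

lemma system_stability {σ s a b g d α γ : ℂ} {X Y κ : ℝ} (hσ : σ ^ 2 = -1) (hs : ‖s‖ ≤ 1 / 2)
    (hα : α = a + σ * (a * γ - b * α)) (hγ : γ = g + σ * (g * γ - d * α)) (hκ : 0 ≤ κ)
    (hαXY : ‖α‖ ≤ X + Y) (hγXY : ‖γ‖ ≤ X + Y) :
    ‖γ - -σ * s ^ 2 / (1 - s ^ 2)‖
      ≤ (4 * κ + 6) * (‖a - s‖ + ‖b‖ + ‖g‖ + ‖d - s‖ + (|X - κ| + |Y - κ|)) := by
  set ε := ‖a - s‖ + ‖b‖ + ‖g‖ + ‖d - s‖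
  set δ := |X - κ| + |Y - κ|
  have hε : 0 ≤ ε := by positivity
  have hXY : X + Y ≤ 2 * κ + δ := by linarith [le_abs_self (X - κ), le_abs_self (Y - κ)]
  rcases le_total δ 2 with hδ | hδ
  · calc _ ≤ 4 / 3 * ((1 + (2 * κ + 2)) * ε) :=
          norm_sub_le_of_system hσ hs hα hγ (by linarith) (by linarith)
      _ ≤ (4 * κ + 6) * (ε + δ) := by
          have : 0 ≤ δ := by positivity
          nlinarith
  · have hlim : ‖-σ * s ^ 2 / (1 - s ^ 2)‖ ≤ 1 := by
      have h34 := three_quarters_le_norm_one_sub_sq hs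
      rw [norm_div, norm_mul, norm_neg, norm_eq_one_of_sq_eq_neg_one hσ, one_mul, norm_pow,
        div_le_one (by linarith)]
      nlinarith [norm_nonneg s]
    calc _ ≤ ‖γ‖ + ‖-σ * s ^ 2 / (1 - s ^ 2)‖ := norm_sub_le _ _
      _ ≤ 2 * κ + δ + 1 := by linarith
      _ ≤ (4 * κ + 6) * (ε + δ) := by nlinarith

/-- The Stieltjes transform of the spectral distribution of `columnMatrix x`. -/
def colStieltjes (z : ℂ) (x : Fin n → Fin 2 × Fin p → ℂ) : ℂ :=
  (p : ℂ)⁻¹ * (resolv (columnMatrix x) z).trace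

/-- The residual of `m` in the self-consistent equation with aspect ratio `κ` at `z`. -/
def residual (κ : ℝ) (z m : ℂ) : ℂ := 1 + z * m + 2 * κ * m ^ 2 / (1 - (κ * m) ^ 2)

lemma norm_colStieltjes_le {z : ℂ} (hz : 0 < z.im) (hp : 0 < p)
    (x : Fin n → Fin 2 × Fin p → ℂ) : ‖colStieltjes z x‖ ≤ 1 / z.im := by
  have h := norm_trace_resolv_le (isHermitian_columnMatrix x) hz
  rw [Fintype.card_fin] at h
  rw [colStieltjes, norm_mul, norm_inv, Complex.norm_natCast, inv_mul_le_iff₀ (by positivity)]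
  exact h.trans_eq (by ring)

lemma norm_ratio_mul_colStieltjes_le {z : ℂ} (hp : 0 < p) (hn : 0 < n)
    (hz : 2 * ((p : ℝ) / n) ≤ z.im) (x : Fin n → Fin 2 × Fin p → ℂ) :
    ‖((p / n : ℝ) : ℂ) * colStieltjes z x‖ ≤ 1 / 2 := by
  have hκ : 0 < (p : ℝ) / n := by positivity
  have hz0 : 0 < z.im := by linarith
  rw [norm_mul, Complex.norm_real, Real.norm_of_nonneg hκ.le]
  calc (p : ℝ) / n * ‖colStieltjes z x‖ ≤ p / n * (1 / z.im) := by
        gcongr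
        exact norm_colStieltjes_le hz0 hp x
    _ ≤ 1 / 2 := by
        rw [mul_one_div, div_le_div_iff₀ hz0 two_pos]
        linarith

lemma ratio_mul_colStieltjes (hp : 0 < p) (z : ℂ) (x : Fin n → Fin 2 × Fin p → ℂ) :
    ((p / n : ℝ) : ℂ) * colStieltjes z x = (n : ℂ)⁻¹ * (resolv (columnMatrix x) z).trace := by
  have hpc : (p : ℂ) ≠ 0 := by exact_mod_cast hp.ne'
  rw [colStieltjes]
  push_cast
  field_simp

lemma natCast_add_mul_trace_resolv {z : ℂ} (hz : 0 < z.im) (x : Fin n → Fin 2 × Fin p → ℂ) :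
    (p : ℂ) + z * (resolv (columnMatrix x) z).trace
      = ∑ j, -I * (form n (resolv (columnMatrix x) z) (x j) 1 0
          - form n (resolv (columnMatrix x) z) (x j) 0 1) := by
  have h := sub_mul_resolv (isHermitian_columnMatrix x) hz
  rw [Matrix.sub_mul, Matrix.smul_mul, Matrix.one_mul, sub_eq_iff_eq_add] at h
  calc _ = (columnMatrix x * resolv (columnMatrix x) z).trace := by
        rw [h, trace_add, trace_one, trace_smul, Fintype.card_fin, smul_eq_mul]
    _ = ∑ j, (n : ℂ)⁻¹ * (pairMatrix (x j) * resolv (columnMatrix x) z).trace := by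
        nth_rewrite 1 [columnMatrix]
        rw [Matrix.smul_mul, Finset.sum_mul, trace_smul, trace_sum, smul_eq_mul, Finset.mul_sum]
    _ = _ := Finset.sum_congr rfl fun j _ => trace_pairMatrix_mul _ _ _

lemma residual_colStieltjes {z s : ℂ} (hp : 0 < p) (hn : 0 < n) (hz : 0 < z.im)
    (x : Fin n → Fin 2 × Fin p → ℂ) (hs : s = ((p / n : ℝ) : ℂ) * colStieltjes z x) :
    residual ((p : ℝ) / n) z (colStieltjes z x) = (p : ℂ)⁻¹ * ∑ j, -I *
      ((form n (resolv (columnMatrix x) z) (x j) 1 0 - -I * s ^ 2 / (1 - s ^ 2))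
        - (form n (resolv (columnMatrix x) z) (x j) 0 1 - -(-I) * s ^ 2 / (1 - s ^ 2))) := by
  have hpc : (p : ℂ) ≠ 0 := by exact_mod_cast hp.ne'
  have hnc : (n : ℂ) ≠ 0 := by exact_mod_cast hn.ne'
  have hsum (β γ : ℂ) : -I * ((γ - -I * s ^ 2 / (1 - s ^ 2)) - (β - -(-I) * s ^ 2 / (1 - s ^ 2)))
      = -I * (γ - β) + 2 * (s ^ 2 / (1 - s ^ 2)) := by
    linear_combination -2 * (s ^ 2 / (1 - s ^ 2)) * Complex.I_sq
  have htrace : (resolv (columnMatrix x) z).trace = p * colStieltjes z x :=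
    (mul_inv_cancel_left₀ hpc _).symm
  simp_rw [hsum]
  rw [Finset.sum_add_distrib, ← natCast_add_mul_trace_resolv hz, Finset.sum_const,
    Finset.card_univ, Fintype.card_fin, nsmul_eq_mul, htrace, residual, ← hs]
  have hsq : 2 * ((p / n : ℝ) : ℂ) * colStieltjes z x ^ 2 = (p : ℂ)⁻¹ * (n * (2 * s ^ 2)) := by
    rw [hs]
    push_cast
    field_simp
  rw [hsq]
  field_simp

lemma norm_form_sub_le {H : Matrix (Fin p) (Fin p) ℂ} {z s : ℂ} (hH : H.IsHermitian)
    (hz : 1 ≤ z.im) (ξ : Fin 2 × Fin p → ℂ) (hs : ‖s‖ ≤ 1 / 2)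
    (hstr : s = (n : ℂ)⁻¹ * (resolv (H + (n : ℂ)⁻¹ • pairMatrix ξ) z).trace) :
    ‖form n (resolv (H + (n : ℂ)⁻¹ • pairMatrix ξ) z) ξ 1 0 - -I * s ^ 2 / (1 - s ^ 2)‖
        ≤ (4 * ((p : ℝ) / n) + 6) * (formError n (resolv H z) ξ + 4 / n)
      ∧ ‖form n (resolv (H + (n : ℂ)⁻¹ • pairMatrix ξ) z) ξ 0 1 - -(-I) * s ^ 2 / (1 - s ^ 2)‖
        ≤ (4 * ((p : ℝ) / n) + 6) * (formError n (resolv H z) ξ + 4 / n) := by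
  have hz0 : 0 < z.im := by linarith
  have hH' := hH.add (isHermitian_inv_natCast_smul (isHermitian_pairMatrix ξ) n)
  have heq := form_resolv_add_pairMatrix hH hz0 n ξ
  have hbound := norm_form_resolv_le hH' hz n ξ
  have htrace : ‖(n : ℂ)⁻¹ * (resolv H z).trace - s‖ ≤ 2 / n := by
    rw [hstr, ← mul_sub, norm_mul, norm_inv, Complex.norm_natCast, norm_sub_rev]
    calc (n : ℝ)⁻¹ * _ ≤ (n : ℝ)⁻¹ * (2 / z.im) := by
          gcongr
          exact norm_trace_resolv_add_pairMatrix_sub_le hH hz0 n ξ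
      _ ≤ (n : ℝ)⁻¹ * (2 / 1) := by gcongr
      _ = 2 / n := by ring
  have herror := sum_norm_form_sub_le_formError (resolv H z) ξ htrace
  constructor
  · exact (system_stability Complex.I_sq hs (heq 0 0) (heq 1 0) (by positivity) (hbound 0 0)
      (hbound 1 0)).trans (mul_le_mul_of_nonneg_left (by linarith) (by positivity))
  · refine (system_stability (a := form n (resolv H z) ξ 1 1) (b := form n (resolv H z) ξ 1 0)
      (g := form n (resolv H z) ξ 0 1) (d := form n (resolv H z) ξ 0 0)
      (by rw [neg_sq, Complex.I_sq]) hs ?_ ?_ (by positivity) (hbound 1 1) (hbound 0 1)).trans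
      (mul_le_mul_of_nonneg_left (by linarith) (by positivity))
    · linear_combination heq 1 1
    · linear_combination heq 0 1

lemma norm_residual_le {z : ℂ} (hp : 0 < p) (hn : 0 < n) (hz1 : 1 ≤ z.im)
    (hz : 2 * ((p : ℝ) / n) ≤ z.im) (x : Fin n → Fin 2 × Fin p → ℂ) :
    ‖residual ((p : ℝ) / n) z (colStieltjes z x)‖
      ≤ (p : ℝ)⁻¹ * ∑ j, 2 * (4 * ((p : ℝ) / n) + 6) *
        (formError n (resolv (columnMatrix (Function.update x j 0)) z) (x j) + 4 / n) := by
  rw [residual_colStieltjes hp hn (by linarith) x rfl, norm_mul, norm_inv, Complex.norm_natCast]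
  gcongr
  refine (norm_sum_le _ _).trans (Finset.sum_le_sum fun j _ => ?_)
  have hs := norm_ratio_mul_colStieltjes_le hp hn hz x
  have hstr := ratio_mul_colStieltjes hp z x
  rw [columnMatrix_eq_add x j] at hstr ⊢
  obtain ⟨hγ, hβ⟩ := norm_form_sub_le (isHermitian_columnMatrix _) hz1 (x j) hs hstr
  rw [norm_mul, norm_neg, Complex.norm_I, one_mul]
  exact (norm_sub_le _ _).trans ((add_le_add hγ hβ).trans_eq (by ring))

end Columns

/-! ### Moment bounds under product measures -/

section SecondMoment

variable {Ω κ : Type*} [MeasurableSpace Ω] {μ : Measure Ω}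

lemma integrable_mul_conj {f g : Ω → ℂ} (hf : MemLp f 2 μ) (hg : MemLp g 2 μ) :
    Integrable (fun ω => f ω * conj (g ω)) μ :=
  hf.integrable_mul hg.star

lemma norm_integral_mul_conj_le {f g : Ω → ℂ} (hf : MemLp f 2 μ) (hg : MemLp g 2 μ) :
    ‖∫ ω, f ω * conj (g ω) ∂μ‖ ≤ (∫ ω, ‖f ω‖ ^ 2 ∂μ + ∫ ω, ‖g ω‖ ^ 2 ∂μ) / 2 := by
  have hf2 : Integrable (fun ω => ‖f ω‖ ^ 2) μ := hf.integrable_norm_pow two_ne_zero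
  have hg2 : Integrable (fun ω => ‖g ω‖ ^ 2) μ := hg.integrable_norm_pow two_ne_zero
  rw [← integral_add hf2 hg2, ← integral_div]
  refine norm_integral_le_of_norm_le ((hf2.add hg2).div_const 2) (ae_of_all _ fun ω => ?_)
  rw [norm_mul, RCLike.norm_conj]
  linarith [two_mul_le_add_sq ‖f ω‖ ‖g ω‖]

lemma ofReal_integral_norm_sum_sq [Fintype κ] {T : κ → Ω → ℂ} (hT : ∀ a, MemLp (T a) 2 μ) :
    ((∫ ω, ‖∑ a, T a ω‖ ^ 2 ∂μ : ℝ) : ℂ) = ∑ a, ∑ b, ∫ ω, T a ω * conj (T b ω) ∂μ := by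
  have hsq (ω : Ω) : ((‖∑ a, T a ω‖ ^ 2 : ℝ) : ℂ) = ∑ a, ∑ b, T a ω * conj (T b ω) := by
    rw [← Finset.sum_mul_sum, ← map_sum, Complex.mul_conj, Complex.normSq_eq_norm_sq]
  have hint a b := integrable_mul_conj (hT a) (hT b)
  rw [← integral_complex_ofReal]
  simp_rw [hsq]
  rw [integral_finsetSum _ fun a _ => integrable_finsetSum _ fun b _ => hint a b]
  exact Finset.sum_congr rfl fun a _ => integral_finsetSum _ fun b _ => hint a b

lemma integral_norm_sum_sq_le [Fintype κ] {T : κ → Ω → ℂ} (hT : ∀ a, MemLp (T a) 2 μ)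
    (σ : Equiv.Perm κ)
    (horth : ∀ a b, b ≠ a → b ≠ σ a → ∫ ω, T a ω * conj (T b ω) ∂μ = 0) :
    ∫ ω, ‖∑ a, T a ω‖ ^ 2 ∂μ ≤ 2 * ∑ a, ∫ ω, ‖T a ω‖ ^ 2 ∂μ := by
  classical
  set t : κ → ℝ := fun a => ∫ ω, ‖T a ω‖ ^ 2 ∂μ
  have ht (a : κ) : 0 ≤ t a := integral_nonneg fun ω => by positivity
  have hrow (a : κ) :
      ‖∑ b, ∫ ω, T a ω * conj (T b ω) ∂μ‖ ≤ (t a + t a) / 2 + (t a + t (σ a)) / 2 := by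
    have hsupp : ∑ b, ∫ ω, T a ω * conj (T b ω) ∂μ
        = ∑ b ∈ {a, σ a}, ∫ ω, T a ω * conj (T b ω) ∂μ := by
      refine (Finset.sum_subset (Finset.subset_univ _) fun b _ hb => ?_).symm
      rw [Finset.mem_insert, Finset.mem_singleton, not_or] at hb
      exact horth a b hb.1 hb.2
    have hpair (b : κ) := norm_integral_mul_conj_le (hT a) (hT b)
    rw [hsupp]
    refine (norm_sum_le _ _).trans ((Finset.sum_le_sum fun b _ => hpair b).trans ?_)
    by_cases ha : a = σ a
    · rw [← ha, Finset.pair_eq_singleton, Finset.sum_singleton]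
      linarith [ht a]
    · rw [Finset.sum_pair ha]
  calc ∫ ω, ‖∑ a, T a ω‖ ^ 2 ∂μ = ‖((∫ ω, ‖∑ a, T a ω‖ ^ 2 ∂μ : ℝ) : ℂ)‖ := by
        rw [Complex.norm_real, Real.norm_of_nonneg (integral_nonneg fun ω => by positivity)]
    _ = ‖∑ a, ∑ b, ∫ ω, T a ω * conj (T b ω) ∂μ‖ := by rw [ofReal_integral_norm_sum_sq hT]
    _ ≤ ∑ a, ((t a + t a) / 2 + (t a + t (σ a)) / 2) :=
        (norm_sum_le _ _).trans (Finset.sum_le_sum fun a _ => hrow a)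
    _ = 2 * ∑ a, t a := by
        rw [Finset.sum_add_distrib, ← Finset.sum_div, ← Finset.sum_div, Finset.sum_add_distrib,
          Finset.sum_add_distrib, Equiv.sum_comp σ t]
        ring

lemma integral_norm_le_sqrt [IsProbabilityMeasure μ] {f : Ω → ℂ} (hf : MemLp f 2 μ) {A : ℝ}
    (hA : ∫ ω, ‖f ω‖ ^ 2 ∂μ ≤ A) : ∫ ω, ‖f ω‖ ∂μ ≤ √A := by
  have hvar := variance_nonneg (fun ω => ‖f ω‖) μ
  rw [variance_eq_sub hf.norm] at hvar
  exact Real.le_sqrt_of_sq_le ((sub_nonneg.1 hvar).trans hA)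

end SecondMoment

section ProductMeasure

variable {ι E : Type*}

lemma preimage_update_pair_univ_pi [DecidableEq ι] (j : ι) (s : ι → Set E) :
    (fun q : E × (ι → E) => Function.update q.2 j q.1) ⁻¹' Set.univ.pi s
      = s j ×ˢ Set.univ.pi (Function.update s j Set.univ) := by
  ext q
  simp only [Set.mem_preimage, Set.mem_univ_pi, Set.mem_prod]
  rw [Function.forall_update_iff q.2 fun i e => e ∈ s i,
    Function.forall_update_iff s fun i t => q.2 i ∈ t]
  simp

variable [MeasurableSpace E]

lemma measurable_update_pair [DecidableEq ι] (j : ι) :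
    Measurable fun q : E × (ι → E) => Function.update q.2 j q.1 := by
  refine measurable_pi_iff.2 fun i => ?_
  obtain rfl | hij := eq_or_ne i j
  · simpa only [Function.update_self] using measurable_fst
  · simp only [Function.update_of_ne hij]
    fun_prop

variable [Fintype ι] (ν : ι → Measure E) [∀ i, IsProbabilityMeasure (ν i)]

theorem measurePreserving_update [DecidableEq ι] (j : ι) :
    MeasurePreserving (fun q : E × (ι → E) => Function.update q.2 j q.1)
      ((ν j).prod (Measure.pi ν)) (Measure.pi ν) := by
  refine ⟨measurable_update_pair j, (Measure.pi_eq fun s hs => ?_).symm⟩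
  rw [Measure.map_apply (measurable_update_pair j) (MeasurableSet.univ_pi hs),
    preimage_update_pair_univ_pi, Measure.prod_prod, Measure.pi_pi,
    ← Finset.mul_prod_erase _ _ (Finset.mem_univ j), Function.update_self, measure_univ, one_mul,
    ← Finset.mul_prod_erase Finset.univ (fun i => ν i (s i)) (Finset.mem_univ j)]
  congr 1
  refine Finset.prod_congr rfl fun i hi => ?_
  rw [Function.update_of_ne (Finset.ne_of_mem_erase hi)]

lemma integral_pi_mul [DecidableEq ι] {𝕜 : Type*} [RCLike 𝕜] (j : ι) {φ : E → 𝕜} {h : (ι → E) → 𝕜}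
    (hφ : Measurable φ) (hh : Measurable h) (hind : ∀ ξ e, h (Function.update ξ j e) = h ξ) :
    ∫ ξ, φ (ξ j) * h ξ ∂(Measure.pi ν) = (∫ e, φ e ∂(ν j)) * ∫ ξ, h ξ ∂(Measure.pi ν) := by
  have hmp := measurePreserving_update ν j
  rw [← integral_prod_mul, ← hmp.map_eq, integral_map hmp.measurable.aemeasurable]
  · rw [hmp.map_eq]
    simp only [Function.update_self, hind]
  · exact ((hφ.comp (measurable_pi_apply j)).mul hh).aestronglyMeasurable

lemma integral_norm_sum_centered_le {φ : ι → E → ℂ} (hφ : ∀ i, Measurable (φ i))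
    (hcenter : ∀ i, ∫ e, φ i e ∂(ν i) = 0) {B : ℝ} (hB : ∀ i e, ‖φ i e‖ ≤ B) :
    ∫ ξ, ‖∑ i, φ i (ξ i)‖ ∂(Measure.pi ν) ≤ √(2 * (Fintype.card ι * B ^ 2)) := by
  classical
  have hmeas (i : ι) : Measurable fun ξ : ι → E => φ i (ξ i) := (hφ i).comp (measurable_pi_apply i)
  have hL2 (i : ι) : MemLp (fun ξ : ι → E => φ i (ξ i)) 2 (Measure.pi ν) :=
    .of_bound (hmeas i).aestronglyMeasurable B (ae_of_all _ fun ξ => hB i (ξ i))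
  have hsq (i : ι) : ∫ ξ : ι → E, ‖φ i (ξ i)‖ ^ 2 ∂(Measure.pi ν) ≤ B ^ 2 := by
    calc ∫ ξ : ι → E, ‖φ i (ξ i)‖ ^ 2 ∂(Measure.pi ν) ≤ ∫ _ : ι → E, B ^ 2 ∂(Measure.pi ν) :=
          integral_mono ((hL2 i).integrable_norm_pow two_ne_zero) (integrable_const _)
            fun ξ => pow_le_pow_left₀ (norm_nonneg _) (hB i (ξ i)) 2
      _ = B ^ 2 := by simp
  refine integral_norm_le_sqrt (memLp_finsetSum _ fun i _ => hL2 i)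
    ((integral_norm_sum_sq_le hL2 (Equiv.refl ι) fun a b hba _ => ?_).trans ?_)
  · rw [integral_pi_mul ν a (hφ a) (h := fun ξ => conj (φ b (ξ b)))
      (Complex.continuous_conj.measurable.comp (hmeas b))
      fun ξ e => by rw [Function.update_of_ne hba], hcenter, zero_mul]
  · gcongr
    simpa using Finset.sum_le_sum fun i (_ : i ∈ Finset.univ) => hsq i

end ProductMeasure

section StandardFamily

variable {ι : Type*}

/-- The laws of centered complex random variables of unit variance. -/
structure IsStandardFamily (ν : ι → Measure ℂ) : Prop where
  prob : ∀ i, IsProbabilityMeasure (ν i)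
  mean_zero : ∀ i, ∫ e, e ∂(ν i) = 0
  variance_one : ∀ i, ∫ e, ‖e‖ ^ 2 ∂(ν i) = 1

variable {ν : ι → Measure ℂ}

lemma exists_coord_not_mem_of_ne {i j k l : ι} (hij : i ≠ j) (hne : (k, l) ≠ (i, j))
    (hswap : (k, l) ≠ (j, i)) : (i ≠ k ∧ i ≠ l) ∨ (j ≠ k ∧ j ≠ l) := by
  grind

lemma IsStandardFamily.integral_sq_mul_sq [Fintype ι] (hν : IsStandardFamily ν) {i j : ι}
    (hij : i ≠ j) :
    ∫ ξ : ι → ℂ, ‖ξ i‖ ^ 2 * ‖ξ j‖ ^ 2 ∂(Measure.pi ν) = 1 := by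
  classical
  have := hν.prob
  have hj : ∫ ξ : ι → ℂ, ‖ξ j‖ ^ 2 ∂(Measure.pi ν) = 1 := by
    rw [← hν.variance_one j]
    exact integral_comp_eval (μ := ν) (i := j) (f := fun e : ℂ => ‖e‖ ^ 2) (by fun_prop)
  rw [integral_pi_mul ν i (φ := fun e => ‖e‖ ^ 2) (h := fun ξ => ‖ξ j‖ ^ 2) (by fun_prop)
    (by fun_prop) fun ξ e => by rw [Function.update_of_ne hij.symm], hν.variance_one, hj, one_mul]

variable [DecidableEq ι]

/-- The term of the quadratic form `ξ ↦ ξᴴ Q ξ` at the index pair `a`, with the diagonal terms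
replaced by `0`. -/
def crossTerm (Q : Matrix ι ι ℂ) (a : ι × ι) (ξ : ι → ℂ) : ℂ :=
  if a.1 = a.2 then 0 else conj (ξ a.1) * Q a.1 a.2 * ξ a.2

lemma measurable_crossTerm (Q : Matrix ι ι ℂ) (a : ι × ι) : Measurable (crossTerm Q a) := by
  unfold crossTerm
  split_ifs
  · exact measurable_const
  · fun_prop

lemma crossTerm_of_ne (Q : Matrix ι ι ℂ) {i j : ι} (hij : i ≠ j) (ξ : ι → ℂ) :
    crossTerm Q (i, j) ξ = conj (ξ i) * Q i j * ξ j :=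
  if_neg hij

lemma norm_crossTerm_sq (Q : Matrix ι ι ℂ) (a : ι × ι) (ξ : ι → ℂ) :
    ‖crossTerm Q a ξ‖ ^ 2
      = if a.1 = a.2 then 0 else ‖Q a.1 a.2‖ ^ 2 * (‖ξ a.1‖ ^ 2 * ‖ξ a.2‖ ^ 2) := by
  unfold crossTerm
  split_ifs
  · simp
  · rw [norm_mul, norm_mul, RCLike.norm_conj]
    ring

lemma crossTerm_update (Q : Matrix ι ι ℂ) {a : ι × ι} {i : ι} (h₁ : i ≠ a.1) (h₂ : i ≠ a.2)
    (ξ : ι → ℂ) (e : ℂ) : crossTerm Q a (Function.update ξ i e) = crossTerm Q a ξ := by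
  simp only [crossTerm, Function.update_of_ne h₁.symm, Function.update_of_ne h₂.symm]

variable [Fintype ι]

lemma IsStandardFamily.memLp_crossTerm (hν : IsStandardFamily ν) (Q : Matrix ι ι ℂ) (a : ι × ι) :
    MemLp (crossTerm Q a) 2 (Measure.pi ν) := by
  rw [memLp_two_iff_integrable_sq_norm (measurable_crossTerm Q a).aestronglyMeasurable]
  simp_rw [norm_crossTerm_sq]
  split_ifs with ha
  · exact integrable_zero _ _ _
  · refine (Integrable.of_integral_ne_zero ?_).const_mul _
    rw [hν.integral_sq_mul_sq ha]
    exact one_ne_zero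

lemma IsStandardFamily.integral_norm_crossTerm_sq_le (hν : IsStandardFamily ν)
    (Q : Matrix ι ι ℂ) (a : ι × ι) :
    ∫ ξ, ‖crossTerm Q a ξ‖ ^ 2 ∂(Measure.pi ν) ≤ ‖Q a.1 a.2‖ ^ 2 := by
  simp_rw [norm_crossTerm_sq]
  split_ifs with ha
  · simp
  · rw [integral_const_mul, hν.integral_sq_mul_sq ha, mul_one]

lemma IsStandardFamily.integral_crossTerm_mul_conj (hν : IsStandardFamily ν) (Q : Matrix ι ι ℂ)
    {a b : ι × ι} (hne : b ≠ a) (hswap : b ≠ a.swap) :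
    ∫ ξ, crossTerm Q a ξ * conj (crossTerm Q b ξ) ∂(Measure.pi ν) = 0 := by
  have := hν.prob
  obtain ⟨i, j⟩ := a
  by_cases hij : i = j
  · simp [crossTerm, hij]
  have hmeas := Complex.continuous_conj.measurable.comp (measurable_crossTerm Q b)
  have hconj : ∫ e, conj e ∂(ν i) = 0 := by rw [integral_conj, hν.mean_zero, map_zero]
  simp only [crossTerm_of_ne Q hij]
  obtain ⟨h₁, h₂⟩ | ⟨h₁, h₂⟩ := exists_coord_not_mem_of_ne hij hne hswap
  · have hsplit := integral_pi_mul ν i (φ := fun e => conj e)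
      (h := fun ξ => Q i j * ξ j * conj (crossTerm Q b ξ)) (by fun_prop) (by fun_prop)
      fun ξ e => by rw [crossTerm_update Q h₁ h₂, Function.update_of_ne (Ne.symm hij)]
    rw [hconj, zero_mul] at hsplit
    rw [← hsplit]
    exact integral_congr_ae (ae_of_all _ fun ξ => by ring)
  · have hsplit := integral_pi_mul ν j (φ := fun e => e)
      (h := fun ξ => conj (ξ i) * Q i j * conj (crossTerm Q b ξ)) (by fun_prop) (by fun_prop)
      fun ξ e => by rw [crossTerm_update Q h₁ h₂, Function.update_of_ne hij]
    rw [hν.mean_zero, zero_mul] at hsplit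
    rw [← hsplit]
    exact integral_congr_ae (ae_of_all _ fun ξ => by ring)

/-- `crossTerm Q a` is orthogonal to every other cross term except the one at `a.swap`. -/
lemma IsStandardFamily.integral_norm_sum_crossTerm_le (hν : IsStandardFamily ν)
    (Q : Matrix ι ι ℂ) :
    ∫ ξ, ‖∑ a, crossTerm Q a ξ‖ ∂(Measure.pi ν) ≤ √(2 * ∑ i, ∑ j, ‖Q i j‖ ^ 2) := by
  have := hν.prob
  refine integral_norm_le_sqrt (memLp_finsetSum _ fun a _ => hν.memLp_crossTerm Q a)
    ((integral_norm_sum_sq_le (hν.memLp_crossTerm Q) (Equiv.prodComm ι ι)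
      fun a b => hν.integral_crossTerm_mul_conj Q).trans ?_)
  rw [← Fintype.sum_prod_type' fun i j => ‖Q i j‖ ^ 2]
  gcongr with a
  exact hν.integral_norm_crossTerm_sq_le Q a

end StandardFamily

/-! ### Concentration of quadratic forms -/

section Truncation

/-- The part of `‖e‖²` above the level `t`. -/
def sqExcess (t : ℝ) (e : ℂ) : ℝ := ‖e‖ ^ 2 - min (‖e‖ ^ 2) t

lemma sqExcess_nonneg (t : ℝ) (e : ℂ) : 0 ≤ sqExcess t e :=
  sub_nonneg.2 (min_le_left _ _)

lemma measurable_sqExcess (t : ℝ) : Measurable (sqExcess t) := by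
  unfold sqExcess
  fun_prop

lemma sqExcess_le {t η : ℝ} (ht : 0 < t) (hη : 0 < η) (e : ℂ) :
    sqExcess t e ≤ ‖e‖ ^ (2 + η) * t ^ (-(η / 2)) := by
  obtain hle | hlt := le_or_gt (‖e‖ ^ 2) t
  · rw [sqExcess, min_eq_left hle, sub_self]
    positivity
  · have he : 0 < ‖e‖ := by
      by_contra! h
      rw [le_antisymm h (norm_nonneg e)] at hlt
      linarith
    have hpow : t ^ (η / 2) ≤ ‖e‖ ^ η := by
      calc t ^ (η / 2) ≤ (‖e‖ ^ 2) ^ (η / 2) := by gcongr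
        _ = ‖e‖ ^ η := by
          rw [← Real.rpow_natCast, ← Real.rpow_mul he.le]
          congr 1
          push_cast
          ring
    have hratio : 1 ≤ ‖e‖ ^ η * t ^ (-(η / 2)) := by
      rwa [Real.rpow_neg ht.le, ← div_eq_mul_inv, one_le_div (by positivity)]
    calc sqExcess t e ≤ ‖e‖ ^ 2 * 1 := by
          rw [mul_one, sqExcess, sub_le_self_iff]
          positivity
      _ ≤ ‖e‖ ^ 2 * (‖e‖ ^ η * t ^ (-(η / 2))) := by gcongr
      _ = ‖e‖ ^ (2 + η) * t ^ (-(η / 2)) := by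
        rw [Real.rpow_add he, Real.rpow_two, mul_assoc]

variable {μ : Measure ℂ} {s : ℝ} {M : ℝ≥0}

lemma lintegral_ofReal_norm_rpow (hs : 0 ≤ s) :
    ∫⁻ e, ENNReal.ofReal (‖e‖ ^ s) ∂μ = ∫⁻ e, ‖e‖ₑ ^ s ∂μ := by
  refine lintegral_congr fun e => ?_
  rw [← ofReal_norm, ENNReal.ofReal_rpow_of_nonneg (norm_nonneg _) hs]

lemma integrable_norm_rpow (hs : 0 ≤ s) (hM : ∫⁻ e, ‖e‖ₑ ^ s ∂μ ≤ M) :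
    Integrable (fun e => ‖e‖ ^ s) μ := by
  refine ⟨by fun_prop, ?_⟩
  rw [hasFiniteIntegral_iff_ofReal (ae_of_all _ fun e => by positivity),
    lintegral_ofReal_norm_rpow hs]
  exact hM.trans_lt ENNReal.coe_lt_top

lemma integral_norm_rpow_le (hs : 0 ≤ s) (hM : ∫⁻ e, ‖e‖ₑ ^ s ∂μ ≤ M) :
    ∫ e, ‖e‖ ^ s ∂μ ≤ M := by
  rw [integral_eq_lintegral_of_nonneg_ae (ae_of_all _ fun e => by positivity) (by fun_prop),
    lintegral_ofReal_norm_rpow hs]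
  exact ENNReal.toReal_le_coe_of_le_coe hM

variable {η t : ℝ}

lemma integrable_sqExcess (hη : 0 < η) (hM : ∫⁻ e, ‖e‖ₑ ^ (2 + η) ∂μ ≤ M) (ht : 0 < t) :
    Integrable (sqExcess t) μ := by
  refine ((integrable_norm_rpow (by positivity) hM).mul_const (t ^ (-(η / 2)))).mono'
    (measurable_sqExcess t).aestronglyMeasurable (ae_of_all _ fun e => ?_)
  rw [Real.norm_of_nonneg (sqExcess_nonneg t e)]
  exact sqExcess_le ht hη e

lemma integral_sqExcess_le (hη : 0 < η) (hM : ∫⁻ e, ‖e‖ₑ ^ (2 + η) ∂μ ≤ M) (ht : 0 < t) :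
    ∫ e, sqExcess t e ∂μ ≤ M * t ^ (-(η / 2)) := by
  calc ∫ e, sqExcess t e ∂μ ≤ ∫ e, ‖e‖ ^ (2 + η) * t ^ (-(η / 2)) ∂μ :=
        integral_mono (integrable_sqExcess hη hM ht)
          ((integrable_norm_rpow (by positivity) hM).mul_const _) (sqExcess_le ht hη)
    _ ≤ M * t ^ (-(η / 2)) := by
        rw [integral_mul_const]
        gcongr
        exact integral_norm_rpow_le (by positivity) hM

end Truncation

section Centering

variable {E : Type*} [MeasurableSpace E]

/-- A real random variable minus its mean. -/
def centered (μ : Measure E) (f : E → ℝ) (e : E) : ℝ := f e - ∫ e', f e' ∂μ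

lemma integrable_centered {μ : Measure E} [IsFiniteMeasure μ] {f : E → ℝ} (hf : Integrable f μ) :
    Integrable (centered μ f) μ :=
  hf.sub (integrable_const _)

lemma integral_centered {μ : Measure E} [IsProbabilityMeasure μ] {f : E → ℝ}
    (hf : Integrable f μ) : ∫ e, centered μ f e ∂μ = 0 := by
  simp only [centered]
  rw [integral_sub hf (integrable_const _), integral_const, probReal_univ, one_smul, sub_self]

lemma abs_centered_le {μ : Measure E} [IsProbabilityMeasure μ] {f : E → ℝ} {t : ℝ}
    (hf : Integrable f μ) (hf₀ : ∀ e, 0 ≤ f e) (hft : ∀ e, f e ≤ t) (e : E) :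
    |centered μ f e| ≤ t := by
  have hmean : ∫ e', f e' ∂μ ≤ t := by
    simpa using integral_mono hf (integrable_const t) hft
  rw [centered, abs_le]
  have hmean₀ : 0 ≤ ∫ e', f e' ∂μ := integral_nonneg hf₀
  constructor <;> linarith [hf₀ e, hft e]

lemma integral_abs_centered_le {μ : Measure E} [IsProbabilityMeasure μ] {f : E → ℝ}
    (hf : Integrable f μ) (hf₀ : ∀ e, 0 ≤ f e) :
    ∫ e, |centered μ f e| ∂μ ≤ 2 * ∫ e, f e ∂μ := by
  have hmean : 0 ≤ ∫ e, f e ∂μ := integral_nonneg hf₀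
  calc ∫ e, |centered μ f e| ∂μ ≤ ∫ e, (f e + ∫ e', f e' ∂μ) ∂μ := by
        refine integral_mono (integrable_centered hf).abs (hf.add (integrable_const _)) fun e => ?_
        refine (abs_sub _ _).trans_eq ?_
        rw [abs_of_nonneg (hf₀ e), abs_of_nonneg hmean]
    _ = 2 * ∫ e, f e ∂μ := by
        rw [integral_add hf (integrable_const _), integral_const, probReal_univ, one_smul]
        ring

variable {ι : Type*} [Fintype ι] {ν : ι → Measure E} [∀ i, IsProbabilityMeasure (ν i)]
  {q : ι → ℂ} {f : E → ℝ}

lemma integrable_sum_mul_centered (q : ι → ℂ) (hf : ∀ i, Integrable f (ν i)) :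
    Integrable (fun ξ : ι → E => ∑ i, q i * (centered (ν i) f (ξ i) : ℂ)) (Measure.pi ν) :=
  integrable_finsetSum _ fun i _ =>
    (integrable_comp_eval (integrable_centered (hf i))).ofReal.const_mul (q i)

lemma integral_norm_sum_mul_centered_le_sqrt (hq : ∀ i, ‖q i‖ ≤ 1) (hf : Measurable f) {t : ℝ}
    (hf₀ : ∀ e, 0 ≤ f e) (hft : ∀ e, f e ≤ t) :
    ∫ ξ, ‖∑ i, q i * (centered (ν i) f (ξ i) : ℂ)‖ ∂(Measure.pi ν)
      ≤ √(2 * (Fintype.card ι * t ^ 2)) := by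
  have hint (i : ι) : Integrable f (ν i) :=
    .of_bound hf.aestronglyMeasurable t (ae_of_all _ fun e => by
      rw [Real.norm_of_nonneg (hf₀ e)]
      exact hft e)
  refine integral_norm_sum_centered_le ν (φ := fun i e => q i * (centered (ν i) f e : ℂ))
    (fun i => ?_) (fun i => ?_) fun i e => ?_
  · unfold centered
    fun_prop
  · rw [integral_const_mul, integral_complex_ofReal, integral_centered (hint i),
      Complex.ofReal_zero, mul_zero]
  · rw [norm_mul, Complex.norm_real, Real.norm_eq_abs]
    exact (mul_le_of_le_one_left (abs_nonneg _) (hq i)).trans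
      (abs_centered_le (hint i) hf₀ hft e)

lemma integral_norm_sum_mul_centered_le (hq : ∀ i, ‖q i‖ ≤ 1) (hf : ∀ i, Integrable f (ν i))
    (hf₀ : ∀ e, 0 ≤ f e) {A : ℝ} (hA : ∀ i, ∫ e, f e ∂(ν i) ≤ A) :
    ∫ ξ, ‖∑ i, q i * (centered (ν i) f (ξ i) : ℂ)‖ ∂(Measure.pi ν)
      ≤ Fintype.card ι * (2 * A) := by
  have hint (i : ι) : Integrable (fun e => |centered (ν i) f e|) (ν i) :=
    (integrable_centered (hf i)).abs
  have hint_eval (i : ι) :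
      Integrable (fun ξ : ι → E => |centered (ν i) f (ξ i)|) (Measure.pi ν) :=
    integrable_comp_eval (μ := ν) (i := i) (f := fun e => |centered (ν i) f e|) (hint i)
  calc ∫ ξ, ‖∑ i, q i * (centered (ν i) f (ξ i) : ℂ)‖ ∂(Measure.pi ν)
      ≤ ∫ ξ, ∑ i, |centered (ν i) f (ξ i)| ∂(Measure.pi ν) := by
        refine integral_mono (integrable_sum_mul_centered q hf).norm
          (integrable_finsetSum _ fun i _ => hint_eval i) fun ξ => ?_
        refine (norm_sum_le _ _).trans (Finset.sum_le_sum fun i _ => ?_)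
        rw [norm_mul, Complex.norm_real, Real.norm_eq_abs]
        exact mul_le_of_le_one_left (abs_nonneg _) (hq i)
    _ = ∑ i, ∫ e, |centered (ν i) f e| ∂(ν i) := by
        rw [integral_finsetSum _ fun i _ => hint_eval i]
        exact Finset.sum_congr rfl fun i _ =>
          integral_comp_eval (μ := ν) (f := fun e => |centered (ν i) f e|)
            (hint i).aestronglyMeasurable
    _ ≤ ∑ _ : ι, 2 * A := Finset.sum_le_sum fun i _ =>
        (integral_abs_centered_le (hf i) hf₀).trans (by linarith [hA i])
    _ = Fintype.card ι * (2 * A) := by simp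

end Centering

section QuadraticForm

open Matrix

variable {ι : Type*} [Fintype ι] {ν : ι → Measure ℂ}

lemma star_dotProduct_mulVec_eq [DecidableEq ι] (Q : Matrix ι ι ℂ) (ξ : ι → ℂ) :
    star ξ ⬝ᵥ (Q *ᵥ ξ) = ∑ a, crossTerm Q a ξ + ∑ i, Q i i * ((‖ξ i‖ ^ 2 : ℝ) : ℂ) := by
  have hdiag : ∑ i, Q i i * ((‖ξ i‖ ^ 2 : ℝ) : ℂ)
      = ∑ a : ι × ι, if a.1 = a.2 then conj (ξ a.1) * Q a.1 a.2 * ξ a.2 else 0 := by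
    rw [Fintype.sum_prod_type]
    refine Finset.sum_congr rfl fun i _ => ?_
    rw [Finset.sum_ite_eq, if_pos (Finset.mem_univ i), ← Complex.normSq_eq_norm_sq,
      ← Complex.mul_conj]
    ring
  calc star ξ ⬝ᵥ (Q *ᵥ ξ) = ∑ a : ι × ι, conj (ξ a.1) * Q a.1 a.2 * ξ a.2 := by
        rw [Fintype.sum_prod_type]
        simp only [dotProduct, mulVec, Finset.mul_sum, Pi.star_apply, RCLike.star_def, mul_assoc]
    _ = _ := by
        rw [hdiag, ← Finset.sum_add_distrib]
        refine Finset.sum_congr rfl fun a _ => ?_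
        unfold crossTerm
        split_ifs <;> simp

lemma IsStandardFamily.integrable_quadForm_sub_trace (hν : IsStandardFamily ν)
    (Q : Matrix ι ι ℂ) :
    Integrable (fun ξ : ι → ℂ => star ξ ⬝ᵥ (Q *ᵥ ξ) - Q.trace) (Measure.pi ν) := by
  classical
  have := hν.prob
  have hsq (i : ι) : Integrable (fun e : ℂ => ‖e‖ ^ 2) (ν i) :=
    .of_integral_ne_zero (by rw [hν.variance_one]; exact one_ne_zero)
  simp_rw [star_dotProduct_mulVec_eq]
  refine ((integrable_finsetSum _ fun a _ => (hν.memLp_crossTerm Q a).integrable one_le_two).add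
    (integrable_finsetSum _ fun i _ => ?_)).sub (integrable_const _)
  exact (integrable_comp_eval (μ := ν) (i := i) (f := fun e : ℂ => ‖e‖ ^ 2)
    (hsq i)).ofReal.const_mul _

lemma integrable_min_norm_sq {μ : Measure ℂ} [IsFiniteMeasure μ] {t : ℝ} (ht : 0 ≤ t) :
    Integrable (fun e => min (‖e‖ ^ 2) t) μ :=
  .of_bound (by fun_prop) t (ae_of_all _ fun e => by
    rw [Real.norm_of_nonneg (le_min (by positivity) ht)]
    exact min_le_right _ _)

lemma IsStandardFamily.quadForm_sub_trace [DecidableEq ι] (hν : IsStandardFamily ν)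
    (Q : Matrix ι ι ℂ) {t : ℝ} (ht : 0 ≤ t) (hint : ∀ i, Integrable (sqExcess t) (ν i))
    (ξ : ι → ℂ) :
    star ξ ⬝ᵥ (Q *ᵥ ξ) - Q.trace
      = ∑ a, crossTerm Q a ξ
        + ∑ i, Q i i * (centered (ν i) (fun e => min (‖e‖ ^ 2) t) (ξ i) : ℂ)
        + ∑ i, Q i i * (centered (ν i) (sqExcess t) (ξ i) : ℂ) := by
  have := hν.prob
  have hmean (i : ι) : ∫ e, min (‖e‖ ^ 2) t ∂(ν i) + ∫ e, sqExcess t e ∂(ν i) = 1 := by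
    rw [← integral_add (integrable_min_norm_sq ht) (hint i), ← hν.variance_one i]
    simp only [sqExcess, add_sub_cancel]
  have hsplit (i : ι) : ‖ξ i‖ ^ 2 - 1 = centered (ν i) (fun e => min (‖e‖ ^ 2) t) (ξ i)
      + centered (ν i) (sqExcess t) (ξ i) := by
    simp only [centered]
    rw [← hmean i, sqExcess]
    ring
  rw [star_dotProduct_mulVec_eq, add_sub_assoc, add_assoc, trace, ← Finset.sum_sub_distrib,
    ← Finset.sum_add_distrib]
  congr 1
  refine Finset.sum_congr rfl fun i _ => ?_
  rw [diag_apply, ← mul_add, ← Complex.ofReal_add, ← hsplit]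
  push_cast
  ring

/-- A bound for the mean deviation of a quadratic form in `N` standard variables from its trace.
The three terms come from the off-diagonal part, and from the diagonal part below and above the
truncation level `N^(1/4)`. -/
def quadBound (η M N : ℝ) : ℝ :=
  √(2 * N) + √(2 * (N * (N ^ (1 / 4 : ℝ)) ^ 2)) + N * (2 * (M * (N ^ (1 / 4 : ℝ)) ^ (-(η / 2))))

theorem IsStandardFamily.integral_norm_quadForm_sub_trace_le (hν : IsStandardFamily ν) {η : ℝ}
    (hη : 0 < η) {M : ℝ≥0} (hM : ∀ i, ∫⁻ e, ‖e‖ₑ ^ (2 + η) ∂(ν i) ≤ M) (Q : Matrix ι ι ℂ)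
    (hQ : ∑ i, ∑ j, ‖Q i j‖ ^ 2 ≤ Fintype.card ι) (hq : ∀ i, ‖Q i i‖ ≤ 1)
    (hι : 0 < Fintype.card ι) :
    ∫ ξ : ι → ℂ, ‖star ξ ⬝ᵥ (Q *ᵥ ξ) - Q.trace‖ ∂(Measure.pi ν)
      ≤ quadBound η M (Fintype.card ι) := by
  classical
  have := hν.prob
  set t : ℝ := (Fintype.card ι : ℝ) ^ (1 / 4 : ℝ)
  have ht : 0 < t := by positivity
  have hexc (i : ι) : Integrable (sqExcess t) (ν i) := integrable_sqExcess hη (hM i) ht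
  have hcross : Integrable (fun ξ => ∑ a, crossTerm Q a ξ) (Measure.pi ν) :=
    integrable_finsetSum _ fun a _ => (hν.memLp_crossTerm Q a).integrable one_le_two
  have hmin := integrable_sum_mul_centered (ν := ν) (fun i => Q i i)
    fun i => integrable_min_norm_sq ht.le
  have htail := integrable_sum_mul_centered (fun i => Q i i) hexc
  simp_rw [hν.quadForm_sub_trace Q ht.le hexc]
  refine (integral_mono ((hcross.add hmin).add htail).norm
    ((hcross.norm.add hmin.norm).add htail.norm) fun ξ => norm_add₃_le).trans ?_
  rw [integral_add' (hcross.norm.add hmin.norm) htail.norm, integral_add' hcross.norm hmin.norm]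
  refine add_le_add_three ((hν.integral_norm_sum_crossTerm_le Q).trans ?_) ?_ ?_
  · gcongr
  · exact integral_norm_sum_mul_centered_le_sqrt hq (by fun_prop)
      (fun e => le_min (by positivity) ht.le) fun e => min_le_right _ _
  · exact integral_norm_sum_mul_centered_le hq hexc (sqExcess_nonneg t)
      fun i => integral_sqExcess_le hη (hM i) ht

lemma quadBound_div {N : ℝ} (hN : 0 < N) (η M : ℝ) :
    quadBound η M N / N = √2 * N ^ (-(1 / 2 : ℝ)) + √2 * N ^ (-(1 / 4 : ℝ))
      + 2 * M * N ^ (-(η / 8)) := by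
  have hoff : √(2 * N) = √2 * N ^ (1 / 2 : ℝ) := by
    rw [Real.sqrt_mul zero_le_two, Real.sqrt_eq_rpow N]
  have hbelow : √(2 * (N * (N ^ (1 / 4 : ℝ)) ^ 2)) = √2 * N ^ (3 / 4 : ℝ) := by
    rw [Real.sqrt_mul zero_le_two, ← Real.rpow_mul_natCast hN.le, ← Real.rpow_one_add' hN.le
      (by norm_num), Real.sqrt_eq_rpow (N ^ _), ← Real.rpow_mul hN.le]
    norm_num
  have habove : (N ^ (1 / 4 : ℝ)) ^ (-(η / 2)) = N ^ (-(η / 8)) := by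
    rw [← Real.rpow_mul hN.le]
    ring_nf
  have hhalf : N ^ (-(1 / 2 : ℝ)) * N = N ^ (1 / 2 : ℝ) := by
    rw [← Real.rpow_add_one hN.ne']
    norm_num
  have hquarter : N ^ (-(1 / 4 : ℝ)) * N = N ^ (3 / 4 : ℝ) := by
    rw [← Real.rpow_add_one hN.ne']
    norm_num
  rw [quadBound, hoff, hbelow, habove, div_eq_iff hN.ne', ← hhalf, ← hquarter]
  ring

lemma tendsto_quadBound_div {η : ℝ} (hη : 0 < η) (M : ℝ) :
    Tendsto (fun N : ℝ => quadBound η M N / N) atTop (𝓝 0) := by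
  have hlim : Tendsto (fun N : ℝ => √2 * N ^ (-(1 / 2 : ℝ)) + √2 * N ^ (-(1 / 4 : ℝ))
      + 2 * M * N ^ (-(η / 8))) atTop (𝓝 (√2 * 0 + √2 * 0 + 2 * M * 0)) :=
    (((tendsto_rpow_neg_atTop (by norm_num)).const_mul _).add
      ((tendsto_rpow_neg_atTop (by norm_num)).const_mul _)).add
      ((tendsto_rpow_neg_atTop (by positivity)).const_mul _)
  simp only [mul_zero, add_zero] at hlim
  refine hlim.congr' ?_
  filter_upwards [eventually_gt_atTop (0 : ℝ)] with N hN using (quadBound_div hN η M).symm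

end QuadraticForm

/-! ### McDiarmid's inequality -/

section BoundedDifferences

lemma integrable_of_abs_le {Ω : Type*} [MeasurableSpace Ω] {μ : Measure Ω} [IsFiniteMeasure μ]
    {f : Ω → ℝ} (hf : Measurable f) {C : ℝ} (hC : ∀ ω, |f ω| ≤ C) : Integrable f μ :=
  .of_bound hf.aestronglyMeasurable C (ae_of_all _ hC)

lemma abs_integral_le {Ω : Type*} [MeasurableSpace Ω] (μ : Measure Ω) [IsProbabilityMeasure μ]
    {f : Ω → ℝ} {C : ℝ} (hC : ∀ ω, |f ω| ≤ C) : |∫ ω, f ω ∂μ| ≤ C := by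
  simpa using norm_integral_le_of_norm_le_const (μ := μ) (f := f) (ae_of_all _ hC)

lemma integrable_exp_mul_of_abs_le {Ω : Type*} [MeasurableSpace Ω] {μ : Measure Ω}
    [IsFiniteMeasure μ] {f : Ω → ℝ} (hf : Measurable f) {C : ℝ} (hC : ∀ ω, |f ω| ≤ C) (t : ℝ) :
    Integrable (fun ω => Real.exp (t * f ω)) μ := by
  refine integrable_of_abs_le (C := Real.exp (|t| * C)) (by fun_prop) fun ω => ?_
  rw [abs_of_pos (Real.exp_pos _), Real.exp_le_exp]
  calc t * f ω ≤ |t| * |f ω| := (le_abs_self _).trans_eq (abs_mul _ _)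
    _ ≤ |t| * C := by gcongr; exact hC ω

lemma abs_sub_integral_le {Ω : Type*} [MeasurableSpace Ω] (μ : Measure Ω) [IsProbabilityMeasure μ]
    {f : Ω → ℝ} {C : ℝ} (hC : ∀ ω, |f ω| ≤ C) (ω : Ω) : |f ω - ∫ ω', f ω' ∂μ| ≤ C + C :=
  (abs_sub _ _).trans (add_le_add (hC ω) (abs_integral_le μ hC))

lemma integral_exp_mul_sub_le {E : Type*} [MeasurableSpace E] (μ : Measure E)
    [IsProbabilityMeasure μ] {F : E → ℝ} (hF : Measurable F) {δ : ℝ}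
    (hosc : ∀ e e', |F e - F e'| ≤ δ) (t : ℝ) :
    ∫ e, Real.exp (t * (F e - ∫ e', F e' ∂μ)) ∂μ ≤ Real.exp (δ ^ 2 * t ^ 2 / 2) := by
  obtain ⟨e₀⟩ : Nonempty E := nonempty_of_isProbabilityMeasure μ
  have hoeffding := hasSubgaussianMGF_of_mem_Icc (μ := μ) (X := F) (a := F e₀ - δ) (b := F e₀ + δ)
    hF.aemeasurable (ae_of_all _ fun e => by
      have := abs_le.1 (hosc e e₀)
      constructor <;> linarith)
  refine (hoeffding.mgf_le t).trans_eq ?_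
  have hlength : F e₀ + δ - (F e₀ - δ) = 2 * δ := by ring
  congr 2
  rw [hlength]
  push_cast
  rw [Real.norm_eq_abs, abs_mul, abs_two, mul_div_cancel_left₀ _ two_ne_zero, sq_abs]

variable {E : Type*} [MeasurableSpace E]

/-- Conditioning on the first coordinate: the conditional mean `F` has oscillation at most `δ`
under `μ`, and around `F` the conditional exponential moment is at most `B`. -/
lemma integral_prod_exp_mul_sub_le {E' : Type*} [MeasurableSpace E'] (μ : Measure E)
    (ρ : Measure E') [IsProbabilityMeasure μ] [IsProbabilityMeasure ρ] {g : E × E' → ℝ}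
    (hg : Measurable g) {C δ B t : ℝ} (hC : ∀ q, |g q| ≤ C)
    (hδ : ∀ e e' y, |g (e, y) - g (e', y)| ≤ δ)
    (hB : ∀ e, ∫ y, Real.exp (t * (g (e, y) - ∫ y', g (e, y') ∂ρ)) ∂ρ ≤ B) :
    ∫ q, Real.exp (t * (g q - ∫ q', g q' ∂(μ.prod ρ))) ∂(μ.prod ρ)
      ≤ Real.exp (δ ^ 2 * t ^ 2 / 2) * B := by
  set F : E → ℝ := fun e => ∫ y, g (e, y) ∂ρ
  have hFmeas : Measurable F := hg.stronglyMeasurable.integral_prod_right'.measurable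
  have hint (e : E) : Integrable (fun y => g (e, y)) ρ :=
    integrable_of_abs_le (hg.comp measurable_prodMk_left) fun y => hC _
  have hFC (e : E) : |F e| ≤ C := abs_integral_le ρ fun y => hC _
  have hFosc (e e' : E) : |F e - F e'| ≤ δ := by
    rw [← integral_sub (hint e) (hint e')]
    exact abs_integral_le ρ (hδ e e')
  have hB₀ : 0 ≤ B := by
    obtain ⟨e⟩ : Nonempty E := nonempty_of_isProbabilityMeasure μ
    exact (integral_nonneg fun y => (Real.exp_pos _).le).trans (hB e)
  have hmean : ∫ q, g q ∂(μ.prod ρ) = ∫ e, F e ∂μ := integral_prod _ (integrable_of_abs_le hg hC)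
  rw [integral_prod _ (integrable_exp_mul_of_abs_le (hg.sub_const _)
    (abs_sub_integral_le (μ.prod ρ) hC) t), hmean]
  set m : ℝ := ∫ e, F e ∂μ
  have hcond (e : E) :
      ∫ y, Real.exp (t * (g (e, y) - m)) ∂ρ ≤ Real.exp (t * (F e - m)) * B := by
    calc ∫ y, Real.exp (t * (g (e, y) - m)) ∂ρ
        = ∫ y, Real.exp (t * (F e - m)) * Real.exp (t * (g (e, y) - F e)) ∂ρ := by
          congr! 2 with y
          rw [← Real.exp_add]
          ring_nf
      _ ≤ Real.exp (t * (F e - m)) * B := by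
          rw [integral_const_mul]
          exact mul_le_mul_of_nonneg_left (hB e) (Real.exp_pos _).le
  calc ∫ e, ∫ y, Real.exp (t * (g (e, y) - m)) ∂ρ ∂μ ≤ ∫ e, Real.exp (t * (F e - m)) * B ∂μ :=
        integral_mono_of_nonneg (ae_of_all _ fun e => integral_nonneg fun y => (Real.exp_pos _).le)
          ((integrable_exp_mul_of_abs_le (hFmeas.sub_const m) (abs_sub_integral_le μ hFC)
            t).mul_const B) (ae_of_all _ hcond)
    _ ≤ Real.exp (δ ^ 2 * t ^ 2 / 2) * B := by
        rw [integral_mul_const]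
        gcongr
        exact integral_exp_mul_sub_le μ hFmeas hFosc t

lemma integral_exp_mul_sub_integral_pi_le {n : ℕ} (ν : Fin n → Measure E)
    [∀ i, IsProbabilityMeasure (ν i)] {f : (Fin n → E) → ℝ} (hf : Measurable f) {C δ : ℝ}
    (hC : ∀ x, |f x| ≤ C) (hδ : ∀ x j e, |f (Function.update x j e) - f x| ≤ δ) (t : ℝ) :
    ∫ x, Real.exp (t * (f x - ∫ y, f y ∂(Measure.pi ν))) ∂(Measure.pi ν)
      ≤ Real.exp (n * δ ^ 2 * t ^ 2 / 2) := by
  induction n with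
  | zero =>
    have hconst (x : Fin 0 → E) : f x - ∫ y, f y ∂(Measure.pi ν) = 0 := by
      simp_rw [fun y => congrArg f (Subsingleton.elim y x)]
      simp
    simp_rw [hconst]
    simp
  | succ n ih =>
    have hmp := (measurePreserving_piFinSuccAbove ν 0).symm
    set split := MeasurableEquiv.piFinSuccAbove (fun _ : Fin (n + 1) => E) 0
    have hsymm (e : E) (y : Fin n → E) : split.symm (e, y) = Fin.insertNth 0 e y := rfl
    have hhead (e e' : E) (y : Fin n → E) :
        split.symm (e, y) = Function.update (split.symm (e', y)) 0 e := by
      simp only [hsymm, Fin.update_insertNth]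
    have htail (e : E) (y : Fin n → E) (j : Fin n) (e' : E) :
        split.symm (e, Function.update y j e')
          = Function.update (split.symm (e, y)) (Fin.succAbove 0 j) e' := by
      simp only [hsymm, Fin.insertNth_update]
    have hfm : Measurable fun q => f (split.symm q) := hf.comp hmp.measurable
    have hsec (e : E) := ih (fun j => ν (Fin.succAbove 0 j))
      (f := fun y => f (split.symm (e, y))) (hfm.comp measurable_prodMk_left) (fun y => hC _)
      fun y j e' => by rw [htail]; exact hδ _ _ _
    have hprod := integral_prod_exp_mul_sub_le (ν 0) _ hfm (fun q => hC _)
      (fun e e' y => by rw [hhead e e' y]; exact hδ _ _ _) hsec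
    rw [hmp.integral_comp' (g := f), hmp.integral_comp'
      (g := fun x => Real.exp (t * (f x - ∫ y, f y ∂(Measure.pi ν))))] at hprod
    refine hprod.trans_eq ?_
    rw [← Real.exp_add]
    congr 1
    push_cast
    ring

theorem measureReal_le_sub_integral_le {n : ℕ} (ν : Fin n → Measure E)
    [∀ i, IsProbabilityMeasure (ν i)] {f : (Fin n → E) → ℝ} (hf : Measurable f) {C δ : ℝ}
    (hC : ∀ x, |f x| ≤ C) (hδ : ∀ x j e, |f (Function.update x j e) - f x| ≤ δ) {ε : ℝ}
    (hε : 0 ≤ ε) :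
    (Measure.pi ν).real {x | ε ≤ f x - ∫ y, f y ∂(Measure.pi ν)}
      ≤ Real.exp (-ε ^ 2 / (2 * (n * δ ^ 2))) := by
  have hsub : HasSubgaussianMGF (fun x => f x - ∫ y, f y ∂(Measure.pi ν))
      (⟨n * δ ^ 2, by positivity⟩ : ℝ≥0) (Measure.pi ν) :=
    ⟨fun t => integrable_exp_mul_of_abs_le (hf.sub_const _) (abs_sub_integral_le _ hC) t,
      fun t => integral_exp_mul_sub_integral_pi_le ν hf hC hδ t⟩
  exact hsub.measure_ge_le hε

end BoundedDifferences

/-! ### The residual in the mean -/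

section ReplaceCoordinate

variable {ι E : Type*} [Fintype ι] [DecidableEq ι] [MeasurableSpace E] (ν : ι → Measure E)
  [∀ i, IsProbabilityMeasure (ν i)] (j : ι) {f : (ι → E) → ℝ} {B : ℝ}

lemma lintegral_pi_le_of_update (hf : Measurable f) (hf0 : ∀ x, 0 ≤ f x)
    (hint : ∀ x, Integrable (fun e => f (Function.update x j e)) (ν j))
    (hB : ∀ x, ∫ e, f (Function.update x j e) ∂(ν j) ≤ B) :
    ∫⁻ x, ENNReal.ofReal (f x) ∂(Measure.pi ν) ≤ ENNReal.ofReal B := by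
  have hmp := measurePreserving_update ν j
  calc ∫⁻ x, ENNReal.ofReal (f x) ∂(Measure.pi ν)
      = ∫⁻ x, ∫⁻ e, ENNReal.ofReal (f (Function.update x j e)) ∂(ν j) ∂(Measure.pi ν) := by
        rw [← hmp.lintegral_comp hf.ennreal_ofReal]
        exact lintegral_prod_symm' _ (hf.ennreal_ofReal.comp hmp.measurable)
    _ ≤ ∫⁻ _, ENNReal.ofReal B ∂(Measure.pi ν) := lintegral_mono fun x => by
        rw [← ofReal_integral_eq_lintegral_ofReal (hint x) (ae_of_all _ fun e => hf0 _)]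
        exact ENNReal.ofReal_le_ofReal (hB x)
    _ = ENNReal.ofReal B := by simp

lemma integrable_pi_of_update (hf : Measurable f) (hf0 : ∀ x, 0 ≤ f x)
    (hint : ∀ x, Integrable (fun e => f (Function.update x j e)) (ν j))
    (hB : ∀ x, ∫ e, f (Function.update x j e) ∂(ν j) ≤ B) : Integrable f (Measure.pi ν) :=
  (lintegral_ofReal_ne_top_iff_integrable hf.aestronglyMeasurable (ae_of_all _ hf0)).1
    ((lintegral_pi_le_of_update ν j hf hf0 hint hB).trans_lt ENNReal.ofReal_lt_top).ne

lemma integral_pi_le_of_update (hf : Measurable f) (hf0 : ∀ x, 0 ≤ f x)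
    (hint : ∀ x, Integrable (fun e => f (Function.update x j e)) (ν j))
    (hB : ∀ x, ∫ e, f (Function.update x j e) ∂(ν j) ≤ B) : ∫ x, f x ∂(Measure.pi ν) ≤ B := by
  obtain ⟨x⟩ := (Measure.pi ν).nonempty_of_neZero
  have hB0 : 0 ≤ B := (integral_nonneg fun _ => hf0 _).trans (hB x)
  rw [integral_eq_lintegral_of_nonneg_ae (ae_of_all _ hf0) hf.aestronglyMeasurable]
  exact ENNReal.toReal_le_of_le_ofReal hB0 (lintegral_pi_le_of_update ν j hf hf0 hint hB)

end ReplaceCoordinate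

section Residual

open Matrix

variable {p n : ℕ}

/-- The matrix of the form `ξ ↦ x_kᴴ G x_l` in the pair of columns `x₀, x₁` encoded by `ξ`. -/
def blockForm (k l : Fin 2) (G : Matrix (Fin p) (Fin p) ℂ) :
    Matrix (Fin 2 × Fin p) (Fin 2 × Fin p) ℂ :=
  fun a b => if a.1 = k ∧ b.1 = l then G a.2 b.2 else 0

lemma star_dotProduct_blockForm (k l : Fin 2) (G : Matrix (Fin p) (Fin p) ℂ)
    (ξ : Fin 2 × Fin p → ℂ) :
    star ξ ⬝ᵥ (blockForm k l G *ᵥ ξ) = star (column k ξ) ⬝ᵥ (G *ᵥ column l ξ) := by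
  simp only [dotProduct, mulVec, Fintype.sum_prod_type, blockForm, Pi.star_apply, column]
  fin_cases k <;> fin_cases l <;> simp

lemma trace_blockForm (k l : Fin 2) (G : Matrix (Fin p) (Fin p) ℂ) :
    (blockForm k l G).trace = if k = l then G.trace else 0 := by
  simp only [trace, diag_apply, Fintype.sum_prod_type, blockForm]
  fin_cases k <;> fin_cases l <;> simp

lemma sum_norm_blockForm_sq (k l : Fin 2) (G : Matrix (Fin p) (Fin p) ℂ) :
    ∑ a, ∑ b, ‖blockForm k l G a b‖ ^ 2 = ∑ i, ∑ j, ‖G i j‖ ^ 2 := by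
  simp only [Fintype.sum_prod_type, blockForm]
  fin_cases k <;> fin_cases l <;> simp

lemma norm_blockForm_diag_le {G : Matrix (Fin p) (Fin p) ℂ} (hdiag : ∀ i, ‖G i i‖ ≤ 1)
    (k l : Fin 2) (a : Fin 2 × Fin p) : ‖blockForm k l G a a‖ ≤ 1 := by
  unfold blockForm
  split_ifs
  · exact hdiag _
  · simp

lemma formDeviation_eq (n : ℕ) (G : Matrix (Fin p) (Fin p) ℂ) (ξ : Fin 2 × Fin p → ℂ)
    (k l : Fin 2) :
    formDeviation n G ξ k l
      = (n : ℂ)⁻¹ * (star ξ ⬝ᵥ (blockForm k l G *ᵥ ξ) - (blockForm k l G).trace) := by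
  rw [star_dotProduct_blockForm, trace_blockForm, mul_sub]
  rfl

lemma sum_norm_one_sq_le : ∑ i, ∑ j, ‖(1 : Matrix (Fin p) (Fin p) ℂ) i j‖ ^ 2 ≤ (p : ℝ) := by
  have hentry (i j : Fin p) :
      ‖(1 : Matrix (Fin p) (Fin p) ℂ) i j‖ ^ 2 = if i = j then 1 else 0 := by
    rw [one_apply]
    split_ifs <;> simp
  simp [hentry]

lemma formError_nonneg (n : ℕ) (G : Matrix (Fin p) (Fin p) ℂ) (ξ : Fin 2 × Fin p → ℂ) :
    0 ≤ formError n G ξ := by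
  unfold formError
  positivity

section Moments

variable {ν : Fin 2 × Fin p → Measure ℂ}

lemma integrable_formDeviation (hν : IsStandardFamily ν) (n : ℕ) (G : Matrix (Fin p) (Fin p) ℂ)
    (k l : Fin 2) : Integrable (fun ξ => formDeviation n G ξ k l) (Measure.pi ν) := by
  simp only [formDeviation_eq]
  exact (hν.integrable_quadForm_sub_trace _).const_mul _

lemma integrable_formError (hν : IsStandardFamily ν) (n : ℕ) (G : Matrix (Fin p) (Fin p) ℂ) :
    Integrable (formError n G) (Measure.pi ν) :=
  (integrable_finsetSum _ fun k _ => integrable_finsetSum _ fun l _ =>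
    (integrable_formDeviation hν n G k l).norm).add
    (integrable_finsetSum _ fun k _ => (integrable_formDeviation hν n 1 k k).norm)

variable {η : ℝ} {M : ℝ≥0} {G : Matrix (Fin p) (Fin p) ℂ}

lemma integral_norm_formDeviation_le (hν : IsStandardFamily ν) (hη : 0 < η)
    (hM : ∀ i, ∫⁻ e, ‖e‖ₑ ^ (2 + η) ∂(ν i) ≤ M) (hp : 0 < p)
    (hG : ∑ i, ∑ j, ‖G i j‖ ^ 2 ≤ p) (hdiag : ∀ i, ‖G i i‖ ≤ 1) (n : ℕ) (k l : Fin 2) :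
    ∫ ξ, ‖formDeviation n G ξ k l‖ ∂(Measure.pi ν)
      ≤ (n : ℝ)⁻¹ * quadBound η M (2 * p) := by
  have hcard : (Fintype.card (Fin 2 × Fin p) : ℝ) = 2 * p := by simp
  have hbound := hν.integral_norm_quadForm_sub_trace_le hη hM (blockForm k l G)
    (by
      rw [sum_norm_blockForm_sq, hcard]
      linarith [(Nat.cast_nonneg p : (0 : ℝ) ≤ p)])
    (norm_blockForm_diag_le hdiag k l) (by simpa using hp)
  rw [hcard] at hbound
  simp only [formDeviation_eq, norm_mul, norm_inv, Complex.norm_natCast]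
  rw [integral_const_mul]
  gcongr

lemma integral_formError_le (hν : IsStandardFamily ν) (hη : 0 < η)
    (hM : ∀ i, ∫⁻ e, ‖e‖ₑ ^ (2 + η) ∂(ν i) ≤ M) (hp : 0 < p)
    (hG : ∑ i, ∑ j, ‖G i j‖ ^ 2 ≤ p) (hdiag : ∀ i, ‖G i i‖ ≤ 1) (n : ℕ) :
    ∫ ξ, formError n G ξ ∂(Measure.pi ν) ≤ (n : ℝ)⁻¹ * (6 * quadBound η M (2 * p)) := by
  have hint (G : Matrix (Fin p) (Fin p) ℂ) (k l : Fin 2) :=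
    (integrable_formDeviation hν n G k l).norm
  have hbound := integral_norm_formDeviation_le hν hη hM hp hG hdiag n
  have hone := integral_norm_formDeviation_le hν hη hM hp sum_norm_one_sq_le
    (fun i => by simp) n
  unfold formError
  rw [integral_add (integrable_finsetSum _ fun k _ => integrable_finsetSum _ fun l _ => hint G k l)
      (integrable_finsetSum _ fun k _ => hint 1 k k),
    integral_finsetSum _ fun k _ => integrable_finsetSum _ fun l _ => hint G k l,
    integral_finsetSum _ fun k _ => hint 1 k k]
  simp_rw [integral_finsetSum _ fun l _ => hint G _ l]
  calc _ ≤ ∑ _ : Fin 2, ∑ _ : Fin 2, (n : ℝ)⁻¹ * quadBound η M (2 * p)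
        + ∑ _ : Fin 2, (n : ℝ)⁻¹ * quadBound η M (2 * p) := by
        gcongr with k _ l _ k _
        · exact hbound k l
        · exact hone k k
    _ = (n : ℝ)⁻¹ * (6 * quadBound η M (2 * p)) := by
        simp only [Fin.sum_univ_two]
        ring

end Moments

lemma continuous_column (k : Fin 2) : Continuous (column (p := p) k) := by
  unfold column
  fun_prop

lemma continuous_pairMatrix :
    Continuous (pairMatrix : (Fin 2 × Fin p → ℂ) → Matrix (Fin p) (Fin p) ℂ) := by
  have hvec (k l : Fin 2) : Continuous fun ξ : Fin 2 × Fin p → ℂ =>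
      vecMulVec (column k ξ) (star (column l ξ)) :=
    (continuous_column k).matrix_vecMulVec (continuous_column l).star
  exact ((hvec 0 1).sub (hvec 1 0)).const_smul (-I)

lemma continuous_columnMatrix :
    Continuous (columnMatrix : (Fin n → Fin 2 × Fin p → ℂ) → Matrix (Fin p) (Fin p) ℂ) := by
  have hsum : Continuous fun x : Fin n → Fin 2 × Fin p → ℂ => ∑ j, pairMatrix (x j) :=
    continuous_finsetSum _ fun j _ => continuous_pairMatrix.comp (continuous_apply j)
  exact hsum.const_smul (n : ℂ)⁻¹

lemma continuous_resolv_columnMatrix {z : ℂ} (hz : 0 < z.im) :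
    Continuous fun x : Fin n → Fin 2 × Fin p → ℂ => resolv (columnMatrix x) z := by
  unfold resolv
  have hsub : Continuous fun x : Fin n → Fin 2 × Fin p → ℂ =>
      columnMatrix x - z • (1 : Matrix (Fin p) (Fin p) ℂ) :=
    continuous_columnMatrix.sub continuous_const
  simp_rw [Matrix.inv_def, Ring.inverse_eq_inv']
  refine Continuous.smul (hsub.matrix_det.inv₀ fun x => ?_) hsub.matrix_adjugate
  exact ((isUnit_iff_isUnit_det _).1
    (isUnit_sub_smul (isHermitian_columnMatrix x) hz)).ne_zero

section Continuity

variable {X : Type*} [TopologicalSpace X] {G : X → Matrix (Fin p) (Fin p) ℂ}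
  {ξ : X → Fin 2 × Fin p → ℂ}

lemma continuous_formDeviation (hG : Continuous G) (hξ : Continuous ξ) (n : ℕ) (k l : Fin 2) :
    Continuous fun x => formDeviation n (G x) (ξ x) k l := by
  have hcolumn (k : Fin 2) : Continuous fun x => column k (ξ x) := (continuous_column k).comp hξ
  refine (continuous_const.mul
    ((hcolumn k).star.dotProduct (hG.matrix_mulVec (hcolumn l)))).sub (continuous_const.mul ?_)
  split_ifs
  · exact hG.matrix_trace
  · exact continuous_const

lemma continuous_formError (hG : Continuous G) (hξ : Continuous ξ) (n : ℕ) :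
    Continuous fun x => formError n (G x) (ξ x) :=
  (continuous_finsetSum _ fun k _ => continuous_finsetSum _ fun l _ =>
    (continuous_formDeviation hG hξ n k l).norm).add
    (continuous_finsetSum _ fun k _ => (continuous_formDeviation continuous_const hξ n k k).norm)

end Continuity

lemma measurable_colStieltjes {z : ℂ} (hz : 0 < z.im) :
    Measurable (colStieltjes z : (Fin n → Fin 2 × Fin p → ℂ) → ℂ) :=
  (continuous_const.mul (continuous_resolv_columnMatrix hz).matrix_trace).measurable

/-- The error that the `j`-th pair of columns makes in the limiting equation, measured with the
resolvent of the matrix built from the other pairs, which is independent of it. -/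
def leaveOneOutError (z : ℂ) (j : Fin n) (x : Fin n → Fin 2 × Fin p → ℂ) : ℝ :=
  formError n (resolv (columnMatrix (Function.update x j 0)) z) (x j)

lemma measurable_leaveOneOutError {z : ℂ} (hz : 0 < z.im) (j : Fin n) :
    Measurable (leaveOneOutError (p := p) z j) :=
  (continuous_formError ((continuous_resolv_columnMatrix hz).comp
    (continuous_id.update j continuous_const)) (continuous_apply j) n).measurable

lemma leaveOneOutError_update (z : ℂ) (j : Fin n) (x : Fin n → Fin 2 × Fin p → ℂ)
    (ξ : Fin 2 × Fin p → ℂ) :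
    leaveOneOutError z j (Function.update x j ξ)
      = formError n (resolv (columnMatrix (Function.update x j 0)) z) ξ := by
  simp only [leaveOneOutError, Function.update_idem, Function.update_self]

section Mean

variable {ν : Fin n → Fin 2 × Fin p → Measure ℂ} {η : ℝ} {M : ℝ≥0} {z : ℂ}

lemma integral_leaveOneOutError_update_le (hν : ∀ j, IsStandardFamily (ν j)) (hη : 0 < η)
    (hM : ∀ j i, ∫⁻ e, ‖e‖ₑ ^ (2 + η) ∂(ν j i) ≤ M) (hp : 0 < p) (hz : 1 ≤ z.im) (j : Fin n)
    (x : Fin n → Fin 2 × Fin p → ℂ) :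
    ∫ ξ, leaveOneOutError z j (Function.update x j ξ) ∂(Measure.pi (ν j))
      ≤ (n : ℝ)⁻¹ * (6 * quadBound η M (2 * p)) := by
  have hz0 : 0 < z.im := by linarith
  have hH := isHermitian_columnMatrix (Function.update x j 0)
  simp only [leaveOneOutError_update]
  refine integral_formError_le (hν j) hη (hM j) hp ?_ (fun i => ?_) n
  · refine (sum_norm_resolv_sq_le hH hz0).trans ?_
    rw [Fintype.card_fin]
    exact div_le_self (Nat.cast_nonneg p) (one_le_pow₀ hz)
  · exact (norm_resolv_apply_le hH hz0 i i).trans ((div_le_one hz0).2 hz)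

lemma integrable_leaveOneOutError (hν : ∀ j, IsStandardFamily (ν j)) (hη : 0 < η)
    (hM : ∀ j i, ∫⁻ e, ‖e‖ₑ ^ (2 + η) ∂(ν j i) ≤ M) (hp : 0 < p) (hz : 1 ≤ z.im) (j : Fin n) :
    Integrable (leaveOneOutError z j) (Measure.pi fun j => Measure.pi (ν j)) := by
  have hprob (j : Fin n) := (hν j).prob
  refine integrable_pi_of_update _ j (measurable_leaveOneOutError (by linarith) j)
    (fun x => formError_nonneg _ _ _) (fun x => ?_)
    (integral_leaveOneOutError_update_le hν hη hM hp hz j)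
  simp only [leaveOneOutError_update]
  exact integrable_formError (hν j) n _

lemma integral_leaveOneOutError_le (hν : ∀ j, IsStandardFamily (ν j)) (hη : 0 < η)
    (hM : ∀ j i, ∫⁻ e, ‖e‖ₑ ^ (2 + η) ∂(ν j i) ≤ M) (hp : 0 < p) (hz : 1 ≤ z.im) (j : Fin n) :
    ∫ x, leaveOneOutError z j x ∂(Measure.pi fun j => Measure.pi (ν j))
      ≤ (n : ℝ)⁻¹ * (6 * quadBound η M (2 * p)) := by
  have hprob (j : Fin n) := (hν j).prob
  refine integral_pi_le_of_update _ j (measurable_leaveOneOutError (by linarith) j)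
    (fun x => formError_nonneg _ _ _) (fun x => ?_)
    (integral_leaveOneOutError_update_le hν hη hM hp hz j)
  simp only [leaveOneOutError_update]
  exact integrable_formError (hν j) n _

theorem integral_norm_residual_le (hν : ∀ j, IsStandardFamily (ν j)) (hη : 0 < η)
    (hM : ∀ j i, ∫⁻ e, ‖e‖ₑ ^ (2 + η) ∂(ν j i) ≤ M) (hp : 0 < p) (hn : 0 < n)
    (hz1 : 1 ≤ z.im) (hz : 2 * ((p : ℝ) / n) ≤ z.im) :
    ∫ x, ‖residual ((p : ℝ) / n) z (colStieltjes z x)‖ ∂(Measure.pi fun j => Measure.pi (ν j))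
      ≤ 2 * (4 * ((p : ℝ) / n) + 6) * (12 * (quadBound η M (2 * p) / (2 * p)) + 4 / p) := by
  have hprob (j : Fin n) := (hν j).prob
  set μ := Measure.pi fun j => Measure.pi (ν j)
  set K : ℝ := 2 * (4 * ((p : ℝ) / n) + 6)
  have hint (j : Fin n) :
      Integrable (fun x => K * (leaveOneOutError z j x + 4 / n)) μ :=
    ((integrable_leaveOneOutError hν hη hM hp hz1 j).add (integrable_const _)).const_mul K
  calc ∫ x, ‖residual ((p : ℝ) / n) z (colStieltjes z x)‖ ∂μ
      ≤ ∫ x, (p : ℝ)⁻¹ * ∑ j, K * (leaveOneOutError z j x + 4 / n) ∂μ :=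
        integral_mono_of_nonneg (ae_of_all _ fun x => norm_nonneg _)
          ((integrable_finsetSum _ fun j _ => hint j).const_mul _)
          (ae_of_all _ (norm_residual_le hp hn hz1 hz))
    _ = (p : ℝ)⁻¹ * ∑ j, K * (∫ x, leaveOneOutError z j x ∂μ + 4 / n) := by
        rw [integral_const_mul, integral_finsetSum _ fun j _ => hint j]
        congr 1
        refine Finset.sum_congr rfl fun j _ => ?_
        rw [integral_const_mul, integral_add (integrable_leaveOneOutError hν hη hM hp hz1 j)
          (integrable_const _), integral_const, probReal_univ, one_smul]
    _ ≤ (p : ℝ)⁻¹ * ∑ _ : Fin n, K * ((n : ℝ)⁻¹ * (6 * quadBound η M (2 * p)) + 4 / n) := by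
        gcongr with j
        exact integral_leaveOneOutError_le hν hη hM hp hz1 j
    _ = K * (12 * (quadBound η M (2 * p) / (2 * p)) + 4 / p) := by
        rw [Finset.sum_const, Finset.card_univ, Fintype.card_fin, nsmul_eq_mul]
        field_simp
        ring

end Mean

end Residual

/-! ### Almost sure convergence of the residual -/

section SampleMatrices

open Matrix

variable {p n : ℕ}

/-- The columns of a pair of data matrices, the `j`-th columns of both matrices being combined
into one vector, which is how the independent randomness is resampled. -/
def columns (Z : Fin 2 → Matrix (Fin p) (Fin n) ℂ) : Fin n → Fin 2 × Fin p → ℂ :=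
  fun j a => Z a.1 a.2 j

lemma neg_I_smul_sampleCommutator (Z : Fin 2 → Matrix (Fin p) (Fin n) ℂ) :
    (-I) • sampleCommutator (Z 0) (Z 1) = columnMatrix (columns Z) := by
  ext i k
  simp only [sampleCommutator, columnMatrix, pairMatrix, column, columns, Matrix.smul_apply,
    Matrix.sub_apply, Matrix.mul_apply, Matrix.sum_apply, conjTranspose_apply, vecMulVec_apply,
    Pi.star_apply, smul_eq_mul, ← Finset.mul_sum, Finset.sum_sub_distrib]
  ring

lemma stieltjes_skewESD {S : Matrix (Fin p) (Fin p) ℂ} (hS : S.conjTranspose = -S) {z : ℂ}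
    (hz : 0 < z.im) :
    stieltjes (skewESD S hS) z = (p : ℂ)⁻¹ * (resolv ((-I) • S) z).trace := by
  rw [trace_resolv (isHermitian_neg_I_smul hS) hz, stieltjes_apply, skewESD, integral_smul_measure,
    integral_finsetSum_measure fun i _ => integrable_dirac (by simp)]
  simp [ENNReal.toReal_inv]

lemma isProbabilityMeasure_skewESD {S : Matrix (Fin p) (Fin p) ℂ} (hS : S.conjTranspose = -S)
    (hp : 0 < p) : IsProbabilityMeasure (skewESD S hS) := by
  refine ⟨?_⟩
  simp only [skewESD, Measure.smul_apply, Measure.finsetSum_apply, measure_univ,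
    Finset.sum_const, Finset.card_univ, Fintype.card_fin, smul_eq_mul, nsmul_eq_mul, mul_one]
  exact ENNReal.inv_mul_cancel (by exact_mod_cast hp.ne') (ENNReal.natCast_ne_top p)

lemma stieltjes_skewESD_eq_colStieltjes (Z : Fin 2 → Matrix (Fin p) (Fin n) ℂ) {z : ℂ}
    (hz : 0 < z.im) :
    stieltjes (skewESD (sampleCommutator (Z 0) (Z 1)) (sampleCommutator_conjTranspose _ _)) z
      = colStieltjes z (columns Z) := by
  rw [stieltjes_skewESD _ hz, neg_I_smul_sampleCommutator, colStieltjes]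

end SampleMatrices

section Concentration

variable {p n : ℕ} {z : ℂ}

lemma norm_residual_sub_le {κ : ℝ} {m m' : ℂ} (hm : ‖κ * m‖ ≤ 1 / 2) (hm' : ‖κ * m'‖ ≤ 1 / 2) :
    ‖residual κ z m - residual κ z m'‖ ≤ (‖z‖ + 4) * ‖m - m'‖ := by
  have hne := one_sub_sq_ne_zero hm
  have hne' := one_sub_sq_ne_zero hm'
  have hsub : residual κ z m - residual κ z m'
      = (z + 2 * (κ * m + κ * m') / ((1 - (κ * m) ^ 2) * (1 - (κ * m') ^ 2))) * (m - m') := by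
    rw [residual, residual, add_sub_add_comm, div_sub_div _ _ hne hne', add_mul,
      div_mul_eq_mul_div]
    ring
  have hquot : ‖2 * (κ * m + κ * m') / ((1 - (κ * m) ^ 2) * (1 - (κ * m') ^ 2))‖ ≤ 4 := by
    rw [norm_div, norm_mul, norm_mul, Complex.norm_two]
    calc 2 * ‖κ * m + κ * m'‖ / (‖1 - (κ * m) ^ 2‖ * ‖1 - (κ * m') ^ 2‖)
        ≤ 2 * (1 / 2 + 1 / 2) / (3 / 4 * (3 / 4)) := by
          gcongr
          · exact (norm_add_le _ _).trans (add_le_add hm hm')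
          · exact three_quarters_le_norm_one_sub_sq hm
          · exact three_quarters_le_norm_one_sub_sq hm'
      _ ≤ 4 := by norm_num
  rw [hsub, norm_mul]
  gcongr
  exact (norm_add_le _ _).trans (by gcongr)

lemma norm_colStieltjes_update_sub_le (hz : 0 < z.im) (hp : 0 < p)
    (x : Fin n → Fin 2 × Fin p → ℂ) (j : Fin n) (e : Fin 2 × Fin p → ℂ) :
    ‖colStieltjes z (Function.update x j e) - colStieltjes z x‖ ≤ 4 / (p * z.im) := by
  set H := columnMatrix (Function.update x j 0)
  have hH : H.IsHermitian := isHermitian_columnMatrix _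
  have hnew := norm_trace_resolv_add_pairMatrix_sub_le hH hz n e
  have hold := norm_trace_resolv_add_pairMatrix_sub_le hH hz n (x j)
  rw [← columnMatrix_update] at hnew
  rw [← columnMatrix_eq_add] at hold
  unfold colStieltjes
  rw [← mul_sub, norm_mul, norm_inv, Complex.norm_natCast]
  calc _ ≤ (p : ℝ)⁻¹ * (2 / z.im + 2 / z.im) := by
        gcongr
        refine (norm_sub_le_norm_sub_add_norm_sub _ (resolv H z).trace _).trans ?_
        exact add_le_add hnew ((norm_sub_rev _ _).trans_le hold)
    _ = 4 / (p * z.im) := by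
        field_simp
        norm_num

lemma norm_residual_colStieltjes_le (hp : 0 < p) (hn : 0 < n) (hz1 : 1 ≤ z.im)
    (hz : 2 * ((p : ℝ) / n) ≤ z.im) (x : Fin n → Fin 2 × Fin p → ℂ) :
    ‖residual (p / n : ℝ) z (colStieltjes z x)‖ ≤ ‖z‖ + 5 := by
  have hsub := norm_residual_sub_le (z := z) (norm_ratio_mul_colStieltjes_le hp hn hz x)
    (m' := 0) (by simp)
  have hone : residual (p / n : ℝ) z 0 = 1 := by simp [residual]
  have hm : ‖colStieltjes z x‖ ≤ 1 := (norm_colStieltjes_le (by linarith) hp x).trans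
    (div_le_one_of_le₀ hz1 (by linarith))
  rw [sub_zero, hone] at hsub
  calc _ ≤ ‖residual (p / n : ℝ) z (colStieltjes z x) - 1‖ + ‖(1 : ℂ)‖ :=
        norm_le_norm_sub_add _ _
    _ ≤ (‖z‖ + 4) * 1 + 1 := by
        rw [norm_one]
        gcongr
        exact hsub.trans (by gcongr)
    _ = ‖z‖ + 5 := by ring

lemma measurable_norm_residual_colStieltjes (hz : 0 < z.im) (κ : ℝ) :
    Measurable fun x : Fin n → Fin 2 × Fin p → ℂ => ‖residual κ z (colStieltjes z x)‖ := by
  have hm := measurable_colStieltjes (p := p) (n := n) hz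
  unfold residual
  fun_prop

theorem measureReal_norm_residual_sub_integral_le (ν : Fin n → Fin 2 × Fin p → Measure ℂ)
    [∀ j i, IsProbabilityMeasure (ν j i)] (hp : 0 < p) (hn : 0 < n) (hz1 : 1 ≤ z.im)
    (hz : 2 * ((p : ℝ) / n) ≤ z.im) {ε : ℝ} (hε : 0 ≤ ε) :
    (Measure.pi fun j => Measure.pi (ν j)).real
      {x | ε ≤ ‖residual (p / n : ℝ) z (colStieltjes z x)‖
        - ∫ y, ‖residual (p / n : ℝ) z (colStieltjes z y)‖ ∂(Measure.pi fun j => Measure.pi (ν j))}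
      ≤ Real.exp (-ε ^ 2 / (2 * (n * ((‖z‖ + 4) * (4 / p)) ^ 2))) := by
  have hz0 : 0 < z.im := by linarith
  refine measureReal_le_sub_integral_le _ (measurable_norm_residual_colStieltjes hz0 _)
    (fun x => (abs_norm _).trans_le (norm_residual_colStieltjes_le hp hn hz1 hz x))
    (fun x j e => ?_) hε
  have hhalf := norm_ratio_mul_colStieltjes_le (z := z) hp hn hz
  calc _ ≤ ‖residual (p / n : ℝ) z (colStieltjes z (Function.update x j e))
          - residual (p / n : ℝ) z (colStieltjes z x)‖ := abs_norm_sub_norm_le _ _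
    _ ≤ (‖z‖ + 4) * ‖colStieltjes z (Function.update x j e) - colStieltjes z x‖ :=
        norm_residual_sub_le (hhalf _) (hhalf _)
    _ ≤ (‖z‖ + 4) * (4 / p) := by
        gcongr
        refine (norm_colStieltjes_update_sub_le hz0 hp x j e).trans ?_
        gcongr
        exact le_mul_of_one_le_right (Nat.cast_nonneg p) hz1

end Concentration

section Model

variable {Ω : Type*} [MeasurableSpace Ω] {P : Measure Ω} {p : ℕ → ℕ}
  {Z : (n : ℕ) → Fin 2 → Ω → Matrix (Fin (p n)) (Fin n) ℂ}

/-- The law of the entry of row `a.2` and column `j` of the matrix `Z n a.1`. -/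
def entryLaw (P : Measure Ω) (Z : (n : ℕ) → Fin 2 → Ω → Matrix (Fin (p n)) (Fin n) ℂ) (n : ℕ)
    (j : Fin n) (a : Fin 2 × Fin (p n)) : Measure ℂ :=
  P.map fun ω => Z n a.1 ω a.2 j

lemma IsInnovationArray.isStandardFamily [IsProbabilityMeasure P] (hZ : IsInnovationArray P p Z)
    (n : ℕ) (j : Fin n) : IsStandardFamily (entryLaw P Z n j) where
  prob a := Measure.isProbabilityMeasure_map (hZ.measurable_entry n a.1 a.2 j).aemeasurable
  mean_zero a := by
    rw [entryLaw, integral_map (hZ.measurable_entry n a.1 a.2 j).aemeasurable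
      measurable_id'.aestronglyMeasurable]
    exact hZ.mean_zero n a.1 a.2 j
  variance_one a := by
    rw [entryLaw, integral_map (hZ.measurable_entry n a.1 a.2 j).aemeasurable
      (by fun_prop : Measurable fun e : ℂ => ‖e‖ ^ 2).aestronglyMeasurable]
    exact hZ.variance_one n a.1 a.2 j

lemma IsInnovationArray.lintegral_entryLaw (hZ : IsInnovationArray P p Z) (η : ℝ) (n : ℕ)
    (j : Fin n) (a : Fin 2 × Fin (p n)) :
    ∫⁻ e, ‖e‖ₑ ^ (2 + η) ∂(entryLaw P Z n j a) = ∫⁻ ω, ‖Z n a.1 ω a.2 j‖ₑ ^ (2 + η) ∂P := by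
  rw [entryLaw, lintegral_map (by fun_prop) (hZ.measurable_entry n a.1 a.2 j)]

lemma IsInnovationArray.measurable_columns (hZ : IsInnovationArray P p Z) (n : ℕ) :
    Measurable fun ω => columns fun k => Z n k ω :=
  measurable_pi_iff.2 fun j => measurable_pi_iff.2 fun a => hZ.measurable_entry n a.1 a.2 j

lemma IsInnovationArray.map_columns [IsProbabilityMeasure P] (hZ : IsInnovationArray P p Z)
    (n : ℕ) : P.map (fun ω => columns fun k => Z n k ω)
      = Measure.pi fun j => Measure.pi (entryLaw P Z n j) := by
  have hprob j : ∀ a, IsProbabilityMeasure (entryLaw P Z n j a) := (hZ.isStandardFamily n j).prob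
  have hmeas (e : Fin n × (Fin 2 × Fin (p n))) : Measurable fun ω => Z n e.2.1 ω e.2.2 e.1 :=
    hZ.measurable_entry n e.2.1 e.2.2 e.1
  have hindep : iIndepFun (fun (e : Fin n × (Fin 2 × Fin (p n))) ω => Z n e.2.1 ω e.2.2 e.1) P :=
    (hZ.indep n).precomp (g := fun e : Fin n × (Fin 2 × Fin (p n)) => (e.2.1, e.2.2, e.1))
      fun e e' h => by grind
  calc P.map (fun ω => columns fun k => Z n k ω)
      = (P.map fun ω (e : Fin n × (Fin 2 × Fin (p n))) => Z n e.2.1 ω e.2.2 e.1).map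
          (MeasurableEquiv.curry _ _ _) :=
        (Measure.map_map (MeasurableEquiv.curry (Fin n) (Fin 2 × Fin (p n)) ℂ).measurable
          (measurable_pi_iff.2 hmeas)).symm
    _ = (Measure.infinitePi fun e : Fin n × (Fin 2 × Fin (p n)) =>
          entryLaw P Z n e.1 e.2).map (MeasurableEquiv.curry _ _ _) := by
        rw [hindep.map_fun_eq_pi_map fun e => (hmeas e).aemeasurable, Measure.infinitePi_eq_pi]
        rfl
    _ = _ := by
        simp_rw [Measure.infinitePi_map_curry, Measure.infinitePi_eq_pi]

end Model

section BorelCantelli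

variable {Ω : Type*} [MeasurableSpace Ω] {P : Measure Ω} [IsFiniteMeasure P]

lemma ae_eventually_notMem_of_le_exp {A : ℕ → Set Ω} {b : ℝ} (hb : 0 < b)
    (hA : ∀ᶠ n : ℕ in atTop, P.real (A n) ≤ Real.exp (n * -b)) :
    ∀ᵐ ω ∂P, ∀ᶠ n in atTop, ω ∉ A n := by
  refine ae_eventually_notMem ?_
  have hsum : Summable fun n => P.real (A n) := by
    refine Summable.of_norm_bounded_eventually_nat
      (Real.summable_exp_nat_mul_iff.2 (neg_lt_zero.2 hb)) (hA.mono fun n hn => ?_)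
    rwa [Real.norm_of_nonneg measureReal_nonneg]
  simpa only [measureReal_def, ENNReal.ofReal_toReal (measure_ne_top P _)]
    using hsum.tsum_ofReal_ne_top

lemma ae_tendsto_zero_of_le_exp {f : ℕ → Ω → ℝ} {a : ℕ → ℝ} (hf : ∀ n ω, 0 ≤ f n ω)
    (ha : Tendsto a atTop (𝓝 0))
    (hP : ∀ ε, 0 < ε → ∃ b, 0 < b ∧
      ∀ᶠ n : ℕ in atTop, P.real {ω | ε ≤ f n ω - a n} ≤ Real.exp (n * -b)) :
    ∀ᵐ ω ∂P, Tendsto (fun n => f n ω) atTop (𝓝 0) := by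
  have hdev (k : ℕ) : ∀ᵐ ω ∂P, ∀ᶠ n in atTop, f n ω - a n < 1 / ((k : ℝ) + 1) := by
    obtain ⟨b, hb, hb'⟩ := hP (1 / ((k : ℝ) + 1)) (by positivity)
    filter_upwards [ae_eventually_notMem_of_le_exp hb hb'] with ω hω
    exact hω.mono fun n hn => not_le.1 hn
  filter_upwards [ae_all_iff.2 hdev] with ω hω
  refine tendsto_order.2 ⟨fun ε hε => .of_forall fun n => hε.trans_le (hf n ω), fun ε hε => ?_⟩
  obtain ⟨k, hk⟩ := exists_nat_one_div_lt (half_pos hε)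
  filter_upwards [hω k, ha.eventually_lt_const (half_pos hε)] with n hn hn'
  linarith

end BorelCantelli

section Asymptotics

variable {c : ℝ} {p : ℕ → ℕ}

lemma eventually_ratio_bounds (hc : 0 < c)
    (hpc : Tendsto (fun n : ℕ => (p n : ℝ) / n) atTop (𝓝 c)) :
    ∀ᶠ n : ℕ in atTop, 0 < n ∧ 0 < p n ∧ c / 2 * n ≤ p n ∧ (p n : ℝ) / n ≤ c + 1 := by
  filter_upwards [hpc.eventually_const_lt (half_lt_self hc),
    hpc.eventually_lt_const (lt_add_one c), eventually_gt_atTop 0] with n hlow hup hn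
  have hn' : (0 : ℝ) < n := by exact_mod_cast hn
  have hlow' : c / 2 * n < p n := (lt_div_iff₀ hn').1 hlow
  have hp : (0 : ℝ) < p n := lt_of_le_of_lt (by positivity) hlow'
  exact ⟨hn, by exact_mod_cast hp, hlow'.le, hup.le⟩

lemma tendsto_dimension_atTop (hc : 0 < c)
    (hpc : Tendsto (fun n : ℕ => (p n : ℝ) / n) atTop (𝓝 c)) :
    Tendsto (fun n : ℕ => (p n : ℝ)) atTop atTop :=
  tendsto_atTop_mono' _ ((eventually_ratio_bounds hc hpc).mono fun _ h => h.2.2.1)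
    (tendsto_natCast_atTop_atTop.const_mul_atTop (half_pos hc))

lemma tendsto_integral_norm_residual (hc : 0 < c)
    (hpc : Tendsto (fun n : ℕ => (p n : ℝ) / n) atTop (𝓝 c))
    {ν : (n : ℕ) → Fin n → Fin 2 × Fin (p n) → Measure ℂ} (hν : ∀ n j, IsStandardFamily (ν n j))
    {η : ℝ} (hη : 0 < η) {M : ℝ≥0} (hM : ∀ n j a, ∫⁻ e, ‖e‖ₑ ^ (2 + η) ∂(ν n j a) ≤ M) {z : ℂ}
    (hz : 2 * (c + 1) ≤ z.im) :
    Tendsto (fun n => ∫ x, ‖residual (p n / n : ℝ) z (colStieltjes z x)‖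
      ∂(Measure.pi fun j => Measure.pi (ν n j))) atTop (𝓝 0) := by
  have hdim := tendsto_dimension_atTop hc hpc
  have hbound : Tendsto (fun n : ℕ => 2 * (4 * ((p n : ℝ) / n) + 6)
      * (12 * (quadBound η M (2 * p n) / (2 * p n)) + 4 / (p n : ℝ))) atTop
      (𝓝 (2 * (4 * c + 6) * (12 * 0 + 0))) :=
    (((hpc.const_mul 4).add_const 6).const_mul 2).mul
      ((((tendsto_quadBound_div hη M).comp (hdim.const_mul_atTop two_pos)).const_mul 12).add
        (hdim.const_div_atTop 4))
  simp only [mul_zero, add_zero] at hbound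
  refine squeeze_zero' (.of_forall fun n => integral_nonneg fun x => norm_nonneg _) ?_ hbound
  filter_upwards [eventually_ratio_bounds hc hpc] with n h
  obtain ⟨hn, hp, -, hup⟩ := h
  exact integral_norm_residual_le (hν n) hη (hM n) hp hn (by linarith) (by linarith)

lemma exp_neg_sq_div_le {n p ε K : ℝ} (hc : 0 < c) (hn : 0 < n) (hK : 0 < K)
    (hp : c / 2 * n ≤ p) :
    Real.exp (-ε ^ 2 / (2 * (n * (K * (4 / p)) ^ 2)))
      ≤ Real.exp (n * -(ε ^ 2 * c ^ 2 / (128 * K ^ 2))) := by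
  have hp0 : 0 < p := lt_of_lt_of_le (by positivity) hp
  have hsq : (c / 2 * n) ^ 2 ≤ p ^ 2 := by gcongr
  rw [Real.exp_le_exp, neg_div, mul_neg, neg_le_neg_iff]
  calc n * (ε ^ 2 * c ^ 2 / (128 * K ^ 2))
      = ε ^ 2 / (32 * n * K ^ 2) * (c / 2 * n) ^ 2 := by
        field_simp
        ring
    _ ≤ ε ^ 2 / (32 * n * K ^ 2) * p ^ 2 := by gcongr
    _ = ε ^ 2 / (2 * (n * (K * (4 / p)) ^ 2)) := by
        field_simp
        ring

variable {Ω : Type*} [MeasurableSpace Ω] {P : Measure Ω} [IsProbabilityMeasure P]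
  {Z : (n : ℕ) → Fin 2 → Ω → Matrix (Fin (p n)) (Fin n) ℂ}

lemma IsInnovationArray.measureReal_norm_residual_sub_integral_le (hZ : IsInnovationArray P p Z)
    {n : ℕ} (hc : 0 < c) (hn : 0 < n) (hp : c / 2 * n ≤ p n) {z : ℂ} (hz1 : 1 ≤ z.im)
    (hz : 2 * ((p n : ℝ) / n) ≤ z.im) {ε : ℝ} (hε : 0 ≤ ε) :
    P.real {ω | ε ≤ ‖residual (p n / n : ℝ) z (colStieltjes z (columns fun k => Z n k ω))‖
      - ∫ x, ‖residual (p n / n : ℝ) z (colStieltjes z x)‖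
        ∂(Measure.pi fun j => Measure.pi (entryLaw P Z n j))}
      ≤ Real.exp (n * -(ε ^ 2 * c ^ 2 / (128 * (‖z‖ + 4) ^ 2))) := by
  have hprob j : ∀ a, IsProbabilityMeasure (entryLaw P Z n j a) := (hZ.isStandardFamily n j).prob
  have hn' : (0 : ℝ) < n := by exact_mod_cast hn
  have hp0 : (0 : ℝ) < p n := lt_of_lt_of_le (by positivity) hp
  have hmeas := measurable_norm_residual_colStieltjes (p := p n) (n := n) (z := z) (by linarith)
    (p n / n)
  refine le_trans (le_of_eq ?_) ((CommutatorLSD.measureReal_norm_residual_sub_integral_le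
    (entryLaw P Z n) (by exact_mod_cast hp0) hn hz1 hz hε).trans
    (exp_neg_sq_div_le hc hn' (by positivity) hp))
  rw [← hZ.map_columns, map_measureReal_apply (hZ.measurable_columns n)
    (measurableSet_le measurable_const (hmeas.sub_const _))]
  rfl

theorem IsInnovationArray.ae_tendsto_residual (hZ : IsInnovationArray P p Z) (hc : 0 < c)
    (hpc : Tendsto (fun n : ℕ => (p n : ℝ) / n) atTop (𝓝 c)) {z : ℂ} (hz : 2 * (c + 1) ≤ z.im) :
    ∀ᵐ ω ∂P, Tendsto (fun n => residual (p n / n : ℝ) z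
      (colStieltjes z (columns fun k => Z n k ω))) atTop (𝓝 0) := by
  obtain ⟨η, hη, M, hM⟩ := hZ.moment_bound
  have hmean := tendsto_integral_norm_residual hc hpc hZ.isStandardFamily hη (M := M)
    (fun n j a => (hZ.lintegral_entryLaw η n j a).trans_le (hM n a.1 a.2 j)) hz
  simp_rw [tendsto_zero_iff_norm_tendsto_zero (E := ℂ)]
  refine ae_tendsto_zero_of_le_exp (fun n ω => norm_nonneg _) hmean fun ε hε =>
    ⟨ε ^ 2 * c ^ 2 / (128 * (‖z‖ + 4) ^ 2), by positivity, ?_⟩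
  filter_upwards [eventually_ratio_bounds hc hpc] with n h
  obtain ⟨hn, -, hlow, hup⟩ := h
  exact hZ.measureReal_norm_residual_sub_integral_le hc hn hlow (by linarith) (by linarith) hε.le

end Asymptotics

/-! ### Passage to the limit -/

section Limit

lemma lsdCubic_eq_residual_mul {κ : ℝ} {z m : ℂ} (hm : ‖κ * m‖ ≤ 1 / 2) :
    lsdCubic κ z m = residual κ z m * (1 - (κ * m) ^ 2) := by
  unfold lsdCubic residual
  rw [add_mul _ _ (1 - (κ * m : ℂ) ^ 2), div_mul_cancel₀ _ (one_sub_sq_ne_zero hm)]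
  ring

lemma norm_one_add_mul_le {κ : ℝ} {z m : ℂ} (hκ : 0 ≤ κ) (hm : ‖κ * m‖ ≤ 1 / 2) :
    ‖1 + z * m‖ ≤ ‖residual κ z m‖ + 3 * κ * ‖m‖ ^ 2 := by
  have hquot : ‖2 * κ * m ^ 2 / (1 - (κ * m) ^ 2)‖ ≤ 3 * κ * ‖m‖ ^ 2 := by
    rw [norm_div, norm_mul, norm_mul, norm_pow, Complex.norm_real, Real.norm_of_nonneg hκ,
      Complex.norm_two]
    calc 2 * κ * ‖m‖ ^ 2 / ‖1 - (κ * m) ^ 2‖ ≤ 2 * κ * ‖m‖ ^ 2 / (3 / 4) := by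
          gcongr
          exact three_quarters_le_norm_one_sub_sq hm
      _ ≤ 3 * κ * ‖m‖ ^ 2 := by
          have : 0 ≤ κ * ‖m‖ ^ 2 := by positivity
          linarith
  have hsub : 1 + z * m = residual κ z m - 2 * κ * m ^ 2 / (1 - (κ * m) ^ 2) :=
    (add_sub_cancel_right _ _).symm
  rw [hsub]
  exact (norm_sub_le _ _).trans (by gcongr)

lemma norm_ofReal_mul_stieltjes_le (μ : Measure ℝ) [IsProbabilityMeasure μ] {κ : ℝ} {z : ℂ}
    (hκ : 0 ≤ κ) (hz : 0 < z.im) (hκz : 2 * κ ≤ z.im) : ‖κ * stieltjes μ z‖ ≤ 1 / 2 := by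
  rw [norm_mul, Complex.norm_real, Real.norm_of_nonneg hκ]
  calc κ * ‖stieltjes μ z‖ ≤ (z.im / 2) * z.im⁻¹ := by
        gcongr
        · linarith
        · exact norm_stieltjes_le μ hz
    _ = 1 / 2 := by field_simp

/-- A sequence of probability measures whose Stieltjes transforms solve the limiting equation
asymptotically, the aspect ratio `κ n` tending to `c`. The equation is only required at countably
many points `z`, so that the exceptional null sets of a random sequence can be united. -/
structure IsAsymptoticSolution (c : ℝ) (κ : ℕ → ℝ) (μ : ℕ → ProbabilityMeasure ℝ) : Prop where
  pos : 0 < c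
  tendsto_ratio : Tendsto κ atTop (𝓝 c)
  nonneg : ∀ n, 0 ≤ κ n
  tendsto_residual : ∀ t : ℚ, 2 * (c + 1) ≤ t →
    Tendsto (fun n => residual (κ n) (t * I) (stieltjes (μ n) (t * I))) atTop (𝓝 0)

namespace IsAsymptoticSolution

variable {c : ℝ} {κ : ℕ → ℝ} {μ : ℕ → ProbabilityMeasure ℝ}

lemma comp (h : IsAsymptoticSolution c κ μ) {φ : ℕ → ℕ} (hφ : Tendsto φ atTop atTop) :
    IsAsymptoticSolution c (κ ∘ φ) (μ ∘ φ) where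
  pos := h.pos
  tendsto_ratio := h.tendsto_ratio.comp hφ
  nonneg _ := h.nonneg _
  tendsto_residual t ht := (h.tendsto_residual t ht).comp hφ

lemma eventually_norm_mul_stieltjes_le (h : IsAsymptoticSolution c κ μ) {z : ℂ}
    (hz : 2 * (c + 1) ≤ z.im) : ∀ᶠ n in atTop, ‖κ n * stieltjes (μ n) z‖ ≤ 1 / 2 := by
  have hc := h.pos
  filter_upwards [h.tendsto_ratio.eventually_lt_const (lt_add_one c)] with n hn
  exact norm_ofReal_mul_stieltjes_le _ (h.nonneg n) (by linarith) (by linarith)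

lemma lsdCubic_rat_eq_zero (h : IsAsymptoticSolution c κ μ) {F : ProbabilityMeasure ℝ}
    (hF : Tendsto μ atTop (𝓝 F)) {t : ℚ} (ht : 2 * (c + 1) ≤ t) :
    lsdCubic c (t * I) (stieltjes F (t * I)) = 0 := by
  have hc := h.pos
  have him : (t * I : ℂ).im = t := by simp
  have hm := tendsto_stieltjes hF (z := t * I) (by rw [him]; linarith)
  have hκ : Tendsto (fun n => (κ n : ℂ)) atTop (𝓝 (c : ℂ)) :=
    (Complex.continuous_ofReal.tendsto c).comp h.tendsto_ratio
  have hcubic : Tendsto (fun n => lsdCubic (κ n) (t * I) (stieltjes (μ n) (t * I))) atTop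
      (𝓝 (lsdCubic c (t * I) (stieltjes F (t * I)))) :=
    (((hm.const_mul _).const_add 1).mul (((hκ.pow 2).mul (hm.pow 2)).const_sub 1)).add
      ((hκ.const_mul 2).mul (hm.pow 2))
  have hzero := (h.tendsto_residual t ht).mul (((hκ.mul hm).pow 2).const_sub 1)
  rw [zero_mul] at hzero
  refine tendsto_nhds_unique (hcubic.congr' ?_) hzero
  filter_upwards [h.eventually_norm_mul_stieltjes_le (ht.trans_eq him.symm)] with n hn
  exact lsdCubic_eq_residual_mul hn

theorem solvesCubic_of_tendsto (h : IsAsymptoticSolution c κ μ) {F : ProbabilityMeasure ℝ}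
    (hF : Tendsto μ atTop (𝓝 F)) : SolvesCubic c (F : Measure ℝ) := by
  intro z hz
  have hdiff : DifferentiableOn ℂ (fun z => lsdCubic c z (stieltjes F z)) {z | 0 < z.im} := by
    intro z hz
    have hm := differentiableAt_stieltjes (F : Measure ℝ) hz
    unfold lsdCubic
    exact DifferentiableAt.differentiableWithinAt (by fun_prop)
  exact eq_zero_of_eq_zero_on_rat (f := fun z => lsdCubic c z (stieltjes F z)) hdiff
    (2 * (c + 1)) (fun t ht => h.lsdCubic_rat_eq_zero hF ht) hz

lemma eventually_measure_norm_gt_le (h : IsAsymptoticSolution c κ μ) {N : ℕ}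
    (hN : 2 * (c + 1) ≤ N) : ∀ᶠ n in atTop,
      (μ n : Measure ℝ) {x | (N : ℝ) < ‖x‖} ≤ ENNReal.ofReal (8 * (c + 1) / N) := by
  have hc := h.pos
  have hN1 : (1 : ℝ) ≤ N := by linarith
  have hN0 : (0 : ℝ) < N := by linarith
  have hres := (h.tendsto_residual N (by exact_mod_cast hN)).norm
  have him : ((N : ℝ) * I : ℂ).im = N := by simp
  simp only [Rat.cast_natCast, norm_zero, ← Complex.ofReal_natCast] at hres
  filter_upwards [hres.eventually_lt_const (show (0 : ℝ) < (c + 1) / N by positivity),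
    h.tendsto_ratio.eventually_lt_const (lt_add_one c),
    h.eventually_norm_mul_stieltjes_le (hN.trans_eq him.symm)] with n hres hκ hhalf
  have hm : ‖stieltjes (μ n) ((N : ℝ) * I)‖ ^ 2 ≤ 1 / N := by
    have hle := norm_stieltjes_le (μ n : Measure ℝ) (z := (N : ℝ) * I) (by simpa using hN0)
    rw [him] at hle
    calc _ ≤ ((N : ℝ)⁻¹) ^ 2 := by gcongr
      _ ≤ (N : ℝ)⁻¹ := pow_le_of_le_one (by positivity) (inv_le_one_of_one_le₀ hN1) two_ne_zero
      _ = 1 / N := inv_eq_one_div _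
  have hκ0 := h.nonneg n
  rw [← ofReal_measureReal]
  refine ENNReal.ofReal_le_ofReal ((measureReal_norm_gt_le (μ n : Measure ℝ) hN0).trans ?_)
  calc _ ≤ 2 * ((c + 1) / N + 3 * (c + 1) * (1 / N)) := by
        gcongr
        refine (norm_one_add_mul_le hκ0 hhalf).trans (add_le_add hres.le ?_)
        gcongr
    _ = 8 * (c + 1) / N := by ring

theorem isTightMeasureSet (h : IsAsymptoticSolution c κ μ) :
    IsTightMeasureSet (Set.range fun n => (μ n : Measure ℝ)) := by
  have hc := h.pos
  refine isTightMeasureSet_range_of_tendsto_limsup_measure_norm_gt ?_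
  have hbound : Tendsto (fun r : ℝ => ENNReal.ofReal (8 * (c + 1) / (⌊r⌋₊ : ℝ))) atTop (𝓝 0) := by
    rw [← ENNReal.ofReal_zero]
    exact ENNReal.tendsto_ofReal (Tendsto.const_div_atTop
      (tendsto_natCast_atTop_atTop.comp tendsto_nat_floor_atTop) _)
  refine tendsto_of_tendsto_of_tendsto_of_le_of_le' tendsto_const_nhds hbound
    (.of_forall fun _ => zero_le) ?_
  filter_upwards [eventually_ge_atTop (2 * (c + 1) + 1)] with r hr
  have hfloor : 2 * (c + 1) ≤ (⌊r⌋₊ : ℝ) := by linarith [Nat.lt_floor_add_one r]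
  refine limsup_le_of_le (h := ?_)
  filter_upwards [h.eventually_measure_norm_gt_le hfloor] with n hn
  refine (measure_mono fun x hx => ?_).trans hn
  exact (Nat.floor_le (show 0 ≤ r by linarith)).trans_lt hx

theorem exists_solvesCubic_tendsto_subseq (h : IsAsymptoticSolution c κ μ) :
    ∃ F : ProbabilityMeasure ℝ, SolvesCubic c (F : Measure ℝ) ∧
      ∃ φ : ℕ → ℕ, Tendsto (fun n => μ (φ n)) atTop (𝓝 F) := by
  have hcompact : IsCompact (closure (Set.range μ)) := by
    refine isCompact_closure_of_isTightMeasureSet ?_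
    convert! h.isTightMeasureSet using 1
    ext x
    simp
  obtain ⟨F, -, φ, hφ, hF⟩ :=
    hcompact.tendsto_subseq fun n => subset_closure (Set.mem_range_self n)
  exact ⟨F, (h.comp hφ.tendsto_atTop).solvesCubic_of_tendsto hF, φ, hF⟩

theorem tendsto (h : IsAsymptoticSolution c κ μ) {F : ProbabilityMeasure ℝ}
    (hF : SolvesCubic c (F : Measure ℝ)) : Tendsto μ atTop (𝓝 F) := by
  refine tendsto_of_subseq_tendsto fun ns hns => ?_
  obtain ⟨G, hG, φ, hφ⟩ := (h.comp hns).exists_solvesCubic_tendsto_subseq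
  have hGF : G = F :=
    Subtype.ext (hG.measure_eq (F := (G : Measure ℝ)) (G := (F : Measure ℝ)) hF h.pos)
  exact ⟨φ, hGF ▸ hφ⟩

end IsAsymptoticSolution

end Limit

section Spectral

/-- The empirical spectral distribution as a probability measure; for `p = 0`, where there are no
eigenvalues, the point mass at `0` is used. -/
def probESD {p n : ℕ} (Z : Fin 2 → Matrix (Fin p) (Fin n) ℂ) : ProbabilityMeasure ℝ :=
  if hp : 0 < p then
    ⟨skewESD (sampleCommutator (Z 0) (Z 1)) (sampleCommutator_conjTranspose _ _),
      isProbabilityMeasure_skewESD _ hp⟩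
  else ⟨Measure.dirac 0, inferInstance⟩

lemma coe_probESD {p n : ℕ} (Z : Fin 2 → Matrix (Fin p) (Fin n) ℂ) (hp : 0 < p) :
    (probESD Z : Measure ℝ)
      = skewESD (sampleCommutator (Z 0) (Z 1)) (sampleCommutator_conjTranspose _ _) :=
  congrArg Subtype.val (dif_pos hp)

variable {c : ℝ} {Ω : Type*} [MeasurableSpace Ω] {P : Measure Ω} [IsProbabilityMeasure P]
  {p : ℕ → ℕ} {Z : (n : ℕ) → Fin 2 → Ω → Matrix (Fin (p n)) (Fin n) ℂ}

theorem IsInnovationArray.ae_isAsymptoticSolution (hZ : IsInnovationArray P p Z) (hc : 0 < c)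
    (hpc : Tendsto (fun n : ℕ => (p n : ℝ) / n) atTop (𝓝 c)) :
    ∀ᵐ ω ∂P, IsAsymptoticSolution c (fun n => (p n : ℝ) / n)
      (fun n => probESD fun k => Z n k ω) := by
  have him (t : ℚ) : (t * I : ℂ).im = t := by simp
  have hae : ∀ᵐ ω ∂P, ∀ t : ℚ, 2 * (c + 1) ≤ t →
      Tendsto (fun n => residual (p n / n : ℝ) (t * I)
        (colStieltjes (t * I) (columns fun k => Z n k ω))) atTop (𝓝 0) :=
    ae_all_iff.2 fun t => eventually_imp_distrib_left.2 fun ht =>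
      hZ.ae_tendsto_residual hc hpc (ht.trans_eq (him t).symm)
  filter_upwards [hae] with ω hω
  refine ⟨hc, hpc, fun n => by positivity, fun t ht => (hω t ht).congr' ?_⟩
  filter_upwards [eventually_ratio_bounds hc hpc] with n hn
  rw [coe_probESD _ hn.2.1, ← stieltjes_skewESD_eq_colStieltjes (fun k => Z n k ω)]
  rw [him]
  linarith

theorem IsInnovationArray.isLSD_of_solvesCubic (hZ : IsInnovationArray P p Z) (hc : 0 < c)
    (hpc : Tendsto (fun n : ℕ => (p n : ℝ) / n) atTop (𝓝 c)) {F : ProbabilityMeasure ℝ}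
    (hF : SolvesCubic c (F : Measure ℝ)) : IsLSD P p Z (F : Measure ℝ) := by
  filter_upwards [hZ.ae_isAsymptoticSolution hc hpc] with ω hω f
  refine ((ProbabilityMeasure.tendsto_iff_forall_integral_tendsto.1 (hω.tendsto hF)) f).congr' ?_
  filter_upwards [eventually_ratio_bounds hc hpc] with n hn
  rw [coe_probESD _ hn.2.1]

end Spectral

/-! ### Existence of a model -/

section Existence

/-- The symmetric distribution on `{1, -1}`. -/
def signLaw : Measure ℂ := (2 : ℝ≥0∞)⁻¹ • (Measure.dirac 1 + Measure.dirac (-1))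

instance : IsProbabilityMeasure signLaw := by
  refine ⟨?_⟩
  simp only [signLaw, Measure.smul_apply, Measure.add_apply, measure_univ, smul_eq_mul,
    one_add_one_eq_two]
  exact ENNReal.inv_mul_cancel two_ne_zero ENNReal.ofNat_ne_top

lemma ae_signLaw_norm_eq_one : ∀ᵐ e ∂signLaw, ‖e‖ = 1 := by
  refine Measure.ae_smul_measure (ae_add_measure_iff.2 ?_) _
  simp [ae_dirac_eq]

lemma integral_signLaw_id : ∫ e, e ∂signLaw = 0 := by
  rw [signLaw, integral_smul_measure, integral_add_measure (integrable_dirac (by simp))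
    (integrable_dirac (by simp)), integral_dirac, integral_dirac, add_neg_cancel, smul_zero]

/-- The law of a doubly infinite pair of arrays of independent random signs. -/
def signMeasure : Measure (Fin 2 × ℕ × ℕ → ℂ) := Measure.infinitePi fun _ => signLaw

instance : IsProbabilityMeasure signMeasure := by
  unfold signMeasure
  infer_instance

lemma measurePreserving_eval_signMeasure (e : Fin 2 × ℕ × ℕ) :
    MeasurePreserving (Function.eval e) signMeasure signLaw :=
  measurePreserving_eval_infinitePi (fun _ => signLaw) e

lemma ae_signMeasure_norm_eq_one (e : Fin 2 × ℕ × ℕ) : ∀ᵐ ω ∂signMeasure, ‖ω e‖ = 1 :=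
  (measurePreserving_eval_signMeasure e).quasiMeasurePreserving.ae ae_signLaw_norm_eq_one

/-- Data matrices with independent random signs as entries. -/
def signArray (p : ℕ → ℕ) (n : ℕ) (k : Fin 2) (ω : Fin 2 × ℕ × ℕ → ℂ) :
    Matrix (Fin (p n)) (Fin n) ℂ :=
  fun i j => ω (k, i, j)

lemma isInnovationArray_signArray (p : ℕ → ℕ) :
    IsInnovationArray signMeasure p (signArray p) where
  measurable_entry n k i j := measurable_pi_apply _
  indep n := by
    have hindep : iIndepFun (fun (e : Fin 2 × ℕ × ℕ) (ω : Fin 2 × ℕ × ℕ → ℂ) => ω e)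
        signMeasure := iIndepFun_infinitePi (X := fun _ e => e) fun _ => measurable_id
    refine hindep.precomp
      (g := fun e : Fin 2 × Fin (p n) × Fin n => (e.1, (e.2.1 : ℕ), (e.2.2 : ℕ))) ?_
    exact Function.injective_id.prodMap (Fin.val_injective.prodMap Fin.val_injective)
  mean_zero n k i j := by
    have hmp := measurePreserving_eval_signMeasure (k, (i : ℕ), (j : ℕ))
    have hmap := integral_map (μ := signMeasure) hmp.measurable.aemeasurable
      (f := fun e : ℂ => e) (by fun_prop)
    rw [hmp.map_eq, integral_signLaw_id] at hmap
    exact hmap.symm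
  variance_one n k i j := by
    have hae : ∀ᵐ ω ∂signMeasure, ‖signArray p n k ω i j‖ ^ 2 = 1 := by
      filter_upwards [ae_signMeasure_norm_eq_one (k, (i : ℕ), (j : ℕ))] with ω hω
      rw [signArray, hω, one_pow]
    simp [integral_congr_ae hae]
  moment_bound := by
    refine ⟨1, one_pos, 1, fun n k i j => ?_⟩
    have hae : ∀ᵐ ω ∂signMeasure, ‖signArray p n k ω i j‖ₑ ^ (2 + 1 : ℝ) = 1 := by
      filter_upwards [ae_signMeasure_norm_eq_one (k, (i : ℕ), (j : ℕ))] with ω hω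
      rw [signArray, ← ofReal_norm, hω, ENNReal.ofReal_one, ENNReal.one_rpow]
    simp [lintegral_congr_ae hae]

theorem exists_solvesCubic {c : ℝ} (hc : 0 < c) :
    ∃ F : ProbabilityMeasure ℝ, SolvesCubic c (F : Measure ℝ) := by
  have hpc : Tendsto (fun n : ℕ => (⌊c * n⌋₊ : ℝ) / n) atTop (𝓝 c) :=
    (tendsto_nat_floor_mul_div_atTop hc.le).comp tendsto_natCast_atTop_atTop
  obtain ⟨ω, hω⟩ :=
    ((isInnovationArray_signArray fun n => ⌊c * n⌋₊).ae_isAsymptoticSolution hc hpc).exists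
  obtain ⟨F, hF, -⟩ := hω.exists_solvesCubic_tendsto_subseq
  exact ⟨F, hF⟩

end Existence

end CommutatorLSD

end

theorem theorem6p1 (c : ℝ) (hc : 0 < c) :
    ∃ F : ProbabilityMeasure ℝ,
      -- `F` is the limiting spectral distribution of every admissible model with ratio `c`
      (∀ (Ω : Type*) [MeasurableSpace Ω] (P : Measure Ω) [IsProbabilityMeasure P] (p : ℕ → ℕ)
        (Z : (n : ℕ) → Fin 2 → Ω → Matrix (Fin (p n)) (Fin n) ℂ),
        Tendsto (fun n : ℕ => (p n : ℝ) / (n : ℝ)) atTop (𝓝 c) →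
        CommutatorLSD.IsInnovationArray P p Z →
        CommutatorLSD.IsLSD P p Z (F : Measure ℝ)) ∧
      -- its distribution function is differentiable off the origin, with the explicit density
      (∀ x : ℝ, x ≠ 0 →
        HasDerivAt (fun t : ℝ => cdf (F : Measure ℝ) t) (CommutatorLSD.density c x) x) ∧
      -- at the origin the derivative exists exactly when `c < 2`
      (DifferentiableAt ℝ (fun t : ℝ => cdf (F : Measure ℝ) t) 0 ↔ c < 2) ∧
      (c < 2 → HasDerivAt (fun t : ℝ => cdf (F : Measure ℝ) t)
        (1 / (Real.pi * √(2 * c - c ^ 2))) 0) ∧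
      -- the density is continuous wherever it exists
      (∀ x : ℝ, DifferentiableAt ℝ (fun t : ℝ => cdf (F : Measure ℝ) t) x →
        ContinuousAt (deriv fun t : ℝ => cdf (F : Measure ℝ) t) x) := by
  obtain ⟨F, hF⟩ := CommutatorLSD.exists_solvesCubic hc
  refine ⟨F, fun Ω _ P _ p Z hpc hZ => hZ.isLSD_of_solvesCubic hc hpc hF, fun x hx => ?_,
    hF.differentiableAt_cdf_zero_iff hc, fun hc2 => hF.hasDerivAt_cdf_zero hc hc2,
    fun x hx => hF.continuousAt_deriv_cdf hc hx⟩
  rw [CommutatorLSD.density_eq_densityFormula hc hx]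
  exact hF.hasDerivAt_cdf hc hx
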